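/- Manifolds are smooth, finite-dimensional, Hausdorff and without boundary. Let $G\rightrightarrows M$ be a Lie groupoid with source $\alpha$, target $\beta$ (both submersions), identity map $1\colon M\to G$, and product $gh$ defined when $\alpha(g)=\beta(h)$. Its Lie algebroid $q\colon AG\to M$ is the vector bundle with fibres $A_mG=\ker T_{1_m}(\alpha)$; let $\iota\colon AG\to TG$ be the inclusion, and let $a=T(\beta)|_{AG}\colon AG\to TM$ be the anchor. Applying the tangent functor to the structure maps gives the tangent groupoid $TG\rightrightarrows TM$; its Lie algebroid $ATG\subseteq T(TG)$ consists of the tangent vectors to $TG$ at points $T(1)(u)$, $u\in TM$, that are annihilated by $T(T(\alpha))$. Let $J_G$ be the canonical involution of $T(TG)$ and $j_G=J_G\circ T(\iota)\colon TAG\to T(TG)$. A multiplicative vector field on $G$ is a pair $(\xi,x)$ of smooth vector fields on $G$ and $M$ such that $\xi\colon G\to TG$ is a morphism of groupoids over $x\colon M\to TM$. For a section $X\in\Gamma AG$ the right-invariant vector field is $\vec X(g)=T(R_g)(X(\beta g))$, where $R_g\colon\alpha^{-1}(\beta g)\to\alpha^{-1}(\alpha g)$, $h\mapsto hg$. A linear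 vector field on a vector bundle $A\to M$ is a pair $(\eta,x)$ of smooth vector fields on $A$ and $M$ such that $\eta\colon A\to TA$ is a morphism of vector bundles from $A\to M$ to $TA\to TM$ over $x$. A covariant differential operator over $x$ is an $\mathbb{R}$-linear map $D\colon\Gamma A\to\Gamma A$ with $D(fX)=fD(X)+x(f)X$ for $f\in C^\infty(M)$. The one corresponding to a linear vector field $(\eta,x)$ is the operator $D_\eta$ on $\Gamma A$ determined by $$\langle\varphi,D_\eta(X)\rangle=x(\langle\varphi,X\rangle)-\eta(\ell_\varphi)\circ X\qquad(\varphi\in\Gamma A^*,\ X\in\Gamma A),$$ where $\ell_\varphi\colon A\to\mathbb{R}$ is the fibrewise linear function defined by $\varphi$. **Theorem.** (1) The map $j_G$ is a bijection of $TAG$ onto $ATG$. Let $(\xi,x)$ be a multiplicative vector field on $G$, and let $A(\xi)=T(\xi)\circ\iota$. Then $A(\xi)$ takes values in $ATG$, and $\tilde\xi=j_G^{-1}\circ A(\xi)$ is a smooth vector field on $AG$ such that $(\tilde\xi,x)$ is linear. There is a unique operator $D_\xi\colon\Gamma AG\to\Gamma AG$ with $\overrightarrow{D_\xi(X)}=[\xi,\vec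 X]$ for all $X\in\Gamma AG$, and there is a unique operator $D_{\tilde\xi}\colon\Gamma AG\to\Gamma AG$ corresponding to $(\tilde\xi,x)$; it is a covariant differential operator over $x$, and $$D_{\tilde\xi}=D_\xi .$$ (2) Let $x$ be a smooth vector field on $M$, and let $M\times M\rightrightarrows M$ be the pair groupoid, with source the second projection and target the first. Then $(x\times x,x)$ is a multiplicative vector field on it. The anchor $a\colon A(M\times M)\to TM$ is a diffeomorphism, and it carries $\widetilde{x\times x}$ to a complete lift $\tilde x$ of $x$, that is, to a smooth vector field $\tilde x$ on $TM$ with $\tilde x(df)=d(x(f))$ for all $f\in C^\infty(M)$, where differentials are regarded as functions on $TM$. The pair $(\tilde x,x)$ is a linear vector field on $TM$, and the operator corresponding to it is the Lie derivative $y\mapsto[x,y]$. Moreover $a(D_{x\times x}(X))=[x,a(X)]$ for all $X\in\Gamma A(M\times M)$. -/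

import Mathlib

open Bundle Set Function VectorField Topology
open scoped Manifold ContDiff Topology

noncomputable section

/-! ### Vector fields, linear vector fields and covariant differential operators -/

section LinearVectorFields

variable
    {E : Type*} [NormedAddCommGroup E] [NormedSpace ℝ E]
    {H : Type*} [TopologicalSpace H] (I : ModelWithCorners ℝ E H)
    {M : Type*} [TopologicalSpace M] [ChartedSpace H M]

/-- A vector field on a manifold is smooth if it is smooth as a map to the tangent bundle. -/
def IsSmoothVectorField [IsManifold I ∞ M] (x : ∀ m : M, TangentSpace I m) : Prop :=
  ContMDiff I I.tangent ∞ (fun m ↦ (⟨m, x m⟩ : TangentBundle I M))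

/-- The derivative `x(f)` of a real function `f` along a vector field `x`. -/
def derivAlong (x : ∀ m : M, TangentSpace I m) (f : M → ℝ) (m : M) : ℝ :=
  mfderiv I 𝓘(ℝ, ℝ) f m (x m)

/-- The differential of a real function, as a function on the tangent bundle. -/
def differentialFun (f : M → ℝ) (v : TangentBundle I M) : ℝ :=
  mfderiv I 𝓘(ℝ, ℝ) f v.1 v.2

/-- The complete lift of a vector field `x` on `M` to the tangent bundle: the vector field `x'`
on `TM` with `x'(df) = d(x(f))` for all smooth functions `f` on `M`, where the differentials are
regarded as functions on `TM`. -/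
structure IsCompleteLift [IsManifold I ∞ M] (x : ∀ m : M, TangentSpace I m)
    (x' : ∀ v : TangentBundle I M, TangentSpace I.tangent v) : Prop where
  smooth : IsSmoothVectorField I.tangent x'
  lift : ∀ f : M → ℝ, ContMDiff I 𝓘(ℝ, ℝ) ∞ f → ∀ v : TangentBundle I M,
    derivAlong I.tangent x' (differentialFun I f) v = differentialFun I (derivAlong I x f) v

/-- The canonical involution of the double tangent bundle. In the coordinates on `TTM` that are
induced by a chart of `M` it is `(p, v; u, w) ↦ (p, u; v, w)`. A tangent vector of `TM` at
`⟨p, v⟩` is, in Mathlib, a pair `(u, w)` of coordinates with respect to the chart of `TM` induced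
by the preferred chart of `M` at `p`, and `v` is given by its coordinates in that same chart. -/
def canonicalInvolution [IsManifold I ∞ M] (Z : TangentBundle I.tangent (TangentBundle I M)) :
    TangentBundle I.tangent (TangentBundle I M) :=
  ⟨⟨Z.1.1, (show E × E from Z.2).1⟩, ((show E from Z.1.2), (show E × E from Z.2).2)⟩

variable
    {F : Type*} [NormedAddCommGroup F] [NormedSpace ℝ F]
    {V : M → Type*} [∀ m, AddCommGroup (V m)] [∀ m, Module ℝ (V m)]
    [∀ m, TopologicalSpace (V m)] [TopologicalSpace (TotalSpace F V)]
    [FiberBundle F V] [VectorBundle ℝ F V]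

/-- A linear vector field on a vector bundle `V → M`: a pair of smooth vector fields `ξ` on the
total space and `x` on `M` such that `ξ` is a morphism of vector bundles from `V → M` to
`TV → TM` over `x`. The addition of `TV → TM` is the tangent map of the addition
`V ⊕ V → V`, and likewise for scalar multiplication. -/
structure IsLinearVectorField [IsManifold I ∞ M] [ContMDiffVectorBundle ∞ F V I]
    (ξ : ∀ a : TotalSpace F V, TangentSpace (I.prod 𝓘(ℝ, F)) a)
    (x : ∀ m : M, TangentSpace I m) : Prop where
  smooth : IsSmoothVectorField (I.prod 𝓘(ℝ, F)) ξ
  smooth_base : IsSmoothVectorField I x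
  proj : ∀ a : TotalSpace F V, mfderiv (I.prod 𝓘(ℝ, F)) I (π F V) a (ξ a) = x a.proj
  add : ∀ (m : M) (X Y : V m),
    ∃ W : TangentSpace (I.prod 𝓘(ℝ, F × F)) (⟨m, (X, Y)⟩ : TotalSpace (F × F) (V ×ᵇ V)),
      mfderiv (I.prod 𝓘(ℝ, F × F)) (I.prod 𝓘(ℝ, F))
        (fun a : TotalSpace (F × F) (V ×ᵇ V) ↦ (⟨a.1, a.2.1⟩ : TotalSpace F V)) ⟨m, (X, Y)⟩ W =
          ξ ⟨m, X⟩ ∧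
      mfderiv (I.prod 𝓘(ℝ, F × F)) (I.prod 𝓘(ℝ, F))
        (fun a : TotalSpace (F × F) (V ×ᵇ V) ↦ (⟨a.1, a.2.2⟩ : TotalSpace F V)) ⟨m, (X, Y)⟩ W =
          ξ ⟨m, Y⟩ ∧
      mfderiv (I.prod 𝓘(ℝ, F × F)) (I.prod 𝓘(ℝ, F))
        (fun a : TotalSpace (F × F) (V ×ᵇ V) ↦ (⟨a.1, a.2.1 + a.2.2⟩ : TotalSpace F V))
        ⟨m, (X, Y)⟩ W = ξ ⟨m, X + Y⟩
  smul : ∀ (t : ℝ) (m : M) (X : V m),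
    mfderiv (I.prod 𝓘(ℝ, F)) (I.prod 𝓘(ℝ, F))
      (fun a : TotalSpace F V ↦ (⟨a.1, t • a.2⟩ : TotalSpace F V)) ⟨m, X⟩ (ξ ⟨m, X⟩) =
        ξ ⟨m, t • X⟩

/-- A covariant differential operator on `V` over the vector field `x`: an `ℝ`-linear operator on
smooth sections with `D(fX) = f D(X) + x(f) X`. -/
structure IsCovariantDifferentialOperator (x : ∀ m : M, TangentSpace I m)
    (D : Cₛ^∞⟮I; F, V⟯ → Cₛ^∞⟮I; F, V⟯) : Prop where
  add : ∀ X Y, D (X + Y) = D X + D Y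
  smul : ∀ (t : ℝ) X, D (t • X) = t • D X
  leibniz : ∀ f : M → ℝ, ContMDiff I 𝓘(ℝ, ℝ) ∞ f → ∀ X Y : Cₛ^∞⟮I; F, V⟯,
    (∀ m, Y m = f m • X m) → ∀ m, D Y m = f m • D X m + derivAlong I x f m • X m

/-- The fibrewise linear function on the total space determined by a section of the dual. -/
def fibrewiseLinear (φ : ∀ m : M, V m →L[ℝ] Trivial M ℝ m) (a : TotalSpace F V) : ℝ :=
  φ a.1 a.2

/-- `D` is the operator on sections of `V` corresponding to the linear vector field `(ξ, x)`:
`⟨φ, D X⟩ = x⟨φ, X⟩ - ξ(ℓ_φ) ∘ X` for all smooth sections `X` of `V` and `φ` of its dual. -/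
def IsOperatorOf [∀ m, IsTopologicalAddGroup (V m)] [∀ m, ContinuousSMul ℝ (V m)]
    (ξ : ∀ a : TotalSpace F V, TangentSpace (I.prod 𝓘(ℝ, F)) a)
    (x : ∀ m : M, TangentSpace I m) (D : Cₛ^∞⟮I; F, V⟯ → Cₛ^∞⟮I; F, V⟯) : Prop :=
  ∀ (φ : Cₛ^∞⟮I; F →L[ℝ] ℝ, fun m ↦ V m →L[ℝ] Trivial M ℝ m⟯) (X : Cₛ^∞⟮I; F, V⟯) (m : M),
    (φ m (D X m) : ℝ) = derivAlong I x (fun m' ↦ φ m' (X m')) m -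
      derivAlong (I.prod 𝓘(ℝ, F)) ξ (fibrewiseLinear φ) ⟨m, X m⟩

end LinearVectorFields

/-- A Lie groupoid `G ⇉ M`. The product `mul g h` is meaningful only if `src g = tgt h`; its values
on other pairs are arbitrary and play no role. The composable pairs form an embedded submanifold of
`G × G`, and `ContMDiffOn` on that set expresses smoothness of the multiplication on it. -/
structure LieGroupoid
    {EG : Type*} [NormedAddCommGroup EG] [NormedSpace ℝ EG]
    {HG : Type*} [TopologicalSpace HG] (IG : ModelWithCorners ℝ EG HG)
    (G : Type*) [TopologicalSpace G] [ChartedSpace HG G]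
    {EM : Type*} [NormedAddCommGroup EM] [NormedSpace ℝ EM]
    {HM : Type*} [TopologicalSpace HM] (IM : ModelWithCorners ℝ EM HM)
    (M : Type*) [TopologicalSpace M] [ChartedSpace HM M] where
  src : G → M
  tgt : G → M
  one : M → G
  inv : G → G
  mul : G → G → G
  src_one : ∀ m, src (one m) = m
  tgt_one : ∀ m, tgt (one m) = m
  src_mul : ∀ g h, src g = tgt h → src (mul g h) = src h
  tgt_mul : ∀ g h, src g = tgt h → tgt (mul g h) = tgt g
  mul_assoc : ∀ g h k, src g = tgt h → src h = tgt k → mul (mul g h) k = mul g (mul h k)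
  one_mul : ∀ g, mul (one (tgt g)) g = g
  mul_one : ∀ g, mul g (one (src g)) = g
  src_inv : ∀ g, src (inv g) = tgt g
  tgt_inv : ∀ g, tgt (inv g) = src g
  inv_mul : ∀ g, mul (inv g) g = one (src g)
  mul_inv : ∀ g, mul g (inv g) = one (tgt g)
  contMDiff_src : ContMDiff IG IM ∞ src
  contMDiff_tgt : ContMDiff IG IM ∞ tgt
  contMDiff_one : ContMDiff IM IG ∞ one
  contMDiff_inv : ContMDiff IG IG ∞ inv
  src_submersion : ∀ g, Surjective (mfderiv IG IM src g)
  tgt_submersion : ∀ g, Surjective (mfderiv IG IM tgt g)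
  contMDiffOn_mul :
    ContMDiffOn (IG.prod IG) IG ∞ (fun p : G × G ↦ mul p.1 p.2) {p | src p.1 = tgt p.2}


namespace LieGroupoid

/-- A family of linear maps out of a finite-dimensional space is smooth if it is pointwise. -/
theorem contMDiffOn_clm_of_apply
    {E : Type*} [NormedAddCommGroup E] [NormedSpace ℝ E]
    {H : Type*} [TopologicalSpace H] {I : ModelWithCorners ℝ E H}
    {N : Type*} [TopologicalSpace N] [ChartedSpace H N]
    {V : Type*} [NormedAddCommGroup V] [NormedSpace ℝ V] [FiniteDimensional ℝ V]
    {W : Type*} [NormedAddCommGroup W] [NormedSpace ℝ W]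
    {f : N → V →L[ℝ] W} {s : Set N}
    (h : ∀ v, ContMDiffOn I 𝓘(ℝ, W) ∞ (fun x ↦ f x v) s) :
    ContMDiffOn I 𝓘(ℝ, V →L[ℝ] W) ∞ f s := by
  classical
  let b := Module.finBasis ℝ V
  have key : f = fun x ↦ ∑ i, ContinuousLinearMap.smulRightL ℝ V W
      (LinearMap.toContinuousLinearMap (b.coord i)) (f x (b i)) := by
    funext x
    ext v
    conv_lhs => rw [← b.sum_repr v, map_sum]
    simp
  rw [key]
  refine contMDiffOn_finsetSum fun i _ ↦ ?_
  exact (ContinuousLinearMap.contMDiff _).comp_contMDiffOn (h (b i))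

section Algebroid

variable
    {EG : Type*} [NormedAddCommGroup EG] [NormedSpace ℝ EG]
    {HG : Type*} [TopologicalSpace HG] {IG : ModelWithCorners ℝ EG HG}
    {G : Type*} [TopologicalSpace G] [ChartedSpace HG G]
    {EM : Type*} [NormedAddCommGroup EM] [NormedSpace ℝ EM]
    {HM : Type*} [TopologicalSpace HM] {IM : ModelWithCorners ℝ EM HM}
    {M : Type*} [TopologicalSpace M] [ChartedSpace HM M]
    (𝒢 : LieGroupoid IG G IM M)

/-- The fibre over `m` of the Lie algebroid: the tangent space at `1_m` of the source fibre. -/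
def Algebroid (m : M) : Type _ :=
  ↥(LinearMap.ker (mfderiv IG IM 𝒢.src (𝒢.one m)).toLinearMap)

instance (m : M) : AddCommGroup (𝒢.Algebroid m) :=
  inferInstanceAs (AddCommGroup ↥(LinearMap.ker (mfderiv IG IM 𝒢.src (𝒢.one m)).toLinearMap))

instance (m : M) : Module ℝ (𝒢.Algebroid m) :=
  inferInstanceAs (Module ℝ ↥(LinearMap.ker (mfderiv IG IM 𝒢.src (𝒢.one m)).toLinearMap))

instance (m : M) : TopologicalSpace (𝒢.Algebroid m) :=
  inferInstanceAs
    (TopologicalSpace ↥(LinearMap.ker (mfderiv IG IM 𝒢.src (𝒢.one m)).toLinearMap))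

instance (m : M) : IsTopologicalAddGroup (𝒢.Algebroid m) :=
  inferInstanceAs
    (IsTopologicalAddGroup ↥(LinearMap.ker (mfderiv IG IM 𝒢.src (𝒢.one m)).toLinearMap))

instance (m : M) : ContinuousSMul ℝ (𝒢.Algebroid m) :=
  inferInstanceAs
    (ContinuousSMul ℝ ↥(LinearMap.ker (mfderiv IG IM 𝒢.src (𝒢.one m)).toLinearMap))

/-- The inclusion of a fibre of the Lie algebroid into the tangent space of `G`. -/
def incl (m : M) : 𝒢.Algebroid m →L[ℝ] TangentSpace IG (𝒢.one m) :=
  (LinearMap.ker (mfderiv IG IM 𝒢.src (𝒢.one m)).toLinearMap).subtypeL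

theorem incl_injective (m : M) : Injective (𝒢.incl m) := Subtype.val_injective

/-- A tangent vector at `1_m` that is killed by the source derivative, as an element of the Lie
algebroid. -/
def mkAlgebroid (m : M) (v : TangentSpace IG (𝒢.one m))
    (hv : mfderiv IG IM 𝒢.src (𝒢.one m) v = 0) : 𝒢.Algebroid m :=
  Subtype.mk v hv

theorem incl_mkAlgebroid (m : M) (v : TangentSpace IG (𝒢.one m))
    (hv : mfderiv IG IM 𝒢.src (𝒢.one m) v = 0) : 𝒢.incl m (𝒢.mkAlgebroid m v hv) = v := rfl

theorem mfderiv_src_incl (m : M) (a : 𝒢.Algebroid m) :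
    mfderiv IG IM 𝒢.src (𝒢.one m) (𝒢.incl m a) = 0 := a.2

variable (EG EM) in
/-- The model fibre of the Lie algebroid. -/
abbrev AlgebroidModel : Type :=
  Fin (Module.finrank ℝ EG - Module.finrank ℝ EM) → ℝ

variable [IsManifold IG ∞ G] [IsManifold IM ∞ M]
  [FiniteDimensional ℝ EG] [FiniteDimensional ℝ EM]

/-- The tangent map of the source projection along the identities, in the trivializations of the
tangent bundles determined by the point `m₀`. -/
def srcCoord (m₀ m : M) : EG →L[ℝ] EM :=
  ((trivializationAt EM (TangentSpace IM) (𝒢.src (𝒢.one m₀))).continuousLinearMapAt ℝ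
      (𝒢.src (𝒢.one m))) ∘L (mfderiv IG IM 𝒢.src (𝒢.one m)) ∘L
    ((trivializationAt EG (TangentSpace IG) (𝒢.one m₀)).symmL ℝ (𝒢.one m))

/-- The points over which the trivializations in `srcCoord` are defined. -/
def coordDomain (m₀ : M) : Set M :=
  𝒢.one ⁻¹' (trivializationAt EG (TangentSpace IG) (𝒢.one m₀)).baseSet ∩
    (fun m ↦ 𝒢.src (𝒢.one m)) ⁻¹'
      (trivializationAt EM (TangentSpace IM) (𝒢.src (𝒢.one m₀))).baseSet

theorem isOpen_coordDomain (m₀ : M) : IsOpen (𝒢.coordDomain m₀) :=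
  ((trivializationAt EG (TangentSpace IG) (𝒢.one m₀)).open_baseSet.preimage
    𝒢.contMDiff_one.continuous).inter
  ((trivializationAt EM (TangentSpace IM) (𝒢.src (𝒢.one m₀))).open_baseSet.preimage
    (𝒢.contMDiff_src.continuous.comp 𝒢.contMDiff_one.continuous))

theorem mem_coordDomain (m₀ : M) : m₀ ∈ 𝒢.coordDomain m₀ :=
  ⟨mem_baseSet_trivializationAt EG (TangentSpace IG) (𝒢.one m₀),
    mem_baseSet_trivializationAt EM (TangentSpace IM) (𝒢.src (𝒢.one m₀))⟩

theorem contMDiffOn_srcCoord (m₀ : M) :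
    ContMDiffOn IM 𝓘(ℝ, EG →L[ℝ] EM) ∞ (𝒢.srcCoord m₀) (𝒢.coordDomain m₀) := by
  refine contMDiffOn_clm_of_apply fun v ↦ ?_
  set e := trivializationAt EG (TangentSpace IG) (𝒢.one m₀) with he
  set e' := trivializationAt EM (TangentSpace IM) (𝒢.src (𝒢.one m₀)) with he'
  have h1 : ContMDiffOn IM (IG.prod 𝓘(ℝ, EG)) ∞ (fun m ↦ (𝒢.one m, v)) (𝒢.coordDomain m₀) :=
    (𝒢.contMDiff_one.prodMk contMDiff_const).contMDiffOn
  have h2 : ContMDiffOn IM (IG.prod 𝓘(ℝ, EG)) ∞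
      (fun m ↦ e.toOpenPartialHomeomorph.symm (𝒢.one m, v)) (𝒢.coordDomain m₀) := by
    refine (e.contMDiffOn_symm (IB := IG) (n := ∞)).comp h1 ?_
    intro m hm
    exact e.mem_target.2 hm.1
  have h3 := (𝒢.contMDiff_src.contMDiff_tangentMap (m := ∞) (by simp)).comp_contMDiffOn h2
  have h4 := (e'.contMDiffOn (IB := IM) (n := ∞)).comp h3 (by
    intro m hm
    rw [mem_preimage, e'.mem_source]
    have : (e.toOpenPartialHomeomorph.symm (𝒢.one m, v)).proj = 𝒢.one m :=
      e.proj_symm_apply' hm.1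
    change 𝒢.src (e.toOpenPartialHomeomorph.symm (𝒢.one m, v)).proj ∈ _
    rw [this]
    exact hm.2)
  have h5 := contMDiff_snd.comp_contMDiffOn h4
  refine h5.congr fun m hm ↦ ?_
  simp only [srcCoord, comp_apply, ContinuousLinearMap.comp_apply]
  rw [← e.mk_symm hm.1 v]
  rw [Trivialization.symmL_apply (R := ℝ) _ hm.1]
  exact Trivialization.continuousLinearMapAt_apply_of_mem ℝ e' hm.2
    (mfderiv IG IM 𝒢.src (𝒢.one m) (e.symm (𝒢.one m) v))

/-- Linear algebra: a surjection between finite-dimensional spaces can be completed to an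
isomorphism by a map to the model fibre. -/
theorem exists_completion (L : EG →L[ℝ] EM) (hL : Surjective L) :
    ∃ Q : EG →L[ℝ] AlgebroidModel EG EM, (L.prod Q).IsInvertible := by
  obtain ⟨K, hK⟩ := Submodule.exists_isCompl (LinearMap.ker L.toLinearMap)
  have hr : Module.finrank ℝ (LinearMap.ker L.toLinearMap) =
      Module.finrank ℝ (AlgebroidModel EG EM) := by
    have h1 := LinearMap.finrank_range_add_finrank_ker L.toLinearMap
    rw [LinearMap.range_eq_top.2 hL, finrank_top] at h1
    simp only [AlgebroidModel, Module.finrank_fin_fun]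
    omega
  let ε := LinearEquiv.ofFinrankEq _ _ hr
  let q : EG →ₗ[ℝ] AlgebroidModel EG EM :=
    ε.toLinearMap ∘ₗ (LinearMap.ker L.toLinearMap).projectionOnto K hK
  refine ⟨LinearMap.toContinuousLinearMap q, ?_⟩
  set T : EG →L[ℝ] EM × AlgebroidModel EG EM := L.prod (LinearMap.toContinuousLinearMap q) with hT
  have hinj : Injective T := by
    rw [injective_iff_map_eq_zero]
    intro v hv
    have hv1 : L v = 0 := congrArg Prod.fst hv
    have hv2 : ε ((LinearMap.ker L.toLinearMap).projectionOnto K hK v) = 0 := congrArg Prod.snd hv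
    have hv3 := ε.map_eq_zero_iff.1 hv2
    have := Submodule.projectionOnto_apply_left hK (⟨v, hv1⟩ : LinearMap.ker L.toLinearMap)
    rw [hv3] at this
    exact (congrArg Subtype.val this).symm
  have hfr : Module.finrank ℝ EG = Module.finrank ℝ (EM × AlgebroidModel EG EM) := by
    have h1 := LinearMap.finrank_range_add_finrank_ker L.toLinearMap
    rw [LinearMap.range_eq_top.2 hL, finrank_top] at h1
    rw [Module.finrank_prod, ← hr]
    omega
  refine ⟨(LinearEquiv.ofInjectiveOfFinrankEq T.toLinearMap hinj hfr).toContinuousLinearEquiv, ?_⟩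
  ext v <;> rfl

theorem surjective_srcCoord (m₀ : M) : Surjective (𝒢.srcCoord m₀ m₀) := by
  have h := 𝒢.mem_coordDomain m₀
  intro w
  obtain ⟨u, hu⟩ := 𝒢.src_submersion (𝒢.one m₀)
    ((trivializationAt EM (TangentSpace IM) (𝒢.src (𝒢.one m₀))).symmL ℝ (𝒢.src (𝒢.one m₀)) w)
  refine ⟨(trivializationAt EG (TangentSpace IG) (𝒢.one m₀)).continuousLinearMapAt ℝ
    (𝒢.one m₀) u, ?_⟩
  simp only [srcCoord, ContinuousLinearMap.comp_apply]
  rw [Trivialization.symmL_continuousLinearMapAt _ h.1, hu,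
    Trivialization.continuousLinearMapAt_symmL _ h.2]

/-- A chosen complementary coordinate map at `m₀`. -/
def fibreCoord (m₀ : M) : EG →L[ℝ] AlgebroidModel EG EM :=
  Classical.choose (exists_completion _ (𝒢.surjective_srcCoord m₀))

/-- The source derivative together with the fibre coordinate. -/
def frame (m₀ m : M) : EG →L[ℝ] EM × AlgebroidModel EG EM :=
  (𝒢.srcCoord m₀ m).prod (𝒢.fibreCoord m₀)

/-- The domain of the local trivialization of the Lie algebroid around `m₀`. -/
def trivDomain (m₀ : M) : Set M :=
  𝒢.coordDomain m₀ ∩ {m | (𝒢.frame m₀ m).IsInvertible}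

theorem mem_trivDomain (m₀ : M) : m₀ ∈ 𝒢.trivDomain m₀ :=
  ⟨𝒢.mem_coordDomain m₀,
    Classical.choose_spec (exists_completion _ (𝒢.surjective_srcCoord m₀))⟩

theorem contMDiffOn_frame (m₀ : M) :
    ContMDiffOn IM 𝓘(ℝ, EG →L[ℝ] EM × AlgebroidModel EG EM) ∞ (𝒢.frame m₀)
      (𝒢.coordDomain m₀) := by
  refine contMDiffOn_clm_of_apply fun v ↦ ?_
  exact ((𝒢.contMDiffOn_srcCoord m₀).clm_apply contMDiffOn_const).prodMk_space contMDiffOn_const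

theorem isOpen_trivDomain (m₀ : M) : IsOpen (𝒢.trivDomain m₀) := by
  have : 𝒢.trivDomain m₀ = 𝒢.coordDomain m₀ ∩ 𝒢.frame m₀ ⁻¹'
      range ContinuousLinearEquiv.toContinuousLinearMap := rfl
  rw [this]
  exact (𝒢.contMDiffOn_frame m₀).continuousOn.isOpen_inter_preimage
    (𝒢.isOpen_coordDomain m₀) ContinuousLinearEquiv.isOpen

/-- The vector of `T_{1_m}G` with fibre coordinate `f` and source derivative zero. -/
def fromFibreAux (m₀ m : M) (f : AlgebroidModel EG EM) : TangentSpace IG (𝒢.one m) :=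
  (trivializationAt EG (TangentSpace IG) (𝒢.one m₀)).symmL ℝ (𝒢.one m)
    ((𝒢.frame m₀ m).inverse (0, f))

theorem frame_inverse {m₀ m : M} (hm : m ∈ 𝒢.trivDomain m₀)
    (p : EM × AlgebroidModel EG EM) : 𝒢.frame m₀ m ((𝒢.frame m₀ m).inverse p) = p := by
  obtain ⟨T, hT⟩ := hm.2
  rw [← hT]
  simp

theorem inverse_frame {m₀ m : M} (hm : m ∈ 𝒢.trivDomain m₀) (v : EG) :
    (𝒢.frame m₀ m).inverse (𝒢.frame m₀ m v) = v := by
  obtain ⟨T, hT⟩ := hm.2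
  rw [← hT]
  simp

theorem mfderiv_src_fromFibreAux {m₀ m : M} (hm : m ∈ 𝒢.trivDomain m₀)
    (f : AlgebroidModel EG EM) :
    mfderiv IG IM 𝒢.src (𝒢.one m) (𝒢.fromFibreAux m₀ m f) = 0 := by
  have h : 𝒢.srcCoord m₀ m ((𝒢.frame m₀ m).inverse (0, f)) = 0 :=
    congrArg Prod.fst (𝒢.frame_inverse hm (0, f))
  rw [← Trivialization.symmL_continuousLinearMapAt
    (trivializationAt EM (TangentSpace IM) (𝒢.src (𝒢.one m₀))) (R := ℝ) hm.1.2
    (mfderiv IG IM 𝒢.src (𝒢.one m) (𝒢.fromFibreAux m₀ m f))]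
  have h' : (trivializationAt EM (TangentSpace IM) (𝒢.src (𝒢.one m₀))).continuousLinearMapAt ℝ
      (𝒢.src (𝒢.one m)) (mfderiv IG IM 𝒢.src (𝒢.one m) (𝒢.fromFibreAux m₀ m f)) = 0 := h
  rw [h', map_zero]

/-- The fibre coordinate on the Lie algebroid, as a linear map on each fibre. -/
def toFibre (m₀ m : M) : 𝒢.Algebroid m →L[ℝ] AlgebroidModel EG EM :=
  𝒢.fibreCoord m₀ ∘L (trivializationAt EG (TangentSpace IG) (𝒢.one m₀)).continuousLinearMapAt ℝ
    (𝒢.one m) ∘L 𝒢.incl m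

open Classical in
/-- The inverse of `toFibre`. -/
def fromFibre (m₀ m : M) (f : AlgebroidModel EG EM) : 𝒢.Algebroid m :=
  if hm : m ∈ 𝒢.trivDomain m₀ then
    𝒢.mkAlgebroid m (𝒢.fromFibreAux m₀ m f) (𝒢.mfderiv_src_fromFibreAux hm f)
  else 0

theorem incl_fromFibre {m₀ m : M} (hm : m ∈ 𝒢.trivDomain m₀) (f : AlgebroidModel EG EM) :
    𝒢.incl m (𝒢.fromFibre m₀ m f) = 𝒢.fromFibreAux m₀ m f := by
  rw [fromFibre, dif_pos hm]
  rfl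

theorem toFibre_fromFibre {m₀ m : M} (hm : m ∈ 𝒢.trivDomain m₀) (f : AlgebroidModel EG EM) :
    𝒢.toFibre m₀ m (𝒢.fromFibre m₀ m f) = f := by
  simp only [toFibre, ContinuousLinearMap.comp_apply]
  rw [𝒢.incl_fromFibre hm, fromFibreAux, Trivialization.continuousLinearMapAt_symmL _ hm.1.1]
  exact congrArg Prod.snd (𝒢.frame_inverse hm (0, f))

theorem fromFibre_toFibre {m₀ m : M} (hm : m ∈ 𝒢.trivDomain m₀) (a : 𝒢.Algebroid m) :
    𝒢.fromFibre m₀ m (𝒢.toFibre m₀ m a) = a := by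
  apply 𝒢.incl_injective
  rw [𝒢.incl_fromFibre hm, fromFibreAux]
  have h : 𝒢.frame m₀ m ((trivializationAt EG (TangentSpace IG) (𝒢.one m₀)).continuousLinearMapAt ℝ
      (𝒢.one m) (𝒢.incl m a)) = (0, 𝒢.toFibre m₀ m a) := by
    refine Prod.ext ?_ rfl
    change 𝒢.srcCoord m₀ m _ = 0
    simp only [srcCoord, ContinuousLinearMap.comp_apply]
    rw [Trivialization.symmL_continuousLinearMapAt _ hm.1.1, mfderiv_src_incl, map_zero]
  rw [← h, 𝒢.inverse_frame hm, Trivialization.symmL_continuousLinearMapAt _ hm.1.1]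

/-- The local trivialization of the Lie algebroid around `m₀`. -/
def preTriv (m₀ : M) :
    Pretrivialization (AlgebroidModel EG EM) (π (AlgebroidModel EG EM) 𝒢.Algebroid) where
  toFun a := (a.1, 𝒢.toFibre m₀ a.1 a.2)
  invFun p := ⟨p.1, 𝒢.fromFibre m₀ p.1 p.2⟩
  source := π (AlgebroidModel EG EM) 𝒢.Algebroid ⁻¹' 𝒢.trivDomain m₀
  target := 𝒢.trivDomain m₀ ×ˢ univ
  map_source' _ ha := ⟨ha, mem_univ _⟩
  map_target' _ hp := hp.1
  left_inv' a ha := by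
    change (⟨a.1, _⟩ : TotalSpace (AlgebroidModel EG EM) 𝒢.Algebroid) = a
    rw [𝒢.fromFibre_toFibre ha]
  right_inv' p hp := Prod.ext rfl (𝒢.toFibre_fromFibre hp.1 p.2)
  open_target := (𝒢.isOpen_trivDomain m₀).prod isOpen_univ
  baseSet := 𝒢.trivDomain m₀
  open_baseSet := 𝒢.isOpen_trivDomain m₀
  source_eq := rfl
  target_eq := rfl
  proj_toFun _ _ := rfl

theorem preTriv_symm {m₀ m : M} (hm : m ∈ 𝒢.trivDomain m₀) (f : AlgebroidModel EG EM) :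
    (𝒢.preTriv m₀).symm m f = 𝒢.fromFibre m₀ m f :=
  (𝒢.preTriv m₀).symm_apply hm f

theorem exists_coordChange (m₀ m₁ : M) :
    ∃ c : M → AlgebroidModel EG EM →L[ℝ] AlgebroidModel EG EM,
      ContMDiffOn IM 𝓘(ℝ, AlgebroidModel EG EM →L[ℝ] AlgebroidModel EG EM) ∞ c
        (𝒢.trivDomain m₀ ∩ 𝒢.trivDomain m₁) ∧
      ∀ m ∈ 𝒢.trivDomain m₀ ∩ 𝒢.trivDomain m₁, ∀ f,
        c m f = (𝒢.preTriv m₁ ⟨m, (𝒢.preTriv m₀).symm m f⟩).2 := by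
  set e₀ := trivializationAt EG (TangentSpace IG) (𝒢.one m₀)
  set e₁ := trivializationAt EG (TangentSpace IG) (𝒢.one m₁)
  refine ⟨fun m ↦ 𝒢.fibreCoord m₁ ∘L (e₀.coordChangeL ℝ e₁ (𝒢.one m) : EG →L[ℝ] EG) ∘L
    (𝒢.frame m₀ m).inverse ∘L ContinuousLinearMap.inr ℝ EM (AlgebroidModel EG EM), ?_, ?_⟩
  · have h1 : ContMDiffOn IM 𝓘(ℝ, EG →L[ℝ] EG) ∞
        (fun m ↦ (e₀.coordChangeL ℝ e₁ (𝒢.one m) : EG →L[ℝ] EG))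
        (𝒢.trivDomain m₀ ∩ 𝒢.trivDomain m₁) :=
      (contMDiffOn_coordChangeL (IB := IG) (n := ∞) e₀ e₁).comp
        𝒢.contMDiff_one.contMDiffOn fun m hm ↦ ⟨hm.1.1.1, hm.2.1.1⟩
    have h2 : ContMDiffOn IM 𝓘(ℝ, EM × AlgebroidModel EG EM →L[ℝ] EG) ∞
        (fun m ↦ (𝒢.frame m₀ m).inverse) (𝒢.trivDomain m₀ ∩ 𝒢.trivDomain m₁) := by
      intro m hm
      have hi : ContDiffAt ℝ ∞ ContinuousLinearMap.inverse (𝒢.frame m₀ m) :=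
        ContinuousLinearMap.IsInvertible.contDiffAt_map_inverse hm.1.2
      exact hi.contMDiffAt.comp_contMDiffWithinAt m
        (((𝒢.contMDiffOn_frame m₀) m hm.1.1).mono fun x hx ↦ hx.1.1)
    exact contMDiffOn_const.clm_comp (h1.clm_comp (h2.clm_comp contMDiffOn_const))
  · intro m hm f
    rw [𝒢.preTriv_symm hm.1]
    change _ = 𝒢.toFibre m₁ m (𝒢.fromFibre m₀ m f)
    simp only [toFibre, ContinuousLinearMap.comp_apply]
    rw [𝒢.incl_fromFibre hm.1, fromFibreAux]
    rw [Trivialization.symmL_apply (R := ℝ) _ hm.1.1.1,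
      Trivialization.continuousLinearMapAt_apply_of_mem ℝ _ hm.2.1.1]
    congr 1
    exact Trivialization.coordChangeL_apply e₀ e₁ (R := ℝ) ⟨hm.1.1.1, hm.2.1.1⟩ _

/-- The local trivializations assemble to a vector bundle. -/
def preBundle : VectorPrebundle ℝ (AlgebroidModel EG EM) 𝒢.Algebroid where
  pretrivializationAtlas := range 𝒢.preTriv
  pretrivialization_linear' := by
    rintro _ ⟨m₀, rfl⟩
    exact ⟨fun m _ ↦ ⟨fun a b ↦ map_add (𝒢.toFibre m₀ m) a b,
      fun c a ↦ map_smul (𝒢.toFibre m₀ m) c a⟩⟩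
  pretrivializationAt := 𝒢.preTriv
  mem_base_pretrivializationAt := 𝒢.mem_trivDomain
  pretrivialization_mem_atlas m := mem_range_self m
  exists_coordChange := by
    rintro _ ⟨m₀, rfl⟩ _ ⟨m₁, rfl⟩
    obtain ⟨c, hc, h⟩ := 𝒢.exists_coordChange m₀ m₁
    exact ⟨c, hc.continuousOn, h⟩
  totalSpaceMk_isInducing m := by
    have h := 𝒢.mem_trivDomain m
    have hinv : Continuous (𝒢.fromFibre m m) := by
      refine (IsInducing.subtypeVal.continuous_iff (f := 𝒢.fromFibre m m)).2 ?_
      have : Continuous (𝒢.fromFibreAux m m) := by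
        unfold fromFibreAux
        fun_prop
      exact this.congr fun f ↦ (𝒢.incl_fromFibre h f).symm
    let Φ : 𝒢.Algebroid m ≃ₜ AlgebroidModel EG EM :=
      { toFun := 𝒢.toFibre m m
        invFun := 𝒢.fromFibre m m
        left_inv := 𝒢.fromFibre_toFibre h
        right_inv := 𝒢.toFibre_fromFibre h
        continuous_toFun := (𝒢.toFibre m m).continuous
        continuous_invFun := hinv }
    exact (isEmbedding_prodMkRight m).isInducing.comp Φ.isInducing

instance : TopologicalSpace (TotalSpace (AlgebroidModel EG EM) 𝒢.Algebroid) :=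
  𝒢.preBundle.totalSpaceTopology

instance : FiberBundle (AlgebroidModel EG EM) 𝒢.Algebroid := 𝒢.preBundle.toFiberBundle

instance : VectorBundle ℝ (AlgebroidModel EG EM) 𝒢.Algebroid := 𝒢.preBundle.toVectorBundle

instance : 𝒢.preBundle.IsContMDiff IM ∞ where
  exists_contMDiffCoordChange := by
    rintro _ ⟨m₀, rfl⟩ _ ⟨m₁, rfl⟩
    exact 𝒢.exists_coordChange m₀ m₁

instance : ContMDiffVectorBundle ∞ (AlgebroidModel EG EM) 𝒢.Algebroid IM :=
  𝒢.preBundle.contMDiffVectorBundle IM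

/-- The inclusion of the total space of the Lie algebroid into `TG`. -/
def totalIncl (a : TotalSpace (AlgebroidModel EG EM) 𝒢.Algebroid) : TangentBundle IG G :=
  ⟨𝒢.one a.1, 𝒢.incl a.1 a.2⟩

/-- The Lie algebroid of the tangent groupoid `TG ⇉ TM`, as a subset of `TTG`: the tangent
vectors at the identities `T(1)(u)` of `TG` that are killed by the derivative of the source
projection `T(src)` of `TG`. -/
def tangentAlgebroid : Set (TangentBundle IG.tangent (TangentBundle IG G)) :=
  {Z | (∃ u : TangentBundle IM M, Z.1 = tangentMap IM IG 𝒢.one u) ∧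
    mfderiv IG.tangent IM.tangent (tangentMap IG IM 𝒢.src) Z.1 Z.2 = 0}

/-- The canonical map `j` from the tangent bundle of the Lie algebroid `AG` to the Lie algebroid
of `TG`: the restriction of the canonical involution of `TTG`. -/
def jMap (w : TangentBundle (IM.prod 𝓘(ℝ, AlgebroidModel EG EM))
      (TotalSpace (AlgebroidModel EG EM) 𝒢.Algebroid)) :
    TangentBundle IG.tangent (TangentBundle IG G) :=
  canonicalInvolution IG
    (tangentMap (IM.prod 𝓘(ℝ, AlgebroidModel EG EM)) IG.tangent 𝒢.totalIncl w)

/-- A multiplicative vector field `(ξ, x)` on a Lie groupoid: smooth vector fields on `G` and `M`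
such that `ξ : G → TG` is a morphism of groupoids over `x : M → TM`. The structure maps of `TG`
are the tangent maps of those of `G`; the product of `ξ g` and `ξ h` is the derivative of the
multiplication along the tangent vector `(ξ g, ξ h)` of the submanifold of composable pairs. -/
structure IsMultiplicative (ξ : ∀ g : G, TangentSpace IG g) (x : ∀ m : M, TangentSpace IM m) :
    Prop where
  smooth : IsSmoothVectorField IG ξ
  smooth_base : IsSmoothVectorField IM x
  src : ∀ g, mfderiv IG IM 𝒢.src g (ξ g) = x (𝒢.src g)
  tgt : ∀ g, mfderiv IG IM 𝒢.tgt g (ξ g) = x (𝒢.tgt g)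
  one : ∀ m, mfderiv IM IG 𝒢.one m (x m) = ξ (𝒢.one m)
  mul : ∀ g h, 𝒢.src g = 𝒢.tgt h →
    mfderivWithin (IG.prod IG) IG (fun p : G × G ↦ 𝒢.mul p.1 p.2)
      {p | 𝒢.src p.1 = 𝒢.tgt p.2} (g, h) (ξ g, ξ h) = ξ (𝒢.mul g h)

/-- The Lie functor applied to `ξ : G → TG`: the restriction of `T(ξ)` to `AG`. -/
def lieFunctor (ξ : ∀ g : G, TangentSpace IG g)
    (a : TotalSpace (AlgebroidModel EG EM) 𝒢.Algebroid) :
    TangentBundle IG.tangent (TangentBundle IG G) :=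
  tangentMap IG IG.tangent (fun g ↦ (⟨g, ξ g⟩ : TangentBundle IG G)) (𝒢.totalIncl a)

/-- `ξ'` is the vector field `j⁻¹ ∘ A(ξ)` on the Lie algebroid. -/
def IsLieLift (ξ : ∀ g : G, TangentSpace IG g)
    (ξ' : ∀ a : TotalSpace (AlgebroidModel EG EM) 𝒢.Algebroid,
      TangentSpace (IM.prod 𝓘(ℝ, AlgebroidModel EG EM)) a) : Prop :=
  ∀ a, 𝒢.jMap ⟨a, ξ' a⟩ = 𝒢.lieFunctor ξ a

/-- The right-invariant vector field of a section `X` of the Lie algebroid: its value at `g` is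
the image of `X (tgt g)` under the tangent map of the right translation `h ↦ h g`, which is
defined on the source fibre through `1_{tgt g}`. -/
def rightInvariant (X : ∀ m, 𝒢.Algebroid m) (g : G) : TangentSpace IG g :=
  𝒢.one_mul g ▸ mfderivWithin IG IG (fun h ↦ 𝒢.mul h g) {h | 𝒢.src h = 𝒢.tgt g}
    (𝒢.one (𝒢.tgt g)) (𝒢.incl (𝒢.tgt g) (X (𝒢.tgt g)))

/-- `D` is the operator `D_ξ`: the right-invariant vector field of `D X` is the Lie bracket of `ξ`
with the right-invariant vector field of `X`. -/
def IsBracketOperator (ξ : ∀ g : G, TangentSpace IG g)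
    (D : Cₛ^∞⟮IM; AlgebroidModel EG EM, 𝒢.Algebroid⟯ →
      Cₛ^∞⟮IM; AlgebroidModel EG EM, 𝒢.Algebroid⟯) : Prop :=
  ∀ X g, 𝒢.rightInvariant (D X) g = mlieBracket IG ξ (𝒢.rightInvariant X) g

/-- The anchor of the Lie algebroid: the derivative of the target projection. -/
def anchor (m : M) (a : 𝒢.Algebroid m) : TangentSpace IM m :=
  𝒢.tgt_one m ▸ mfderiv IG IM 𝒢.tgt (𝒢.one m) (𝒢.incl m a)

end Algebroid
end LieGroupoid

section PairGroupoid

variable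
    {E : Type*} [NormedAddCommGroup E] [NormedSpace ℝ E]
    {H : Type*} [TopologicalSpace H] (I : ModelWithCorners ℝ E H)
    (M : Type*) [TopologicalSpace M] [ChartedSpace H M]

/-- The pair groupoid `M × M ⇉ M`, with source the second and target the first projection. -/
def pairGroupoid : LieGroupoid (I.prod I) (M × M) I M where
  src := Prod.snd
  tgt := Prod.fst
  one m := (m, m)
  inv p := (p.2, p.1)
  mul p q := (p.1, q.2)
  src_one _ := rfl
  tgt_one _ := rfl
  src_mul _ _ _ := rfl
  tgt_mul _ _ _ := rfl
  mul_assoc _ _ _ _ _ := rfl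
  one_mul _ := rfl
  mul_one _ := rfl
  src_inv _ := rfl
  tgt_inv _ := rfl
  inv_mul _ := rfl
  mul_inv _ := rfl
  contMDiff_src := contMDiff_snd
  contMDiff_tgt := contMDiff_fst
  contMDiff_one := contMDiff_id.prodMk contMDiff_id
  contMDiff_inv := contMDiff_snd.prodMk contMDiff_fst
  src_submersion g := by
    rw [mfderiv_snd]
    exact fun v ↦ ⟨(0, v), rfl⟩
  tgt_submersion g := by
    rw [mfderiv_fst]
    exact fun v ↦ ⟨(v, 0), rfl⟩
  contMDiffOn_mul :=
    ((contMDiff_fst.comp contMDiff_fst).prodMk (contMDiff_snd.comp contMDiff_snd)).contMDiffOn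

variable {M}

/-- The vector field `x × x` on `M × M`. -/
def pairField (x : ∀ m : M, TangentSpace I m) (p : M × M) : TangentSpace (I.prod I) p :=
  (x p.1, x p.2)

end PairGroupoid

end

/-!
Since `α` is a submersion, a vector tangent to `TG` at a unit comes from `TAG` as soon as
`T(T(α))` annihilates it. A multiplicative field `ξ` is `α`-related to `x`, so `A(ξ)` takes values
in `ATG`, and the resulting field on `AG` is linear: over `m` its fibre component is an
endomorphism `K m`, the derivative of `ξ` along the source fibre at `1 m`.

On composable pairs the product of `G` relates `ξ × ξ` to `ξ` and `X⃗ × 0` to `X⃗`, and both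
product fields are tangent to the composable pairs. Hence the product relates
`[ξ × ξ, X⃗ × 0] = [ξ, X⃗] × 0` to `[ξ, X⃗]`, so `[ξ, X⃗]` is right-invariant. Its value at
`1 m`, read in a trivialization at `m`, is `x(X) - K m (X m)`, which is also the operator
determined by the linear field.

For the pair groupoid, `a` is the tangent map of the first projection, which relates `x × x` to
`x`; it therefore carries the lift of `x × x` to `J ∘ T(x)`, the complete lift of `x`.
-/

noncomputable section

/-! ### Second order calculus on manifolds -/

section FiberBundle

variable
    {E : Type*} [NormedAddCommGroup E] [NormedSpace ℝ E]
    {H : Type*} [TopologicalSpace H] {I : ModelWithCorners ℝ E H}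
    {M : Type*} [TopologicalSpace M]
    {F : Type*} {V : M → Type*} [∀ m, TopologicalSpace (V m)]
    [TopologicalSpace (TotalSpace F V)]

theorem eventually_proj [TopologicalSpace F] [FiberBundle F V] {a : TotalSpace F V}
    {p : M → Prop} (hp : ∀ᶠ m in 𝓝 a.proj, p m) :
    ∀ᶠ b : TotalSpace F V in 𝓝 a, p b.proj :=
  (FiberBundle.continuous_proj F V).continuousAt.eventually hp

theorem eventually_proj_mem_baseSet [TopologicalSpace F] [FiberBundle F V] (a : TotalSpace F V) :
    ∀ᶠ b : TotalSpace F V in 𝓝 a, b.proj ∈ (trivializationAt F V a.proj).baseSet :=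
  eventually_proj ((trivializationAt F V a.proj).open_baseSet.mem_nhds
    (mem_baseSet_trivializationAt F V a.proj))

theorem eventuallyEq_extChartAt_totalSpace [ChartedSpace H M] [NormedAddCommGroup F]
    [NormedSpace ℝ F] [FiberBundle F V] (a : TotalSpace F V) :
    extChartAt (I.prod 𝓘(ℝ, F)) a =ᶠ[𝓝 a]
      fun b ↦ ((extChartAt I a.proj ∘ π F V) b, (trivializationAt F V a.proj b).2) := by
  have hsource : (trivializationAt F V a.proj).source ∈ 𝓝 a :=
    (trivializationAt F V a.proj).open_source.mem_nhds
      ((trivializationAt F V a.proj).mem_source.2 (mem_baseSet_trivializationAt F V a.proj))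
  filter_upwards [hsource] with b hb
  rw [FiberBundle.extChartAt]
  change (extChartAt I a.proj (trivializationAt F V a.proj b).1, _) = _
  rw [Trivialization.coe_fst _ hb]
  rfl

end FiberBundle

section Calculus

variable
    {E : Type*} [NormedAddCommGroup E] [NormedSpace ℝ E]
    {H : Type*} [TopologicalSpace H] {I : ModelWithCorners ℝ E H}
    {M : Type*} [TopologicalSpace M] [ChartedSpace H M]
    {E' : Type*} [NormedAddCommGroup E'] [NormedSpace ℝ E']
    {H' : Type*} [TopologicalSpace H'] {I' : ModelWithCorners ℝ E' H'}
    {N : Type*} [TopologicalSpace N] [ChartedSpace H' N]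
    {F : Type*} [NormedAddCommGroup F] [NormedSpace ℝ F]
    {V : M → Type*} [∀ m, AddCommGroup (V m)] [∀ m, Module ℝ (V m)]
    [∀ m, TopologicalSpace (V m)] [TopologicalSpace (TotalSpace F V)]
    [FiberBundle F V] [VectorBundle ℝ F V]

variable (I) in
/-- The differential of a vector-valued function, as a function on the tangent bundle. It extends
`differentialFun` to vector-valued functions such as charts. -/
def totalDifferential (ψ : M → F) (w : TangentBundle I M) : F :=
  mfderiv I 𝓘(ℝ, F) ψ w.1 w.2

variable (I) in
/-- The derivative of a vector-valued function along a vector field, of which `derivAlong` is the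
real-valued case. The derivative of `extChartAt I p` along `W` is the coordinate representation of
`W` in that chart. -/
def vectorDerivAlong (W : ∀ q : M, TangentSpace I q) (ψ : M → F) (q : M) : F :=
  totalDifferential I ψ ⟨q, W q⟩

theorem totalDifferential_comp {f : M → N} {ψ : N → F} {b : TangentBundle I M}
    (hψ : MDifferentiableAt I' 𝓘(ℝ, F) ψ (f b.1)) (hf : MDifferentiableAt I I' f b.1) :
    totalDifferential I (ψ ∘ f) b = totalDifferential I' ψ (tangentMap I I' f b) := by
  rw [totalDifferential, mfderiv_comp b.1 hψ hf]
  rfl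

theorem vectorDerivAlong_comp_of_related {f : M → N} {ψ : N → F}
    {W : ∀ q : M, TangentSpace I q} {W' : ∀ r : N, TangentSpace I' r} {q : M}
    (hψ : MDifferentiableAt I' 𝓘(ℝ, F) ψ (f q)) (hf : MDifferentiableAt I I' f q)
    (hW : mfderiv I I' f q (W q) = W' (f q)) :
    vectorDerivAlong I W (ψ ∘ f) q = vectorDerivAlong I' W' ψ (f q) :=
  (totalDifferential_comp (b := (⟨q, W q⟩ : TangentBundle I M)) hψ hf).trans
    (congrArg (fun v : TangentSpace I' (f q) ↦ totalDifferential I' ψ ⟨f q, v⟩) hW)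

theorem totalDifferential_congr {ψ χ : M → F} {w : TangentBundle I M} (h : ψ =ᶠ[𝓝 w.1] χ) :
    totalDifferential I ψ w = totalDifferential I χ w :=
  DFunLike.congr_fun (h.mfderiv_eq : mfderiv I 𝓘(ℝ, F) ψ w.1 = mfderiv I 𝓘(ℝ, F) χ w.1) w.2

theorem hasMFDerivAt_prodMk_space {f : M → F} {g : M → E'} {p : M}
    {f' : TangentSpace I p →L[ℝ] F} {g' : TangentSpace I p →L[ℝ] E'}
    (hf : HasMFDerivAt I 𝓘(ℝ, F) f p f') (hg : HasMFDerivAt I 𝓘(ℝ, E') g p g') :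
    HasMFDerivAt I 𝓘(ℝ, F × E') (fun q ↦ (f q, g q)) p (f'.prod g') :=
  ⟨hf.1.prodMk hg.1, hf.2.prodMk hg.2⟩

theorem contMDiffAt_trivialization_snd [IsManifold I ∞ M] [ContMDiffVectorBundle ∞ F V I]
    {m₀ : M} {a : TotalSpace F V} (ha : a.proj ∈ (trivializationAt F V m₀).baseSet) :
    ContMDiffAt (I.prod 𝓘(ℝ, F)) 𝓘(ℝ, F) ∞ (fun b ↦ (trivializationAt F V m₀ b).2) a := by
  have ha' : a ∈ (trivializationAt F V m₀).source := (trivializationAt F V m₀).mem_source.2 ha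
  exact contMDiffAt_snd.comp a
    (((trivializationAt F V m₀).contMDiffOn (IB := I) (n := ∞)).contMDiffAt
      ((trivializationAt F V m₀).open_source.mem_nhds ha'))

/-- Mathlib represents a tangent vector of the total space at `a` by its coordinates in the chart
at `a`. -/
theorem mfderiv_proj_mfderiv_trivializationAt [IsManifold I ∞ M] [ContMDiffVectorBundle ∞ F V I]
    (a : TotalSpace F V) (η : TangentSpace (I.prod 𝓘(ℝ, F)) a) :
    ((mfderiv (I.prod 𝓘(ℝ, F)) I (π F V) a η,
      mfderiv (I.prod 𝓘(ℝ, F)) 𝓘(ℝ, F) (fun b ↦ (trivializationAt F V a.proj b).2) a η) : E × F) =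
      η := by
  have : IsManifold (I.prod 𝓘(ℝ, F)) ∞ (TotalSpace F V) := inferInstance
  have : IsManifold (I.prod 𝓘(ℝ, F)) 1 (TotalSpace F V) := .of_le (n := ∞) (by simp)
  have : IsManifold I 1 M := .of_le (n := ∞) (by simp)
  have hproj : MDifferentiableAt (I.prod 𝓘(ℝ, F)) I (π F V) a :=
    (contMDiff_proj V (n := ∞) |>.mdifferentiable (by simp)) a
  have hfibre := (contMDiffAt_trivialization_snd (I := I)
    (mem_baseSet_trivializationAt F V a.proj)).mdifferentiableAt (by simp)
  have hchart : MDifferentiableAt I 𝓘(ℝ, E) (extChartAt I a.proj) a.proj :=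
    mdifferentiableAt_extChartAt (mem_chart_source H a.proj)
  have hη : mfderiv (I.prod 𝓘(ℝ, F)) 𝓘(ℝ, E × F) (extChartAt (I.prod 𝓘(ℝ, F)) a) a η = η := by
    rw [mfderiv_extChartAt_self]; rfl
  rw [(eventuallyEq_extChartAt_totalSpace (I := I) a).mfderiv_eq,
    (hasMFDerivAt_prodMk_space (hchart.hasMFDerivAt.comp a hproj.hasMFDerivAt)
      hfibre.hasMFDerivAt).mfderiv, mfderiv_extChartAt_self] at hη
  exact hη

theorem mfderiv_proj_apply [IsManifold I ∞ M] [ContMDiffVectorBundle ∞ F V I]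
    (a : TotalSpace F V) (η : TangentSpace (I.prod 𝓘(ℝ, F)) a) :
    mfderiv (I.prod 𝓘(ℝ, F)) I (π F V) a η = (show E × F from η).1 :=
  congrArg Prod.fst (mfderiv_proj_mfderiv_trivializationAt a η)

theorem mfderiv_trivializationAt_snd_apply [IsManifold I ∞ M] [ContMDiffVectorBundle ∞ F V I]
    (a : TotalSpace F V) (η : TangentSpace (I.prod 𝓘(ℝ, F)) a) :
    mfderiv (I.prod 𝓘(ℝ, F)) 𝓘(ℝ, F) (fun b ↦ (trivializationAt F V a.proj b).2) a η =
      (show E × F from η).2 :=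
  congrArg Prod.snd (mfderiv_proj_mfderiv_trivializationAt a η)

theorem trivializationAt_tangent_snd [IsManifold I ∞ M] {p : M} {b : TangentBundle I M}
    (hb : b.1 ∈ (chartAt H p).source) :
    (trivializationAt E (TangentSpace I) p b).2 = totalDifferential I (extChartAt I p) b := by
  rw [← Trivialization.continuousLinearMapAt_apply_of_mem ℝ _ (by simpa using hb)]
  exact DFunLike.congr_fun (TangentBundle.continuousLinearMapAt_trivializationAt hb) b.2

theorem eventuallyEq_totalDifferential_extChartAt [IsManifold I ∞ M] (b : TangentBundle I M) :
    totalDifferential I (extChartAt I b.1) =ᶠ[𝓝 b]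
      fun c ↦ (trivializationAt E (TangentSpace I) b.proj c).2 := by
  filter_upwards [eventually_proj
    ((chartAt H b.1).open_source.mem_nhds (mem_chart_source H b.1))] with c hc
  exact (trivializationAt_tangent_snd hc).symm

theorem contMDiffAt_totalDifferential_extChartAt [IsManifold I ∞ M] (b : TangentBundle I M) :
    ContMDiffAt I.tangent 𝓘(ℝ, E) ∞ (totalDifferential I (extChartAt I b.1)) b :=
  (contMDiffAt_trivialization_snd (I := I) (V := (TangentSpace I : M → Type _))
    (mem_baseSet_trivializationAt E (TangentSpace I) b.1)).congr_of_eventuallyEq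
    (eventuallyEq_totalDifferential_extChartAt b)

theorem mfderiv_totalDifferential_extChartAt [IsManifold I ∞ M] (b : TangentBundle I M)
    (Z : TangentSpace I.tangent b) :
    mfderiv I.tangent 𝓘(ℝ, E) (totalDifferential I (extChartAt I b.1)) b Z =
      (show E × E from Z).2 := by
  rw [(eventuallyEq_totalDifferential_extChartAt b).mfderiv_eq]
  exact mfderiv_trivializationAt_snd_apply (I := I) b Z

theorem totalDifferential_extChartAt_self [IsManifold I ∞ M] (b : TangentBundle I M) :
    totalDifferential I (extChartAt I b.1) b = b.2 := by
  rw [totalDifferential, mfderiv_extChartAt_self]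
  rfl

theorem canonicalInvolution_tangentMap_proj [IsManifold I ∞ M] {ξ : ∀ p : M, TangentSpace I p}
    {b : TangentBundle I M} (hξ : MDifferentiableAt I I.tangent (T% ξ) b.1) :
    (canonicalInvolution I (tangentMap I I.tangent (T% ξ) b)).1 = b := by
  have hproj : MDifferentiableAt I.tangent I (π E (TangentSpace I))
      (⟨b.1, ξ b.1⟩ : TangentBundle I M) :=
    (contMDiff_proj (TangentSpace I : M → Type _) (n := ∞)).mdifferentiable (by simp) _
  have hfst : (show E × E from mfderiv I I.tangent (T% ξ) b.1 b.2).1 = b.2 :=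
    (mfderiv_proj_apply (⟨b.1, ξ b.1⟩ : TangentBundle I M)
      (mfderiv I I.tangent (T% ξ) b.1 b.2)).symm.trans
      ((DFunLike.congr_fun (mfderiv_comp b.1 hproj hξ) b.2).symm.trans
        (DFunLike.congr_fun (mfderiv_id (I := I) (x := b.1)) b.2))
  exact congrArg (fun v : TangentSpace I b.1 ↦ (⟨b.1, v⟩ : TangentBundle I M)) hfst

theorem totalDifferential_clm_apply {c : N → E →L[ℝ] F} {d : N → E} {b : TangentBundle I' N}
    (hc : MDifferentiableAt I' 𝓘(ℝ, E →L[ℝ] F) c b.1)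
    (hd : MDifferentiableAt I' 𝓘(ℝ, E) d b.1) :
    totalDifferential I' (fun k ↦ c k (d k)) b =
      totalDifferential I' c b (d b.1) + c b.1 (totalDifferential I' d b) := by
  have happly : HasFDerivAt (fun z : (E →L[ℝ] F) × E ↦ z.1 z.2) _ (c b.1, d b.1) :=
    hasFDerivAt_fst.clm_apply hasFDerivAt_snd
  have hcomp : HasMFDerivAt I' 𝓘(ℝ, F) (fun k ↦ c k (d k)) b.1 _ :=
    happly.hasMFDerivAt.comp b.1 (hasMFDerivAt_prodMk_space hc.hasMFDerivAt hd.hasMFDerivAt)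
  rw [totalDifferential, hcomp.mfderiv]
  exact add_comm (c b.1 (totalDifferential I' d b)) (totalDifferential I' c b (d b.1))

theorem totalDifferential_fderiv_apply {g : E → F} {c d : N → E} {b : TangentBundle I' N}
    (hg : ContDiffAt ℝ 2 g (c b.1)) (hc : MDifferentiableAt I' 𝓘(ℝ, E) c b.1)
    (hd : MDifferentiableAt I' 𝓘(ℝ, E) d b.1) :
    totalDifferential I' (fun k ↦ fderiv ℝ g (c k) (d k)) b =
      fderiv ℝ (fderiv ℝ g) (c b.1) (totalDifferential I' c b) (d b.1) +
        fderiv ℝ g (c b.1) (totalDifferential I' d b) := by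
  have hg' : HasFDerivAt (fderiv ℝ g) (fderiv ℝ (fderiv ℝ g) (c b.1)) (c b.1) :=
    ((hg.fderiv_right (m := 1) (by norm_num)).differentiableAt (by simp)).hasFDerivAt
  have hgc := hg'.hasMFDerivAt.comp b.1 hc.hasMFDerivAt
  refine (totalDifferential_clm_apply hgc.mdifferentiableAt hd).trans
    (congrArg (· + _) (congrArg (fun T : E →L[ℝ] F ↦ T (d b.1)) ?_))
  exact DFunLike.congr_fun hgc.mfderiv b.2

variable [I.Boundaryless]

theorem contDiffAt_comp_extChartAt_symm {n : ℕ∞ω} {ψ : M → F} {p : M}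
    (hψ : ContMDiffAt I 𝓘(ℝ, F) n ψ p) :
    ContDiffAt ℝ n (ψ ∘ (extChartAt I p).symm) (extChartAt I p p) := by
  have h := (contMDiffAt_iff.1 hψ).2
  rwa [I.range_eq_univ, contDiffWithinAt_univ] at h

theorem totalDifferential_eq_fderiv_of_eventuallyEq {g : M → F} {ĝ : E → F} {p : M}
    (hg : MDifferentiableAt I 𝓘(ℝ, F) g p)
    (h : g ∘ (extChartAt I p).symm =ᶠ[𝓝 (extChartAt I p p)] ĝ) (v : TangentSpace I p) :
    totalDifferential I g ⟨p, v⟩ = fderiv ℝ ĝ (extChartAt I p p) (show E from v) := by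
  have hv : totalDifferential I g ⟨p, v⟩ =
      fderivWithin ℝ (g ∘ (extChartAt I p).symm) (range I) (extChartAt I p p) (show E from v) :=
    DFunLike.congr_fun hg.mfderiv v
  rw [hv, ← h.fderiv_eq, I.range_eq_univ, fderivWithin_univ]

variable [IsManifold I ∞ M]

theorem eventually_mfderiv_eq_fderiv {ψ : M → F} {p : M} (hψ : ContMDiffAt I 𝓘(ℝ, F) 1 ψ p) :
    ∀ᶠ q in 𝓝 p, ∀ w : TangentSpace I q, mfderiv I 𝓘(ℝ, F) ψ q w =
      fderiv ℝ (ψ ∘ (extChartAt I p).symm) (extChartAt I p q)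
        (totalDifferential I (extChartAt I p) ⟨q, w⟩) := by
  have hchart : ∀ᶠ q in 𝓝 p, q ∈ (chartAt H p).source :=
    (chartAt H p).open_source.mem_nhds (mem_chart_source H p)
  have hdiff : ∀ᶠ q in 𝓝 p,
      ContDiffAt ℝ 1 (ψ ∘ (extChartAt I p).symm) (extChartAt I p q) :=
    (continuousAt_extChartAt (I := I) p).eventually
      ((contDiffAt_comp_extChartAt_symm hψ).eventually (by simp))
  filter_upwards [hchart, hchart.eventually_nhds, hdiff] with q hq hq' hd w
  have hψ_eq : ψ =ᶠ[𝓝 q] (ψ ∘ (extChartAt I p).symm) ∘ extChartAt I p := by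
    filter_upwards [hq'] with r hr
    rw [comp_apply, comp_apply, (extChartAt I p).left_inv (by rwa [extChartAt_source])]
  rw [hψ_eq.mfderiv_eq, ((hd.differentiableAt (by simp)).hasFDerivAt.hasMFDerivAt.comp q
    (mdifferentiableAt_extChartAt (I := I) hq).hasMFDerivAt).mfderiv]
  rfl

theorem eventuallyEq_totalDifferential {ψ : M → F} {b : TangentBundle I M}
    (hψ : ContMDiffAt I 𝓘(ℝ, F) 1 ψ b.1) :
    totalDifferential I ψ =ᶠ[𝓝 b] fun c ↦ fderiv ℝ (ψ ∘ (extChartAt I b.1).symm)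
      (extChartAt I b.1 c.1) (totalDifferential I (extChartAt I b.1) c) := by
  filter_upwards [eventually_proj (eventually_mfderiv_eq_fderiv hψ)] with c hc
  exact hc c.2

theorem mfderiv_totalDifferential {ψ : M → F} {b : TangentBundle I M}
    (hψ : ContMDiffAt I 𝓘(ℝ, F) 2 ψ b.1) (Z : TangentSpace I.tangent b) :
    mfderiv I.tangent 𝓘(ℝ, F) (totalDifferential I ψ) b Z =
      fderiv ℝ (fderiv ℝ (ψ ∘ (extChartAt I b.1).symm)) (extChartAt I b.1 b.1)
        (show E × E from Z).1 (show E from b.2) +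
      fderiv ℝ (ψ ∘ (extChartAt I b.1).symm) (extChartAt I b.1 b.1) (show E × E from Z).2 := by
  rw [(eventuallyEq_totalDifferential (hψ.of_le one_le_two)).mfderiv_eq]
  have hproj : MDifferentiableAt I.tangent I (π E (TangentSpace I)) b :=
    (contMDiff_proj (TangentSpace I : M → Type _) (n := ∞) |>.mdifferentiable (by simp)) b
  have hchart := mdifferentiableAt_extChartAt (I := I) (mem_chart_source H b.1)
  have hbase : totalDifferential I.tangent (extChartAt I b.1 ∘ π E (TangentSpace I)) ⟨b, Z⟩ =
      (show E × E from Z).1 := by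
    rw [totalDifferential_comp hchart hproj]
    exact (totalDifferential_extChartAt_self (⟨b.1, mfderiv I.tangent I _ b Z⟩ :
      TangentBundle I M)).trans (mfderiv_proj_apply (I := I) b Z)
  refine (totalDifferential_fderiv_apply (b := (⟨b, Z⟩ : TangentBundle I.tangent _))
    (c := extChartAt I b.1 ∘ π E (TangentSpace I)) (contDiffAt_comp_extChartAt_symm hψ)
    (hchart.comp b hproj)
    ((contMDiffAt_totalDifferential_extChartAt b).mdifferentiableAt (by simp))).trans ?_
  rw [hbase, totalDifferential_extChartAt_self]
  exact congrArg _ (congrArg _ (mfderiv_totalDifferential_extChartAt b Z))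

theorem mfderiv_totalDifferential_vertical {ψ : M → F} {b : TangentBundle I M}
    (hψ : ContMDiffAt I 𝓘(ℝ, F) 2 ψ b.1) (v : E) :
    mfderiv I.tangent 𝓘(ℝ, F) (totalDifferential I ψ) b ((0 : E), v) =
      totalDifferential I ψ ⟨b.1, v⟩ := by
  have hdifferential : totalDifferential I ψ ⟨b.1, v⟩ = _ :=
    (eventually_mfderiv_eq_fderiv (hψ.of_le one_le_two)).self_of_nhds v
  refine (mfderiv_totalDifferential hψ _).trans (Eq.trans ?_ hdifferential.symm)
  have hchart : totalDifferential I (extChartAt I b.1) ⟨b.1, v⟩ = v :=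
    totalDifferential_extChartAt_self (⟨b.1, v⟩ : TangentBundle I M)
  rw [map_zero, zero_apply, zero_add, hchart]

theorem contMDiffAt_totalDifferential {ψ : M → F} {b : TangentBundle I M}
    (hψ : ContMDiffAt I 𝓘(ℝ, F) ∞ ψ b.1) :
    ContMDiffAt I.tangent 𝓘(ℝ, F) ∞ (totalDifferential I ψ) b := by
  refine ContMDiffAt.congr_of_eventuallyEq ?_
    (eventuallyEq_totalDifferential (hψ.of_le (by norm_cast)))
  have hbase : ContMDiffAt I.tangent 𝓘(ℝ, E) ∞
      (fun c : TangentBundle I M ↦ extChartAt I b.1 c.1) b :=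
    (contMDiffAt_extChartAt (I := I) (n := ∞) (x := b.1)).comp b
      (contMDiff_proj (TangentSpace I : M → Type _) b)
  have hderiv : ContDiffAt ℝ ∞ (fderiv ℝ (ψ ∘ (extChartAt I b.1).symm)) (extChartAt I b.1 b.1) :=
    (contDiffAt_comp_extChartAt_symm hψ).fderiv_right (by simp)
  exact (hderiv.contMDiffAt.comp b hbase).clm_apply (contMDiffAt_totalDifferential_extChartAt b)

theorem mfderiv_totalDifferential_canonicalInvolution
    {ψ : M → F} (Z : TangentBundle I.tangent (TangentBundle I M))
    (hψ : ContMDiffAt I 𝓘(ℝ, F) 2 ψ Z.1.1) :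
    mfderiv I.tangent 𝓘(ℝ, F) (totalDifferential I ψ) (canonicalInvolution I Z).1
      (canonicalInvolution I Z).2 = mfderiv I.tangent 𝓘(ℝ, F) (totalDifferential I ψ) Z.1 Z.2 := by
  refine (mfderiv_totalDifferential (b := (canonicalInvolution I Z).1) hψ
    (canonicalInvolution I Z).2).trans
    (Eq.trans (congrArg (· + _) ?_) (mfderiv_totalDifferential (b := Z.1) hψ Z.2).symm)
  exact ((contDiffAt_comp_extChartAt_symm hψ).isSymmSndFDerivAt (by simp)).eq _ _

section LieBracket

variable {V W : ∀ q : M, TangentSpace I q} {p : M} {ψ : M → F}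

theorem contMDiffAt_vectorDerivAlong (hψ : ContMDiffAt I 𝓘(ℝ, F) ∞ ψ p)
    (hW : ContMDiffAt I I.tangent ∞ (T% W) p) :
    ContMDiffAt I 𝓘(ℝ, F) ∞ (vectorDerivAlong I W ψ) p :=
  (contMDiffAt_totalDifferential (b := (⟨p, W p⟩ : TangentBundle I M)) hψ).comp p hW

variable (I W p) in
theorem eventuallyEq_mpullbackWithin_extChartAt_symm :
    vectorDerivAlong I W (extChartAt I p) ∘ (extChartAt I p).symm =ᶠ[𝓝 (extChartAt I p p)]
      mpullbackWithin 𝓘(ℝ, E) I (extChartAt I p).symm W (range I) := by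
  filter_upwards [extChartAt_target_mem_nhds (I := I) p] with z hz
  rw [mpullbackWithin_apply, ContinuousLinearMap.inverse_eq
    (mfderivWithin_extChartAt_symm_comp_mfderiv_extChartAt (I := I) hz)
    (mfderiv_extChartAt_comp_mfderivWithin_extChartAt_symm (I := I) hz)]
  rfl

variable (I W p) in
theorem mpullbackWithin_extChartAt_symm_self :
    mpullbackWithin 𝓘(ℝ, E) I (extChartAt I p).symm W (range I) (extChartAt I p p) = W p := by
  rw [← (eventuallyEq_mpullbackWithin_extChartAt_symm I W p).eq_of_nhds, comp_apply,
    extChartAt_to_inv]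
  exact totalDifferential_extChartAt_self (⟨p, W p⟩ : TangentBundle I M)

theorem totalDifferential_vectorDerivAlong_extChartAt (hW : ContMDiffAt I I.tangent ∞ (T% W) p)
    (v : TangentSpace I p) :
    totalDifferential I (vectorDerivAlong I W (extChartAt I p)) ⟨p, v⟩ =
      fderiv ℝ (mpullbackWithin 𝓘(ℝ, E) I (extChartAt I p).symm W (range I)) (extChartAt I p p)
        (show E from v) :=
  totalDifferential_eq_fderiv_of_eventuallyEq
    ((contMDiffAt_vectorDerivAlong contMDiffAt_extChartAt hW).mdifferentiableAt (by simp))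
    (eventuallyEq_mpullbackWithin_extChartAt_symm I W p) v

variable (I V W p) in
theorem mlieBracket_eq_lieBracket_mpullbackWithin :
    (show E from mlieBracket I V W p) =
      lieBracket ℝ (mpullbackWithin 𝓘(ℝ, E) I (extChartAt I p).symm V (range I))
        (mpullbackWithin 𝓘(ℝ, E) I (extChartAt I p).symm W (range I)) (extChartAt I p p) := by
  have hid (z : E) : (ContinuousLinearMap.id ℝ E).inverse z = z := by simp
  have hrange : (extChartAt I p).symm ⁻¹' univ ∩ range I = univ := by
    rw [preimage_univ, univ_inter, I.range_eq_univ]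
  rw [← mlieBracketWithin_univ, mlieBracketWithin_apply, mfderiv_extChartAt_self, hrange]
  exact (hid _).trans (congrFun lieBracketWithin_univ _)

theorem mlieBracket_eq_sub (hV : ContMDiffAt I I.tangent ∞ (T% V) p)
    (hW : ContMDiffAt I I.tangent ∞ (T% W) p) :
    (show E from mlieBracket I V W p) =
      vectorDerivAlong I V (vectorDerivAlong I W (extChartAt I p)) p -
      vectorDerivAlong I W (vectorDerivAlong I V (extChartAt I p)) p := by
  have hVW := totalDifferential_vectorDerivAlong_extChartAt hW (V p)
  have hWV := totalDifferential_vectorDerivAlong_extChartAt hV (W p)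
  refine (mlieBracket_eq_lieBracket_mpullbackWithin I V W p).trans
    (Eq.trans ?_ (congrArg₂ (· - ·) hVW hWV).symm)
  exact congrArg₂ (· - ·) (congrArg _ (mpullbackWithin_extChartAt_symm_self I V p))
    (congrArg _ (mpullbackWithin_extChartAt_symm_self I W p))

theorem totalDifferential_vectorDerivAlong (hψ : ContMDiffAt I 𝓘(ℝ, F) 2 ψ p)
    (hW : ContMDiffAt I I.tangent ∞ (T% W) p) (v : TangentSpace I p) :
    totalDifferential I (vectorDerivAlong I W ψ) ⟨p, v⟩ =
      fderiv ℝ (fderiv ℝ (ψ ∘ (extChartAt I p).symm)) (extChartAt I p p)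
        (show E from v) (show E from W p) +
      fderiv ℝ (ψ ∘ (extChartAt I p).symm) (extChartAt I p p)
        (totalDifferential I (vectorDerivAlong I W (extChartAt I p)) ⟨p, v⟩) := by
  have hlocal : vectorDerivAlong I W ψ =ᶠ[𝓝 p] fun q ↦
      fderiv ℝ (ψ ∘ (extChartAt I p).symm) (extChartAt I p q)
        (vectorDerivAlong I W (extChartAt I p) q) := by
    filter_upwards [eventually_mfderiv_eq_fderiv (hψ.of_le one_le_two)] with q hq
    exact hq (W q)
  have hW' : vectorDerivAlong I W (extChartAt I p) p = (show E from W p) :=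
    totalDifferential_extChartAt_self (⟨p, W p⟩ : TangentBundle I M)
  have hv : totalDifferential I (extChartAt I p) ⟨p, v⟩ = (show E from v) :=
    totalDifferential_extChartAt_self (⟨p, v⟩ : TangentBundle I M)
  rw [totalDifferential, hlocal.mfderiv_eq]
  refine (totalDifferential_fderiv_apply (b := (⟨p, v⟩ : TangentBundle I M))
    (contDiffAt_comp_extChartAt_symm hψ) (mdifferentiableAt_extChartAt (mem_chart_source H p))
    ((contMDiffAt_vectorDerivAlong contMDiffAt_extChartAt hW).mdifferentiableAt
      (by simp))).trans ?_
  rw [hW', hv]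

theorem vectorDerivAlong_mlieBracket (hψ : ContMDiffAt I 𝓘(ℝ, F) 2 ψ p)
    (hV : ContMDiffAt I I.tangent ∞ (T% V) p) (hW : ContMDiffAt I I.tangent ∞ (T% W) p) :
    vectorDerivAlong I (mlieBracket I V W) ψ p =
      vectorDerivAlong I V (vectorDerivAlong I W ψ) p -
      vectorDerivAlong I W (vectorDerivAlong I V ψ) p := by
  have hsymm := ((contDiffAt_comp_extChartAt_symm hψ).isSymmSndFDerivAt (by simp)).eq
    (show E from W p) (show E from V p)
  have hbracket : vectorDerivAlong I (mlieBracket I V W) ψ p = _ :=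
    (eventually_mfderiv_eq_fderiv (hψ.of_le one_le_two)).self_of_nhds (mlieBracket I V W p)
  refine hbracket.trans ?_
  refine Eq.trans ?_ (congrArg₂ (· - ·) (totalDifferential_vectorDerivAlong hψ hW (V p))
    (totalDifferential_vectorDerivAlong hψ hV (W p))).symm
  rw [hsymm, add_sub_add_left_eq_sub, ← map_sub]
  exact congrArg _ ((totalDifferential_extChartAt_self
    (⟨p, mlieBracket I V W p⟩ : TangentBundle I M)).trans (mlieBracket_eq_sub hV hW))

end LieBracket

end Calculus

section Curves

variable
    {E : Type*} [NormedAddCommGroup E] [NormedSpace ℝ E]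
    {H : Type*} [TopologicalSpace H] {I : ModelWithCorners ℝ E H}
    {M : Type*} [TopologicalSpace M] [ChartedSpace H M]
    {E' : Type*} [NormedAddCommGroup E'] [NormedSpace ℝ E']
    {H' : Type*} [TopologicalSpace H'] {I' : ModelWithCorners ℝ E' H'}
    {N : Type*} [TopologicalSpace N] [ChartedSpace H' N]
    {F : Type*} [NormedAddCommGroup F] [NormedSpace ℝ F]

/-- The curve `c` is differentiable at time `0`, with velocity `b` there. -/
def HasVelocity (c : ℝ → M) (b : TangentBundle I M) : Prop :=
  MDifferentiableAt 𝓘(ℝ, ℝ) I c 0 ∧ tangentMap 𝓘(ℝ, ℝ) I c ⟨0, (1 : ℝ)⟩ = b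

/-- The tangent vector `b` is the velocity of a curve in `S`. Two maps that agree on `S` then have
the same derivative along `b`, whether or not `S` is a submanifold. -/
def IsTangentTo (S : Set M) (b : TangentBundle I M) : Prop :=
  ∃ c : ℝ → M, HasVelocity c b ∧ ∀ᶠ t in 𝓝 0, c t ∈ S

namespace HasVelocity

variable {c c' : ℝ → M} {b b' : TangentBundle I M}

theorem apply_zero (h : HasVelocity c b) : c 0 = b.1 := congrArg TotalSpace.proj h.2

theorem tendsto (h : HasVelocity c b) : Filter.Tendsto c (𝓝 0) (𝓝 b.1) :=
  h.apply_zero ▸ h.1.continuousAt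

theorem tendsto_nhdsWithin (h : HasVelocity c b) {S : Set M} (hc : ∀ᶠ t in 𝓝 0, c t ∈ S) :
    Filter.Tendsto c (𝓝 0) (𝓝[S] b.1) :=
  tendsto_nhdsWithin_iff.2 ⟨h.tendsto, hc⟩

theorem unique (h : HasVelocity c b) (h' : HasVelocity c' b') (hc : c =ᶠ[𝓝 0] c') : b = b' := by
  rw [← h.2, ← h'.2]
  exact TotalSpace.ext hc.eq_of_nhds (heq_of_eq (DFunLike.congr_fun hc.mfderiv_eq (1 : ℝ)))

theorem comp_within (h : HasVelocity c b) {S : Set M} (hc : ∀ᶠ t in 𝓝 0, c t ∈ S) {f : M → N}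
    {f' : TangentSpace I b.1 →L[ℝ] TangentSpace I' (f b.1)}
    (hf : HasMFDerivWithinAt I I' f S b.1 f') :
    HasVelocity (f ∘ c) (⟨f b.1, f' b.2⟩ : TangentBundle I' N) := by
  obtain ⟨hcd, rfl⟩ := h
  have hfc : HasMFDerivAt 𝓘(ℝ, ℝ) I' (f ∘ c) 0 (f'.comp (mfderiv 𝓘(ℝ, ℝ) I c 0)) :=
    (HasMFDerivWithinAt.comp (0 : ℝ) hf hcd.hasMFDerivAt.hasMFDerivWithinAt
      Subset.rfl).hasMFDerivAt hc
  refine ⟨hfc.mdifferentiableAt, ?_⟩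
  rw [tangentMap, hfc.mfderiv]
  rfl

theorem comp (h : HasVelocity c b) {f : M → N} (hf : MDifferentiableAt I I' f b.1) :
    HasVelocity (f ∘ c) (tangentMap I I' f b) :=
  h.comp_within (S := univ) (by simp) hf.hasMFDerivAt.hasMFDerivWithinAt

theorem prodMk {d : ℝ → N} {v : TangentBundle I' N} (h : HasVelocity c b)
    (h' : HasVelocity d v) :
    HasVelocity (fun t ↦ (c t, d t)) ((equivTangentBundleProd I M I' N).symm (b, v)) := by
  obtain ⟨hc, rfl⟩ := h
  obtain ⟨hd, rfl⟩ := h'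
  refine ⟨hc.prodMk hd, ?_⟩
  rw [tangentMap, mfderiv_prodMk hc hd]
  rfl

end HasVelocity

theorem hasVelocity_const (p : M) : HasVelocity (fun _ ↦ p) (⟨p, 0⟩ : TangentBundle I M) := by
  refine ⟨mdifferentiableAt_const, ?_⟩
  rw [tangentMap, mfderiv_const]
  rfl

theorem hasVelocity_of_hasDerivAt {c : ℝ → F} {x v : F} (h : HasDerivAt c v 0) (hx : c 0 = x) :
    HasVelocity c (⟨x, v⟩ : TangentBundle 𝓘(ℝ, F) F) := by
  subst hx
  have hm := h.hasFDerivAt.hasMFDerivAt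
  refine ⟨hm.mdifferentiableAt, congrArg (TotalSpace.mk (c 0)) ?_⟩
  exact (DFunLike.congr_fun hm.mfderiv (1 : ℝ)).trans (one_smul ℝ v)

theorem exists_hasVelocity [I.Boundaryless] [IsManifold I ∞ M] (b : TangentBundle I M) :
    ∃ c : ℝ → M, HasVelocity c b := by
  obtain ⟨p, v⟩ := b
  have hline (v : E) : HasVelocity (fun t : ℝ ↦ extChartAt I p p + t • v)
      (⟨extChartAt I p p, v⟩ : TangentBundle 𝓘(ℝ, E) E) := by
    have h := ((hasDerivAt_id (0 : ℝ)).smul_const v).const_add (extChartAt I p p)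
    rw [one_smul] at h
    exact hasVelocity_of_hasDerivAt h (by simp)
  have hsymm : MDifferentiableAt 𝓘(ℝ, E) I (extChartAt I p).symm (extChartAt I p p) :=
    ((contMDiffOn_extChartAt_symm (n := ∞) p).contMDiffAt
      (extChartAt_target_mem_nhds p)).mdifferentiableAt (by simp)
  have hchart : tangentMap I 𝓘(ℝ, E) (extChartAt I p) ⟨p, v⟩ = ⟨extChartAt I p p, v⟩ :=
    congrArg (TotalSpace.mk _) (totalDifferential_extChartAt_self (⟨p, v⟩ : TangentBundle I M))
  have hid : (extChartAt I p).symm ∘ extChartAt I p =ᶠ[𝓝 p] id := by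
    filter_upwards [extChartAt_source_mem_nhds (I := I) p] with q hq
    exact (extChartAt I p).left_inv hq
  have hvelocity : tangentMap 𝓘(ℝ, E) I (extChartAt I p).symm ⟨extChartAt I p p, v⟩ = ⟨p, v⟩ := by
    rw [← hchart, ← tangentMap_comp_at (I' := 𝓘(ℝ, E)) (⟨p, v⟩ : TangentBundle I M) hsymm
      (mdifferentiableAt_extChartAt (mem_chart_source H p))]
    exact TotalSpace.ext hid.eq_of_nhds
      (heq_of_eq (DFunLike.congr_fun (hid.mfderiv_eq.trans mfderiv_id) v))
  exact ⟨_, hvelocity ▸ (hline v).comp hsymm⟩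

theorem isTangentTo_univ [I.Boundaryless] [IsManifold I ∞ M] (b : TangentBundle I M) :
    IsTangentTo univ b :=
  (exists_hasVelocity b).imp fun _ hc ↦ ⟨hc, by simp⟩

theorem IsTangentTo.mfderiv_eq {S : Set M} {b : TangentBundle I M} (hb : IsTangentTo S b)
    {S₁ S₂ : Set M} {f₁ f₂ : M → N}
    {f₁' : TangentSpace I b.1 →L[ℝ] TangentSpace I' (f₁ b.1)}
    {f₂' : TangentSpace I b.1 →L[ℝ] TangentSpace I' (f₂ b.1)}
    (h₁ : HasMFDerivWithinAt I I' f₁ S₁ b.1 f₁') (h₂ : HasMFDerivWithinAt I I' f₂ S₂ b.1 f₂')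
    (hS₁ : S ⊆ S₁) (hS₂ : S ⊆ S₂) (h : f₁ =ᶠ[𝓝[S] b.1] f₂) :
    (⟨f₁ b.1, f₁' b.2⟩ : TangentBundle I' N) = ⟨f₂ b.1, f₂' b.2⟩ := by
  obtain ⟨c, hc, hcS⟩ := hb
  exact (hc.comp_within hcS (h₁.mono hS₁)).unique (hc.comp_within hcS (h₂.mono hS₂))
    ((hc.tendsto_nhdsWithin hcS).eventually h)

theorem IsTangentTo.totalDifferential_eq {S : Set M} {b : TangentBundle I M}
    (hb : IsTangentTo S b) {f₁ f₂ : M → F} (h₁ : MDifferentiableAt I 𝓘(ℝ, F) f₁ b.1)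
    (h₂ : MDifferentiableAt I 𝓘(ℝ, F) f₂ b.1) (h : f₁ =ᶠ[𝓝[S] b.1] f₂) :
    totalDifferential I f₁ b = totalDifferential I f₂ b :=
  congrArg (fun z : TangentBundle 𝓘(ℝ, F) F ↦ (show F from z.2))
    (hb.mfderiv_eq h₁.hasMFDerivAt.hasMFDerivWithinAt h₂.hasMFDerivAt.hasMFDerivWithinAt
      (subset_univ _) (subset_univ _) h)

theorem snd_eq_of_mk_eq {W : ∀ q : M, TangentSpace I q} {p q : M} {v : TangentSpace I p}
    (h : (⟨p, v⟩ : TangentBundle I M) = ⟨q, W q⟩) : v = W p := by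
  obtain rfl : p = q := congrArg TotalSpace.proj h
  simpa using h

section VectorBundle

variable [IsManifold I ∞ M] {V : M → Type*} [∀ m, AddCommGroup (V m)] [∀ m, Module ℝ (V m)]
    [∀ m, TopologicalSpace (V m)] [TopologicalSpace (TotalSpace F V)] [FiberBundle F V]
    [VectorBundle ℝ F V] [ContMDiffVectorBundle ∞ F V I]

theorem hasVelocity_totalSpace {c : ℝ → TotalSpace F V} {a : TotalSpace F V} (hca : c 0 = a)
    {u : TangentSpace I a.proj} {v : F}
    (hproj : HasVelocity (fun t ↦ (c t).proj) (⟨a.proj, u⟩ : TangentBundle I M))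
    (hfibre : HasDerivAt (fun t ↦ (trivializationAt F V a.proj (c t)).2) v 0) :
    HasVelocity c (⟨a, ((u : E), v)⟩ : TangentBundle (I.prod 𝓘(ℝ, F)) (TotalSpace F V)) := by
  subst hca
  have hc : MDifferentiableAt 𝓘(ℝ, ℝ) (I.prod 𝓘(ℝ, F)) c 0 :=
    (mdifferentiableAt_totalSpace I c).2
      ⟨hproj.1, hfibre.hasFDerivAt.hasMFDerivAt.mdifferentiableAt⟩
  set η : TangentSpace (I.prod 𝓘(ℝ, F)) (c 0) :=
    mfderiv 𝓘(ℝ, ℝ) (I.prod 𝓘(ℝ, F)) c 0 (1 : ℝ)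
  have hcη : HasVelocity c (⟨c 0, η⟩ : TangentBundle (I.prod 𝓘(ℝ, F)) (TotalSpace F V)) := ⟨hc, rfl⟩
  have hbase : mfderiv (I.prod 𝓘(ℝ, F)) I (π F V) (c 0) η = u :=
    eq_of_heq (TotalSpace.ext_iff.1 ((hcη.comp
      ((contMDiff_proj V (n := ∞)).mdifferentiable (by simp) (c 0))).unique hproj .rfl)).2
  have hvertical : mfderiv (I.prod 𝓘(ℝ, F)) 𝓘(ℝ, F)
      (fun b ↦ (trivializationAt F V (c 0).proj b).2) (c 0) η = v :=
    eq_of_heq (TotalSpace.ext_iff.1 ((hcη.comp ((contMDiffAt_trivialization_snd (I := I)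
      (mem_baseSet_trivializationAt F V (c 0).proj)).mdifferentiableAt (by simp))).unique
      (hasVelocity_of_hasDerivAt hfibre rfl) .rfl)).2
  have hη_eq : η = ((u : E), v) :=
    (mfderiv_proj_mfderiv_trivializationAt (I := I) (c 0) η).symm.trans
      (congrArg₂ Prod.mk hbase hvertical)
  exact hη_eq ▸ hcη

theorem hasVelocity_add_smul (a : TotalSpace F V) (k : V a.proj) :
    HasVelocity (fun t : ℝ ↦ (⟨a.proj, a.2 + t • k⟩ : TotalSpace F V))
      (⟨a, ((0 : E), (trivializationAt F V a.proj ⟨a.proj, k⟩).2)⟩ :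
        TangentBundle (I.prod 𝓘(ℝ, F)) (TotalSpace F V)) := by
  have hlinear (t : ℝ) : (trivializationAt F V a.proj ⟨a.proj, a.2 + t • k⟩).2 =
      (trivializationAt F V a.proj a).2 + t • (trivializationAt F V a.proj ⟨a.proj, k⟩).2 := by
    simp only [← Trivialization.continuousLinearMapAt_apply_of_mem ℝ _
      (mem_baseSet_trivializationAt F V a.proj), map_add, map_smul]
  have hderiv := ((hasDerivAt_id (0 : ℝ)).smul_const
    (trivializationAt F V a.proj ⟨a.proj, k⟩).2).const_add (trivializationAt F V a.proj a).2
  rw [one_smul] at hderiv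
  exact hasVelocity_totalSpace (by simp) (hasVelocity_const a.proj)
    (hderiv.congr_of_eventuallyEq (Filter.Eventually.of_forall hlinear))

end VectorBundle

end Curves

section RelatedFields

variable
    {E : Type*} [NormedAddCommGroup E] [NormedSpace ℝ E]
    {H : Type*} [TopologicalSpace H] {I : ModelWithCorners ℝ E H}
    {M : Type*} [TopologicalSpace M] [ChartedSpace H M] [IsManifold I ∞ M]
    {E' : Type*} [NormedAddCommGroup E'] [NormedSpace ℝ E']
    {H' : Type*} [TopologicalSpace H'] {I' : ModelWithCorners ℝ E' H'}
    {N : Type*} [TopologicalSpace N] [ChartedSpace H' N]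

theorem eventually_mdifferentiableAt [IsManifold I' ∞ N] {f : M → N} {p : M}
    (hf : ContMDiffAt I I' 1 f p) : ∀ᶠ q in 𝓝 p, MDifferentiableAt I I' f q :=
  ((contMDiffAt_iff_contMDiffAt_nhds (by simp)).1 hf).mono
    fun _ hq ↦ hq.mdifferentiableAt one_ne_zero

variable [I.Boundaryless] [I'.Boundaryless] [IsManifold I' ∞ N]
    {f : M → N} {p : M} {S : Set M} {V W : ∀ q : M, TangentSpace I q}
    {V' W' : ∀ r : N, TangentSpace I' r}

theorem totalDifferential_vectorDerivAlong_of_related (hf : ContMDiffAt I I' ∞ f p)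
    (hV : ContMDiffAt I I.tangent ∞ (T% V) p) (hV' : ContMDiffAt I' I'.tangent ∞ (T% V') (f p))
    (hVV : ∀ᶠ q in 𝓝[S] p, mfderiv I I' f q (V q) = V' (f q))
    {X : TangentSpace I p} (hX : IsTangentTo S (⟨p, X⟩ : TangentBundle I M)) :
    totalDifferential I (vectorDerivAlong I V (extChartAt I' (f p) ∘ f)) ⟨p, X⟩ =
      totalDifferential I' (vectorDerivAlong I' V' (extChartAt I' (f p)))
        ⟨f p, mfderiv I I' f p X⟩ := by
  have hfd := hf.mdifferentiableAt (by simp)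
  have hdV' := (contMDiffAt_vectorDerivAlong contMDiffAt_extChartAt hV').mdifferentiableAt
    (by simp)
  have hdV : MDifferentiableAt I 𝓘(ℝ, E') (vectorDerivAlong I V (extChartAt I' (f p) ∘ f)) p :=
    (contMDiffAt_vectorDerivAlong (contMDiffAt_extChartAt.comp p hf) hV).mdifferentiableAt
      (by simp)
  have hrelated : vectorDerivAlong I V (extChartAt I' (f p) ∘ f) =ᶠ[𝓝[S] p]
      vectorDerivAlong I' V' (extChartAt I' (f p)) ∘ f := by
    have hdiff : ∀ᶠ q in 𝓝[S] p, MDifferentiableAt I I' f q :=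
      nhdsWithin_le_nhds (eventually_mdifferentiableAt (hf.of_le (by norm_cast)))
    have hsource : ∀ᶠ q in 𝓝[S] p, f q ∈ (chartAt H' (f p)).source :=
      nhdsWithin_le_nhds (hf.continuousAt.eventually
        ((chartAt H' (f p)).open_source.mem_nhds (mem_chart_source H' (f p))))
    filter_upwards [hVV, hdiff, hsource] with q hq hqd hqs
    exact vectorDerivAlong_comp_of_related (mdifferentiableAt_extChartAt (I := I') hqs) hqd hq
  exact (hX.totalDifferential_eq hdV (hdV'.comp p hfd) hrelated).trans
    (totalDifferential_comp (b := (⟨p, X⟩ : TangentBundle I M)) hdV' hfd)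

/-- `S` is only required to carry the two fields at `p` (through curves in it), so that the lemma
applies to the set of composable pairs of a groupoid without a manifold structure on it. -/
theorem mfderiv_mlieBracket_of_related (hf : ContMDiffAt I I' ∞ f p)
    (hV : ContMDiffAt I I.tangent ∞ (T% V) p) (hW : ContMDiffAt I I.tangent ∞ (T% W) p)
    (hV' : ContMDiffAt I' I'.tangent ∞ (T% V') (f p))
    (hW' : ContMDiffAt I' I'.tangent ∞ (T% W') (f p))
    (hp : p ∈ S) (hVS : IsTangentTo S (⟨p, V p⟩ : TangentBundle I M))
    (hWS : IsTangentTo S (⟨p, W p⟩ : TangentBundle I M))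
    (hVV : ∀ᶠ q in 𝓝[S] p, mfderiv I I' f q (V q) = V' (f q))
    (hWW : ∀ᶠ q in 𝓝[S] p, mfderiv I I' f q (W q) = W' (f q)) :
    mfderiv I I' f p (mlieBracket I V W p) = mlieBracket I' V' W' (f p) := by
  have hψ : ContMDiffAt I 𝓘(ℝ, E') 2 (extChartAt I' (f p) ∘ f) p :=
    contMDiffAt_extChartAt.comp p (hf.of_le (by norm_cast))
  have hbracket : vectorDerivAlong I (mlieBracket I V W) (extChartAt I' (f p) ∘ f) p =
      mfderiv I I' f p (mlieBracket I V W p) :=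
    (totalDifferential_comp (b := (⟨p, mlieBracket I V W p⟩ : TangentBundle I M))
      (mdifferentiableAt_extChartAt (mem_chart_source H' (f p)))
      (hf.mdifferentiableAt (by simp))).trans
      (totalDifferential_extChartAt_self
        (tangentMap I I' f (⟨p, mlieBracket I V W p⟩ : TangentBundle I M)))
  have hVW : vectorDerivAlong I V (vectorDerivAlong I W (extChartAt I' (f p) ∘ f)) p =
      vectorDerivAlong I' V' (vectorDerivAlong I' W' (extChartAt I' (f p))) (f p) :=
    (totalDifferential_vectorDerivAlong_of_related hf hW hW' hWW hVS).trans
      (congrArg (fun v ↦ totalDifferential I' _ (⟨f p, v⟩ : TangentBundle I' N))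
        (hVV.self_of_nhdsWithin hp))
  have hWV : vectorDerivAlong I W (vectorDerivAlong I V (extChartAt I' (f p) ∘ f)) p =
      vectorDerivAlong I' W' (vectorDerivAlong I' V' (extChartAt I' (f p))) (f p) :=
    (totalDifferential_vectorDerivAlong_of_related hf hV hV' hVV hWS).trans
      (congrArg (fun v ↦ totalDifferential I' _ (⟨f p, v⟩ : TangentBundle I' N))
        (hWW.self_of_nhdsWithin hp))
  have hsub := vectorDerivAlong_mlieBracket hψ hV hW
  rw [hVW, hWV] at hsub
  exact hbracket.symm.trans (hsub.trans (mlieBracket_eq_sub hV' hW').symm)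

end RelatedFields

section Submersions

variable
    {E : Type*} [NormedAddCommGroup E] [NormedSpace ℝ E]
    {H : Type*} [TopologicalSpace H] {I : ModelWithCorners ℝ E H}
    {M : Type*} [TopologicalSpace M] [ChartedSpace H M]
    {E' : Type*} [NormedAddCommGroup E'] [NormedSpace ℝ E']
    {H' : Type*} [TopologicalSpace H'] {I' : ModelWithCorners ℝ E' H'}
    {N : Type*} [TopologicalSpace N] [ChartedSpace H' N]

theorem contMDiffAt_tangentMap [I.Boundaryless] [IsManifold I ∞ M] [IsManifold I' ∞ N]
    {f : M → N} {b : TangentBundle I M} (hf : ContMDiffAt I I' ∞ f b.1) :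
    ContMDiffAt I.tangent I'.tangent ∞ (tangentMap I I' f) b := by
  have hπ := contMDiff_proj (IB := I) (TangentSpace I : M → Type _) (n := ∞) b
  refine (contMDiffAt_totalSpace ..).2 ⟨hf.comp b hπ, ?_⟩
  refine (contMDiffAt_totalDifferential (b := b)
    (contMDiffAt_extChartAt.comp b.1 hf)).congr_of_eventuallyEq ?_
  have hsource : ∀ᶠ c : TangentBundle I M in 𝓝 b, f c.1 ∈ (chartAt H' (f b.1)).source :=
    eventually_proj (hf.continuousAt.eventually
      ((chartAt H' (f b.1)).open_source.mem_nhds (mem_chart_source H' (f b.1))))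
  filter_upwards [hsource,
    eventually_proj (eventually_mdifferentiableAt (hf.of_le (by norm_cast)))] with c hc hd
  rw [totalDifferential_comp (mdifferentiableAt_extChartAt (I := I') hc) hd]
  exact trivializationAt_tangent_snd (b := tangentMap I I' f c) hc

variable [FiniteDimensional ℝ E] [FiniteDimensional ℝ E']

theorem exists_local_sections_of_contDiffAt {n : ℕ∞ω} (hn : n ≠ 0) {g : E → E'} {z₀ : E}
    (hg : ContDiffAt ℝ n g z₀) (hs : Surjective (fderiv ℝ g z₀)) :
    ∃ σ : E × E' → E, ContDiffAt ℝ n σ (z₀, g z₀) ∧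
      (∀ᶠ w in 𝓝 (z₀, g z₀), g (σ w) = w.2) ∧ ∀ᶠ z in 𝓝 z₀, σ (z, g z) = z := by
  obtain ⟨Q, T, hT⟩ := LieGroupoid.exists_completion _ hs
  have hΨ : ContDiffAt ℝ n (fun z ↦ (g z, Q z)) z₀ := hg.prodMk Q.contDiff.contDiffAt
  have hΨ' : HasFDerivAt (fun z ↦ (g z, Q z)) (T : E →L[ℝ] _) z₀ := by
    rw [hT]
    exact (hg.differentiableAt hn).hasFDerivAt.prodMk Q.hasFDerivAt
  have hstrict := hΨ.hasStrictFDerivAt' hΨ' hn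
  have hκ : ContDiff ℝ n fun w : E × E' ↦ (w.2, Q w.1) :=
    contDiff_snd.prodMk (Q.contDiff.comp contDiff_fst)
  refine ⟨fun w ↦ hΨ.localInverse hΨ' hn (w.2, Q w.1),
    ContDiffAt.comp (z₀, g z₀) (hΨ.to_localInverse hΨ' hn) hκ.contDiffAt, ?_,
    hstrict.eventually_left_inverse⟩
  filter_upwards [hκ.continuous.continuousAt.eventually hstrict.eventually_right_inverse] with w hw
  exact congrArg Prod.fst hw

/-- The inverse function theorem gives such sections in charts, where a submersion can be completed
to a local diffeomorphism by linear coordinates. -/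
theorem exists_local_sections [I.Boundaryless] [I'.Boundaryless] [IsManifold I ∞ M]
    [IsManifold I' ∞ N] {f : M → N} {p : M} (hf : ContMDiffAt I I' ∞ f p)
    (hs : Surjective (mfderiv I I' f p)) :
    ∃ σ : M × N → M, ContMDiffAt (I.prod I') I ∞ σ (p, f p) ∧
      (∀ᶠ z in 𝓝 (p, f p), f (σ z) = z.2) ∧ ∀ᶠ q in 𝓝 p, σ (q, f q) = q := by
  set φ := extChartAt I p
  set φ' := extChartAt I' (f p)
  have hg : ContDiffAt ℝ ∞ ((φ' ∘ f) ∘ φ.symm) (φ p) :=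
    contDiffAt_comp_extChartAt_symm (contMDiffAt_extChartAt.comp p hf)
  have hg₀ : ((φ' ∘ f) ∘ φ.symm) (φ p) = φ' (f p) := congrArg (φ' ∘ f) (extChartAt_to_inv p)
  have hs' : Surjective (fderiv ℝ ((φ' ∘ f) ∘ φ.symm) (φ p)) := by
    have h := (hf.mdifferentiableAt (by simp)).mfderiv
    rw [I.range_eq_univ, fderivWithin_univ] at h
    exact fun w ↦ (hs w).imp fun v hv ↦ (DFunLike.congr_fun h v).symm.trans hv
  obtain ⟨τ, hτ, hright, hleft⟩ := exists_local_sections_of_contDiffAt (by simp) hg hs'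
  have hτ₀ := hleft.self_of_nhds
  rw [hg₀] at hτ hright hτ₀
  have hκ : ContMDiffAt (I.prod I') 𝓘(ℝ, E × E') ∞ (fun z : M × N ↦ (φ z.1, φ' z.2)) (p, f p) :=
    (contMDiffAt_extChartAt.comp (p, f p) contMDiffAt_fst).prodMk_space
      (contMDiffAt_extChartAt.comp (p, f p) contMDiffAt_snd)
  have hσ : ContMDiffAt (I.prod I') I ∞ (fun z : M × N ↦ φ.symm (τ (φ z.1, φ' z.2))) (p, f p) := by
    have hτκ := ContMDiffAt.comp (p, f p) hτ.contMDiffAt hκ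
    refine ContMDiffAt.comp (p, f p) (g := φ.symm) ?_ hτκ
    refine hτ₀.symm ▸ (contMDiffOn_extChartAt_symm p).contMDiffAt (extChartAt_target_mem_nhds p)
  have hσ₀ : φ.symm (τ (φ p, φ' (f p))) = p := (congrArg φ.symm hτ₀).trans (extChartAt_to_inv p)
  refine ⟨_, hσ, ?_, ?_⟩
  · have hfσ : ∀ᶠ z : M × N in 𝓝 (p, f p), f (φ.symm (τ (φ z.1, φ' z.2))) ∈ φ'.source :=
      (hσ₀ ▸ hσ.continuousAt.tendsto).eventually
        (hf.continuousAt.eventually (extChartAt_source_mem_nhds (f p)))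
    filter_upwards [hκ.continuousAt.eventually hright, hfσ,
      continuousAt_snd.eventually (extChartAt_source_mem_nhds (I := I') (f p))] with z hz hz₁ hz₂
    exact φ'.injOn hz₁ hz₂ hz
  · filter_upwards [extChartAt_source_mem_nhds (I := I) p,
      (continuousAt_extChartAt (I := I) p).eventually hleft] with q hq hτq
    have hgq : ((φ' ∘ f) ∘ φ.symm) (φ q) = φ' (f q) := congrArg (φ' ∘ f) (φ.left_inv hq)
    exact (congrArg (fun y ↦ φ.symm (τ (φ q, y))) hgq.symm).trans
      ((congrArg φ.symm hτq).trans (φ.left_inv hq))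

theorem HasVelocity.exists_lift [I.Boundaryless] [I'.Boundaryless] [IsManifold I ∞ M]
    [IsManifold I' ∞ N] {f : M → N} {b : TangentBundle I M} {d : ℝ → N}
    (hd : HasVelocity d (tangentMap I I' f b)) (hf : ContMDiffAt I I' ∞ f b.1)
    (hs : Surjective (mfderiv I I' f b.1)) :
    ∃ c : ℝ → M, HasVelocity c b ∧ ∀ᶠ t in 𝓝 0, f (c t) = d t := by
  obtain ⟨σ, hσ, hright, hleft⟩ := exists_local_sections hf hs
  obtain ⟨c, hc⟩ := exists_hasVelocity b
  have hσd : MDifferentiableAt (I.prod I') I σ (b.1, f b.1) := hσ.mdifferentiableAt (by simp)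
  have hfc : HasVelocity (f ∘ c) (tangentMap I I' f b) := hc.comp (hf.mdifferentiableAt (by simp))
  have hvelocity := ((hc.prodMk hfc).comp (f := σ) hσd).unique hc (hc.tendsto.eventually hleft)
  exact ⟨_, hvelocity ▸ (hc.prodMk hd).comp (f := σ) hσd,
    (hc.tendsto.prodMk_nhds hd.tendsto).eventually hright⟩

theorem isTangentTo_fibre [I.Boundaryless] [I'.Boundaryless] [IsManifold I ∞ M]
    [IsManifold I' ∞ N] {f : M → N} {b : TangentBundle I M} (hf : ContMDiffAt I I' ∞ f b.1)
    (hs : Surjective (mfderiv I I' f b.1)) (hb : mfderiv I I' f b.1 b.2 = 0) :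
    IsTangentTo (f ⁻¹' {f b.1}) b := by
  have hd : HasVelocity (fun _ ↦ f b.1) (tangentMap I I' f b) := by
    rw [tangentMap, hb]
    exact hasVelocity_const _
  exact hd.exists_lift hf hs

end Submersions

section ProductFields

variable
    {E : Type*} [NormedAddCommGroup E] [NormedSpace ℝ E]
    {H : Type*} [TopologicalSpace H] {I : ModelWithCorners ℝ E H}
    {M : Type*} [TopologicalSpace M] [ChartedSpace H M] [IsManifold I ∞ M]
    {E' : Type*} [NormedAddCommGroup E'] [NormedSpace ℝ E']
    {H' : Type*} [TopologicalSpace H'] {I' : ModelWithCorners ℝ E' H'}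
    {N : Type*} [TopologicalSpace N] [ChartedSpace H' N] [IsManifold I' ∞ N]

theorem isSmoothVectorField_zero : IsSmoothVectorField I (fun q : M ↦ (0 : TangentSpace I q)) :=
  contMDiff_zeroSection ℝ (TangentSpace I : M → Type _)

theorem IsSmoothVectorField.prod {V : ∀ q : M, TangentSpace I q} {W : ∀ r : N, TangentSpace I' r}
    (hV : IsSmoothVectorField I V) (hW : IsSmoothVectorField I' W) :
    IsSmoothVectorField (I.prod I')
      (fun z : M × N ↦ ((V z.1, W z.2) : TangentSpace (I.prod I') z)) :=
  contMDiff_equivTangentBundleProd_symm.comp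
    ((ContMDiff.comp hV contMDiff_fst).prodMk (ContMDiff.comp hW contMDiff_snd))

theorem IsSmoothVectorField.mlieBracket [CompleteSpace E] {V W : ∀ q : M, TangentSpace I q}
    (hV : IsSmoothVectorField I V) (hW : IsSmoothVectorField I W) :
    IsSmoothVectorField I (mlieBracket I V W) := by
  have : IsManifold I ((⊤ : ℕ∞) + 1) M := inferInstanceAs (IsManifold I ∞ M)
  have : IsManifold I (minSmoothness ℝ 2) M :=
    .of_le (n := ∞) (by rw [minSmoothness_of_isRCLikeNormedField]; norm_cast)
  exact fun p ↦ ContMDiffAt.mlieBracket_vectorField (m := ⊤) (n := ⊤)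
    hV.contMDiffAt hW.contMDiffAt (by simp)

variable [I.Boundaryless] [I'.Boundaryless]

theorem mfderiv_mlieBracket_of_forall_related {f : M → N} {V W : ∀ q : M, TangentSpace I q}
    {V' W' : ∀ r : N, TangentSpace I' r} (hf : ContMDiff I I' ∞ f)
    (hV : IsSmoothVectorField I V) (hW : IsSmoothVectorField I W)
    (hV' : IsSmoothVectorField I' V') (hW' : IsSmoothVectorField I' W')
    (hVV : ∀ q, mfderiv I I' f q (V q) = V' (f q))
    (hWW : ∀ q, mfderiv I I' f q (W q) = W' (f q)) (p : M) :
    mfderiv I I' f p (mlieBracket I V W p) = mlieBracket I' V' W' (f p) :=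
  mfderiv_mlieBracket_of_related hf.contMDiffAt hV.contMDiffAt hW.contMDiffAt hV'.contMDiffAt
    hW'.contMDiffAt (mem_univ p) (isTangentTo_univ _) (isTangentTo_univ _)
    (.of_forall hVV) (.of_forall hWW)

theorem mlieBracket_prod {V₁ V₂ : ∀ q : M, TangentSpace I q} {W₁ W₂ : ∀ r : N, TangentSpace I' r}
    (hV₁ : IsSmoothVectorField I V₁) (hV₂ : IsSmoothVectorField I V₂)
    (hW₁ : IsSmoothVectorField I' W₁) (hW₂ : IsSmoothVectorField I' W₂) (z : M × N) :
    mlieBracket (I.prod I')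
      (fun z : M × N ↦ ((V₁ z.1, W₁ z.2) : TangentSpace (I.prod I') z))
      (fun z : M × N ↦ ((V₂ z.1, W₂ z.2) : TangentSpace (I.prod I') z)) z =
    ((mlieBracket I V₁ V₂ z.1, mlieBracket I' W₁ W₂ z.2) : TangentSpace (I.prod I') z) := by
  have hfst := mfderiv_mlieBracket_of_forall_related contMDiff_fst (hV₁.prod hW₁) (hV₂.prod hW₂)
    hV₁ hV₂ (fun q ↦ DFunLike.congr_fun mfderiv_fst _) (fun q ↦ DFunLike.congr_fun mfderiv_fst _) z
  have hsnd := mfderiv_mlieBracket_of_forall_related contMDiff_snd (hV₁.prod hW₁) (hV₂.prod hW₂)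
    hW₁ hW₂ (fun q ↦ DFunLike.congr_fun mfderiv_snd _) (fun q ↦ DFunLike.congr_fun mfderiv_snd _) z
  rw [mfderiv_fst] at hfst
  rw [mfderiv_snd] at hsnd
  exact Prod.ext (x := (_ : E × E')) (y := (_ : E × E')) hfst hsnd

end ProductFields

/-! ### Linear vector fields -/

section LinearFields

variable
    {E : Type*} [NormedAddCommGroup E] [NormedSpace ℝ E]
    {H : Type*} [TopologicalSpace H] {I : ModelWithCorners ℝ E H}
    {M : Type*} [TopologicalSpace M] [ChartedSpace H M]
    {F : Type*} [NormedAddCommGroup F] [NormedSpace ℝ F]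
    {V : M → Type*} [∀ m, AddCommGroup (V m)] [∀ m, Module ℝ (V m)]
    [∀ m, TopologicalSpace (V m)] [TopologicalSpace (TotalSpace F V)]
    [FiberBundle F V] [VectorBundle ℝ F V]
    {F₂ : Type*} [NormedAddCommGroup F₂] [NormedSpace ℝ F₂]
    {V₂ : M → Type*} [∀ m, TopologicalSpace (V₂ m)] [TopologicalSpace (TotalSpace F₂ V₂)]
    [FiberBundle F₂ V₂]
    [IsManifold I ∞ M] [ContMDiffVectorBundle ∞ F V I]

theorem contMDiffAt_fibrewise {P : ∀ m, V m → V₂ m} {L : F →L[ℝ] F₂} {a : TotalSpace F V}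
    (hP : (fun b : TotalSpace F V ↦ (trivializationAt F₂ V₂ a.proj ⟨b.1, P b.1 b.2⟩).2) =ᶠ[𝓝 a]
      fun b ↦ L (trivializationAt F V a.proj b).2) :
    ContMDiffAt (I.prod 𝓘(ℝ, F)) (I.prod 𝓘(ℝ, F₂)) ∞
      (fun b : TotalSpace F V ↦ (⟨b.1, P b.1 b.2⟩ : TotalSpace F₂ V₂)) a := by
  have hproj : ContMDiffAt (I.prod 𝓘(ℝ, F)) I ∞ (π F V) a := contMDiff_proj V a
  exact (contMDiffAt_totalSpace ..).2 ⟨hproj, (L.contMDiff.contMDiffAt.comp a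
    (contMDiffAt_trivialization_snd (mem_baseSet_trivializationAt F V a.proj)))
      |>.congr_of_eventuallyEq hP⟩

variable [∀ m, AddCommGroup (V₂ m)] [∀ m, Module ℝ (V₂ m)] [VectorBundle ℝ F₂ V₂]
    [ContMDiffVectorBundle ∞ F₂ V₂ I]

theorem mfderiv_fibrewise {P : ∀ m, V m → V₂ m} {L : F →L[ℝ] F₂} {a : TotalSpace F V}
    (hP : (fun b : TotalSpace F V ↦ (trivializationAt F₂ V₂ a.proj ⟨b.1, P b.1 b.2⟩).2) =ᶠ[𝓝 a]
      fun b ↦ L (trivializationAt F V a.proj b).2)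
    (W : TangentSpace (I.prod 𝓘(ℝ, F)) a) :
    mfderiv (I.prod 𝓘(ℝ, F)) (I.prod 𝓘(ℝ, F₂))
      (fun b : TotalSpace F V ↦ (⟨b.1, P b.1 b.2⟩ : TotalSpace F₂ V₂)) a W =
      (((show E × F from W).1, L (show E × F from W).2) : E × F₂) := by
  set p : TotalSpace F V → TotalSpace F₂ V₂ := fun b ↦ ⟨b.1, P b.1 b.2⟩
  have hp : MDifferentiableAt (I.prod 𝓘(ℝ, F)) (I.prod 𝓘(ℝ, F₂)) p a :=
    (contMDiffAt_fibrewise hP).mdifferentiableAt (by simp)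
  let w : TangentBundle (I.prod 𝓘(ℝ, F)) (TotalSpace F V) := ⟨a, W⟩
  have hproj : MDifferentiableAt (I.prod 𝓘(ℝ, F₂)) I (π F₂ V₂) (p a) :=
    (contMDiff_proj V₂ (n := ∞)).mdifferentiable (by simp) _
  have hfst : mfderiv (I.prod 𝓘(ℝ, F₂)) I (π F₂ V₂) (p a)
      (mfderiv (I.prod 𝓘(ℝ, F)) (I.prod 𝓘(ℝ, F₂)) p a W) =
        mfderiv (I.prod 𝓘(ℝ, F)) I (π F V) a W :=
    (DFunLike.congr_fun (mfderiv_comp a hproj hp) W).symm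
  have hsnd : totalDifferential (I.prod 𝓘(ℝ, F₂)) (fun c ↦ (trivializationAt F₂ V₂ a.proj c).2)
      (tangentMap (I.prod 𝓘(ℝ, F)) (I.prod 𝓘(ℝ, F₂)) p w) =
        L (totalDifferential (I.prod 𝓘(ℝ, F)) (fun c ↦ (trivializationAt F V a.proj c).2) w) := by
    have ht := contMDiffAt_trivialization_snd (I := I) (mem_baseSet_trivializationAt F V a.proj)
    have ht₂ := contMDiffAt_trivialization_snd (I := I) (a := p a)
      (mem_baseSet_trivializationAt F₂ V₂ a.proj)
    calc
      _ = totalDifferential _ (fun b ↦ (trivializationAt F₂ V₂ a.proj (p b)).2) w :=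
          (totalDifferential_comp (b := w) (ht₂.mdifferentiableAt (by simp)) hp).symm
      _ = totalDifferential _ (L ∘ fun b ↦ (trivializationAt F V a.proj b).2) w :=
          totalDifferential_congr (w := w) hP
      _ = totalDifferential 𝓘(ℝ, F) L (tangentMap _ _ _ w) :=
          totalDifferential_comp (b := w) L.mdifferentiableAt (ht.mdifferentiableAt (by simp))
      _ = L (totalDifferential _ (fun c ↦ (trivializationAt F V a.proj c).2) w) :=
          DFunLike.congr_fun L.hasMFDerivAt.mfderiv _
  exact Prod.ext (x := (show E × F₂ from _))
    ((mfderiv_proj_apply (p a) _).symm.trans (hfst.trans (mfderiv_proj_apply a W)))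
    ((mfderiv_trivializationAt_snd_apply (p a) _).symm.trans
      (hsnd.trans (congrArg L (mfderiv_trivializationAt_snd_apply a W))))

theorem trivializationAt_add {m₀ m : M} (hm : m ∈ (trivializationAt F V m₀).baseSet)
    (X Y : V m) : (trivializationAt F V m₀ ⟨m, X + Y⟩).2 =
      (trivializationAt F V m₀ ⟨m, X⟩).2 + (trivializationAt F V m₀ ⟨m, Y⟩).2 :=
  ((trivializationAt F V m₀).linear ℝ hm).map_add X Y

theorem trivializationAt_smul {m₀ m : M} (hm : m ∈ (trivializationAt F V m₀).baseSet)
    (t : ℝ) (X : V m) : (trivializationAt F V m₀ ⟨m, t • X⟩).2 =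
      t • (trivializationAt F V m₀ ⟨m, X⟩).2 :=
  ((trivializationAt F V m₀).linear ℝ hm).map_smul t X

theorem eq_of_trivializationAt_snd_eq {m₀ m : M} (hm : m ∈ (trivializationAt F V m₀).baseSet)
    {X Y : V m} (h : (trivializationAt F V m₀ ⟨m, X⟩).2 = (trivializationAt F V m₀ ⟨m, Y⟩).2) :
    X = Y :=
  ((trivializationAt F V m₀).continuousLinearEquivAt ℝ m hm).injective h

variable {η : ∀ a : TotalSpace F V, TangentSpace (I.prod 𝓘(ℝ, F)) a}
  {x : ∀ m : M, TangentSpace I m} {K : ∀ m, V m →ₗ[ℝ] F}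

variable (I K x η) in
/-- The vector field `η` on the total space lies over `x`, and in the preferred trivialization at
`m` its fibre component on `V m` is the linear map `K m`. -/
def HasFibreComponent : Prop :=
  ∀ m X, η ⟨m, X⟩ = ((x m, K m X) : E × F)

theorem trivializationAt_tangent_totalSpace_snd (a b : TotalSpace F V)
    (hη : (show E × F from η b).1 = x b.proj) (hb : b ∈ (chartAt (ModelProd H F) a).source)
    (hproj : b.proj ∈ (chartAt H a.proj).source)
    (htriv : b.proj ∈ (trivializationAt F V a.proj).baseSet)
    (hchart : extChartAt (I.prod 𝓘(ℝ, F)) a =ᶠ[𝓝 b]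
      fun c ↦ ((extChartAt I a.proj ∘ π F V) c, (trivializationAt F V a.proj c).2)) :
    (trivializationAt (E × F) (TangentSpace (I.prod 𝓘(ℝ, F)) : TotalSpace F V → Type _) a
      ⟨b, η b⟩).2 =
      (vectorDerivAlong I x (extChartAt I a.proj) b.proj,
        vectorDerivAlong (I.prod 𝓘(ℝ, F)) η (fun c ↦ (trivializationAt F V a.proj c).2) b) := by
  let w : TangentBundle (I.prod 𝓘(ℝ, F)) (TotalSpace F V) := ⟨b, η b⟩
  have hπ : MDifferentiableAt (I.prod 𝓘(ℝ, F)) I (π F V) b :=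
    (contMDiff_proj V (n := ∞)).mdifferentiable (by simp) b
  have hbase : MDifferentiableAt (I.prod 𝓘(ℝ, F)) 𝓘(ℝ, E) (extChartAt I a.proj ∘ π F V) b :=
    (mdifferentiableAt_extChartAt (I := I) hproj).comp b hπ
  have hfibre := (contMDiffAt_trivialization_snd (I := I) htriv).mdifferentiableAt (by simp)
  have hpair : totalDifferential (I.prod 𝓘(ℝ, F))
      (fun c ↦ ((extChartAt I a.proj ∘ π F V) c, (trivializationAt F V a.proj c).2)) w =
        (totalDifferential (I.prod 𝓘(ℝ, F)) (extChartAt I a.proj ∘ π F V) w,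
          totalDifferential (I.prod 𝓘(ℝ, F)) (fun c ↦ (trivializationAt F V a.proj c).2) w) :=
    DFunLike.congr_fun
      (hasMFDerivAt_prodMk_space hbase.hasMFDerivAt hfibre.hasMFDerivAt).mfderiv (η b)
  have hfst : totalDifferential (I.prod 𝓘(ℝ, F)) (extChartAt I a.proj ∘ π F V) w =
      vectorDerivAlong I x (extChartAt I a.proj) b.proj :=
    vectorDerivAlong_comp_of_related (mdifferentiableAt_extChartAt (I := I) hproj) hπ
      ((mfderiv_proj_apply b (η b)).trans hη)
  exact (trivializationAt_tangent_snd (b := w) hb).trans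
    ((totalDifferential_congr (w := w) hchart).trans
      (hpair.trans (congrArg (fun v ↦ (v, totalDifferential (I.prod 𝓘(ℝ, F))
        (fun c ↦ (trivializationAt F V a.proj c).2) w)) hfst)))

theorem contMDiffAt_vectorField_totalSpace (hx : IsSmoothVectorField I x)
    (hη : ∀ a, (show E × F from η a).1 = x a.proj) {a : TotalSpace F V}
    (hfibre : ContMDiffAt (I.prod 𝓘(ℝ, F)) 𝓘(ℝ, F) ∞ (vectorDerivAlong (I.prod 𝓘(ℝ, F)) η
      (fun c ↦ (trivializationAt F V a.proj c).2)) a) :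
    ContMDiffAt (I.prod 𝓘(ℝ, F)) (I.prod 𝓘(ℝ, F)).tangent ∞
      (fun b ↦ (⟨b, η b⟩ : TangentBundle (I.prod 𝓘(ℝ, F)) (TotalSpace F V))) a := by
  have hbase : ContMDiffAt (I.prod 𝓘(ℝ, F)) 𝓘(ℝ, E) ∞
      (fun b : TotalSpace F V ↦ vectorDerivAlong I x (extChartAt I a.proj) b.proj) a :=
    ((contMDiffAt_totalDifferential_extChartAt ⟨a.proj, x a.proj⟩).comp a.proj (hx a.proj)).comp a
      (contMDiff_proj V (n := ∞)).contMDiffAt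
  refine (contMDiffAt_totalSpace ..).2 ⟨contMDiffAt_id,
    (hbase.prodMk_space hfibre).congr_of_eventuallyEq ?_⟩
  filter_upwards [chart_source_mem_nhds (ModelProd H F) a, eventually_proj_mem_baseSet a,
    eventually_proj (chart_source_mem_nhds H a.proj),
    (eventuallyEq_extChartAt_totalSpace (I := I) a).eventuallyEq_nhds] with b hb htriv hproj hchart
  exact trivializationAt_tangent_totalSpace_snd a b (hη b) hb hproj htriv hchart

theorem HasFibreComponent.isLinearVectorField (hηK : HasFibreComponent I η x K)
    (hη : IsSmoothVectorField (I.prod 𝓘(ℝ, F)) η) (hx : IsSmoothVectorField I x) :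
    IsLinearVectorField I η x where
  smooth := hη
  smooth_base := hx
  proj a := (mfderiv_proj_apply a (η a)).trans
    (congrArg (fun z : E × F ↦ z.1) (hηK a.1 a.2))
  add m X Y := by
    refine ⟨((x m, (K m X, K m Y)) : E × F × F), ?_, ?_, ?_⟩
    · refine (mfderiv_fibrewise (I := I) (V := V ×ᵇ V) (P := fun m (a : V m × V m) ↦ a.1)
        (L := ContinuousLinearMap.fst ℝ F F) (a := ⟨m, (X, Y)⟩) .rfl _).trans ?_
      exact (hηK m X).symm
    · refine (mfderiv_fibrewise (I := I) (V := V ×ᵇ V) (P := fun m (a : V m × V m) ↦ a.2)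
        (L := ContinuousLinearMap.snd ℝ F F) (a := ⟨m, (X, Y)⟩) .rfl _).trans ?_
      exact (hηK m Y).symm
    · refine (mfderiv_fibrewise (I := I) (V := V ×ᵇ V) (P := fun m (a : V m × V m) ↦ a.1 + a.2)
        (L := ContinuousLinearMap.fst ℝ F F + ContinuousLinearMap.snd ℝ F F)
        (a := ⟨m, (X, Y)⟩) ?_ _).trans ?_
      · filter_upwards [eventually_proj_mem_baseSet _] with b hb
        exact trivializationAt_add hb.1 b.2.1 b.2.2
      refine Eq.trans ?_ (hηK m (X + Y)).symm
      exact congrArg (fun v : F ↦ ((x m, v) : E × F)) ((K m).map_add X Y).symm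
  smul t m X := by
    refine (mfderiv_fibrewise (I := I) (P := fun m (a : V m) ↦ t • a)
      (L := t • ContinuousLinearMap.id ℝ F) (a := ⟨m, X⟩) ?_ _).trans ?_
    · filter_upwards [eventually_proj_mem_baseSet _] with b hb
      exact trivializationAt_smul hb t b.2
    refine Eq.trans ?_ (hηK m (t • X)).symm
    exact (congrArg (fun z : E × F ↦ (z.1, t • z.2)) (hηK m X)).trans
      (congrArg (fun v : F ↦ ((x m, v) : E × F)) ((K m).map_smul t X).symm)

end LinearFields

section Operators

variable
    {E : Type*} [NormedAddCommGroup E] [NormedSpace ℝ E]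
    {H : Type*} [TopologicalSpace H] {I : ModelWithCorners ℝ E H}
    {M : Type*} [TopologicalSpace M] [ChartedSpace H M]
    {F : Type*} [NormedAddCommGroup F] [NormedSpace ℝ F]

theorem vectorDerivAlong_add {W : ∀ m : M, TangentSpace I m} {f g : M → F} {m : M}
    (hf : MDifferentiableAt I 𝓘(ℝ, F) f m) (hg : MDifferentiableAt I 𝓘(ℝ, F) g m) :
    vectorDerivAlong I W (fun q ↦ f q + g q) m =
      vectorDerivAlong I W f m + vectorDerivAlong I W g m :=
  DFunLike.congr_fun (hf.hasMFDerivAt.add hg.hasMFDerivAt).mfderiv (W m)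

theorem vectorDerivAlong_smul {W : ∀ m : M, TangentSpace I m} {f : M → ℝ} {g : M → F} {m : M}
    (hf : MDifferentiableAt I 𝓘(ℝ, ℝ) f m) (hg : MDifferentiableAt I 𝓘(ℝ, F) g m) :
    vectorDerivAlong I W (fun q ↦ f q • g q) m =
      f m • vectorDerivAlong I W g m + derivAlong I W f m • g m := by
  have hsmul : HasFDerivAt (fun z : ℝ × F ↦ z.1 • z.2) _ (f m, g m) :=
    (hasFDerivAt_fst (𝕜 := ℝ) (p := (f m, g m))).smul
      (hasFDerivAt_snd (𝕜 := ℝ) (p := (f m, g m)))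
  have hcomp : HasMFDerivAt I 𝓘(ℝ, F) (fun q ↦ f q • g q) m _ :=
    hsmul.hasMFDerivAt.comp m (hasMFDerivAt_prodMk_space hf.hasMFDerivAt hg.hasMFDerivAt)
  exact DFunLike.congr_fun hcomp.mfderiv (W m)

variable
    {V : M → Type*} [∀ m, AddCommGroup (V m)] [∀ m, Module ℝ (V m)]
    [∀ m, TopologicalSpace (V m)] [TopologicalSpace (TotalSpace F V)]
    [FiberBundle F V] [VectorBundle ℝ F V]

variable (F V) in
/-- The section `X` read in the preferred trivialization at `m₀`. -/
def sectionCoord (X : ∀ m, V m) (m₀ m : M) : F := (trivializationAt F V m₀ ⟨m, X m⟩).2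

theorem exists_dual_coordinates
    (φ : Cₛ^∞⟮I; F →L[ℝ] ℝ, fun m ↦ V m →L[ℝ] Trivial M ℝ m⟯) (m : M) :
    ∃ φ' : M → F →L[ℝ] ℝ, MDifferentiableAt I 𝓘(ℝ, F →L[ℝ] ℝ) φ' m ∧
      ∀ m' ∈ (trivializationAt F V m).baseSet, ∀ v : V m',
        φ m' v = φ' m' (trivializationAt F V m ⟨m', v⟩).2 := by
  have hsmooth := ((contMDiffAt_hom_bundle _).1 (φ.contMDiff m)).2
  refine ⟨_, hsmooth.mdifferentiableAt (by simp), fun m' hm' v ↦ ?_⟩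
  change φ m' v = ContinuousLinearMap.inCoordinates F V ℝ (Trivial M ℝ) m m' m m' (φ m') _
  rw [ContinuousLinearMap.inCoordinates_eq hm' (by simp)]
  exact congrArg (φ m')
    (((trivializationAt F V m).continuousLinearEquivAt ℝ m' hm').symm_apply_apply v).symm

variable [IsManifold I ∞ M] [ContMDiffVectorBundle ∞ F V I]

theorem exists_section_apply_eq [FiniteDimensional ℝ E] [T2Space M] (m : M) (v : V m) :
    ∃ X : Cₛ^∞⟮I; F, V⟯, X m = v := by
  set e := trivializationAt F V m
  have hm : m ∈ e.baseSet := mem_baseSet_trivializationAt F V m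
  obtain ⟨ρ, -, hρ⟩ := (SmoothBumpFunction.nhds_basis_tsupport (I := I) m).mem_iff.1
    (e.open_baseSet.mem_nhds hm)
  have hconst : ContMDiffOn I (I.prod 𝓘(ℝ, F)) ∞
      (fun m' ↦ (⟨m', e.symm m' (e ⟨m, v⟩).2⟩ : TotalSpace F V)) e.baseSet :=
    ((e.contMDiffOn_symm (IB := I) (n := ∞)).comp
      (contMDiff_id.prodMk contMDiff_const).contMDiffOn fun m' hm' ↦ e.mem_target.2 hm').congr
        fun m' hm' ↦ e.mk_symm hm' _
  refine ⟨⟨_, ContMDiffOn.smul_section_of_tsupport (ψ := ρ) ρ.contMDiff.contMDiffOn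
    e.open_baseSet hρ hconst⟩, ?_⟩
  change ρ m • e.symm m (e ⟨m, v⟩).2 = v
  rw [ρ.eq_one, one_smul]
  exact e.symm_apply_apply_mk hm v

theorem mdifferentiableAt_sectionCoord (X : Cₛ^∞⟮I; F, V⟯) (m : M) :
    MDifferentiableAt I 𝓘(ℝ, F) (sectionCoord F V X m) m :=
  ((contMDiffAt_trivialization_snd (I := I) (a := ⟨m, X m⟩)
    (mem_baseSet_trivializationAt F V m)).comp m X.contMDiff.contMDiffAt).mdifferentiableAt
    (by simp)

variable
  {η : ∀ a : TotalSpace F V, TangentSpace (I.prod 𝓘(ℝ, F)) a}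
  {x : ∀ m : M, TangentSpace I m} {K : ∀ m, V m →ₗ[ℝ] F}
  {D : Cₛ^∞⟮I; F, V⟯ → Cₛ^∞⟮I; F, V⟯}

variable (I x K D) in
/-- In the preferred trivialization at `m`, the operator `D` is `X ↦ x(X) - K X` at the point
`m`. -/
def HasConnectionTerm : Prop :=
  ∀ X m, sectionCoord F V (D X) m m = vectorDerivAlong I x (sectionCoord F V X m) m - K m (X m)

namespace HasConnectionTerm

theorem leibniz (hD : HasConnectionTerm I x K D) {f : M → ℝ} (hf : ContMDiff I 𝓘(ℝ, ℝ) ∞ f)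
    {X Y : Cₛ^∞⟮I; F, V⟯} (hXY : ∀ m, Y m = f m • X m) (m : M) :
    D Y m = f m • D X m + derivAlong I x f m • X m := by
  have hm := mem_baseSet_trivializationAt F V m
  have hcoord : sectionCoord F V Y m =ᶠ[𝓝 m] fun m' ↦ f m' • sectionCoord F V X m m' := by
    filter_upwards [(trivializationAt F V m).open_baseSet.mem_nhds hm] with m' hm'
    rw [sectionCoord, hXY, trivializationAt_smul hm', sectionCoord]
  have hderiv : vectorDerivAlong I x (sectionCoord F V Y m) m =
      f m • vectorDerivAlong I x (sectionCoord F V X m) m +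
        derivAlong I x f m • sectionCoord F V X m m :=
    (totalDifferential_congr (w := ⟨m, x m⟩) hcoord).trans
      (vectorDerivAlong_smul (hf.mdifferentiable (by simp) m) (mdifferentiableAt_sectionCoord X m))
  apply eq_of_trivializationAt_snd_eq hm
  rw [trivializationAt_add hm, trivializationAt_smul hm, trivializationAt_smul hm]
  change sectionCoord F V (D Y) m m =
    f m • sectionCoord F V (D X) m m + derivAlong I x f m • sectionCoord F V X m m
  rw [hD, hD, hderiv, hXY, map_smul, smul_sub]
  abel

theorem map_add (hD : HasConnectionTerm I x K D) (X Y : Cₛ^∞⟮I; F, V⟯) :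
    D (X + Y) = D X + D Y := by
  ext m
  have hm := mem_baseSet_trivializationAt F V m
  have hcoord : sectionCoord F V (X + Y) m =ᶠ[𝓝 m]
      fun m' ↦ sectionCoord F V X m m' + sectionCoord F V Y m m' := by
    filter_upwards [(trivializationAt F V m).open_baseSet.mem_nhds hm] with m' hm'
    exact trivializationAt_add hm' (X m') (Y m')
  have hderiv : vectorDerivAlong I x (sectionCoord F V (X + Y) m) m =
      vectorDerivAlong I x (sectionCoord F V X m) m +
        vectorDerivAlong I x (sectionCoord F V Y m) m :=
    (totalDifferential_congr (w := ⟨m, x m⟩) hcoord).trans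
      (vectorDerivAlong_add (mdifferentiableAt_sectionCoord X m)
        (mdifferentiableAt_sectionCoord Y m))
  apply eq_of_trivializationAt_snd_eq hm
  rw [ContMDiffSection.coe_add, Pi.add_apply, trivializationAt_add hm]
  change sectionCoord F V (D (X + Y)) m m =
    sectionCoord F V (D X) m m + sectionCoord F V (D Y) m m
  rw [hD, hD, hD, ContMDiffSection.coe_add, hderiv, Pi.add_apply, _root_.map_add]
  abel

theorem isCovariantDifferentialOperator (hD : HasConnectionTerm I x K D) :
    IsCovariantDifferentialOperator I x D where
  add := hD.map_add
  smul t X := by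
    ext m
    have hconst : derivAlong I x (fun _ ↦ t) m = 0 := by
      rw [derivAlong, mfderiv_const]
      rfl
    rw [hD.leibniz (f := fun _ ↦ t) contMDiff_const (X := X) (fun _ ↦ rfl) m, hconst, zero_smul,
      add_zero]
    rfl
  leibniz _ hf _ _ hXY := hD.leibniz hf hXY

end HasConnectionTerm

theorem derivAlong_fibrewiseLinear (hηK : HasFibreComponent I η x K) {m : M} (X : V m)
    {φ : ∀ m, V m →L[ℝ] Trivial M ℝ m} {φ' : M → F →L[ℝ] ℝ}
    (hφ' : MDifferentiableAt I 𝓘(ℝ, F →L[ℝ] ℝ) φ' m)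
    (hφ : ∀ m' ∈ (trivializationAt F V m).baseSet, ∀ v : V m',
      φ m' v = φ' m' (trivializationAt F V m ⟨m', v⟩).2) :
    derivAlong (I.prod 𝓘(ℝ, F)) η (fibrewiseLinear φ) ⟨m, X⟩ =
      vectorDerivAlong I x φ' m (trivializationAt F V m ⟨m, X⟩).2 + φ' m (K m X) := by
  let w : TangentBundle (I.prod 𝓘(ℝ, F)) (TotalSpace F V) := ⟨⟨m, X⟩, η ⟨m, X⟩⟩
  have hcoord : fibrewiseLinear φ =ᶠ[𝓝 (⟨m, X⟩ : TotalSpace F V)]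
      fun a ↦ (φ' ∘ π F V) a (trivializationAt F V m a).2 := by
    filter_upwards [eventually_proj_mem_baseSet (⟨m, X⟩ : TotalSpace F V)] with a ha
    exact hφ a.1 ha a.2
  have hproj : MDifferentiableAt (I.prod 𝓘(ℝ, F)) I (π F V) ⟨m, X⟩ :=
    (contMDiff_proj V (n := ∞)).mdifferentiable (by simp) _
  have htriv := (contMDiffAt_trivialization_snd (I := I) (a := (⟨m, X⟩ : TotalSpace F V))
    (mem_baseSet_trivializationAt F V m)).mdifferentiableAt (by simp)
  have hbase : totalDifferential (I.prod 𝓘(ℝ, F)) (φ' ∘ π F V) w = vectorDerivAlong I x φ' m :=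
    vectorDerivAlong_comp_of_related hφ' hproj
      ((mfderiv_proj_apply _ _).trans (congrArg (fun z : E × F ↦ z.1) (hηK m X)))
  have hfibre : totalDifferential (I.prod 𝓘(ℝ, F)) (fun a ↦ (trivializationAt F V m a).2) w =
      K m X :=
    (mfderiv_trivializationAt_snd_apply _ _).trans (congrArg (fun z : E × F ↦ z.2) (hηK m X))
  exact (totalDifferential_congr (w := w) hcoord).trans ((totalDifferential_clm_apply (b := w)
    (MDifferentiableAt.comp (I' := I) (⟨m, X⟩ : TotalSpace F V) hφ' hproj) htriv).trans
      (congrArg₂ (fun (L : F →L[ℝ] ℝ) v ↦ L (trivializationAt F V m ⟨m, X⟩).2 + φ' m v)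
        hbase hfibre))

variable [∀ m, IsTopologicalAddGroup (V m)] [∀ m, ContinuousSMul ℝ (V m)]

theorem HasConnectionTerm.isOperatorOf (hD : HasConnectionTerm I x K D)
    (hηK : HasFibreComponent I η x K) : IsOperatorOf I η x D := by
  intro φ X m
  obtain ⟨φ', hφ', hφ⟩ := exists_dual_coordinates φ m
  have hm := mem_baseSet_trivializationAt F V m
  have hcoord : (fun m' ↦ (φ m' (X m') : ℝ)) =ᶠ[𝓝 m] fun m' ↦ φ' m' (sectionCoord F V X m m') := by
    filter_upwards [(trivializationAt F V m).open_baseSet.mem_nhds hm] with m' hm'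
    exact hφ m' hm' _
  have hpairing : derivAlong I x (fun m' ↦ (φ m' (X m') : ℝ)) m =
      vectorDerivAlong I x φ' m (sectionCoord F V X m m) +
        φ' m (vectorDerivAlong I x (sectionCoord F V X m) m) :=
    (totalDifferential_congr (w := ⟨m, x m⟩) hcoord).trans
      (totalDifferential_clm_apply (b := ⟨m, x m⟩) hφ' (mdifferentiableAt_sectionCoord X m))
  have hlinear : derivAlong (I.prod 𝓘(ℝ, F)) η (fibrewiseLinear φ) ⟨m, X m⟩ =
      vectorDerivAlong I x φ' m (sectionCoord F V X m m) + φ' m (K m (X m)) :=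
    derivAlong_fibrewiseLinear hηK (X m) hφ' hφ
  have hD_pairing : (φ m (D X m) : ℝ) = φ' m (sectionCoord F V (D X) m m) := hφ m hm _
  rw [hD_pairing, hpairing, hlinear, hD, map_sub]
  abel

theorem isOperatorOf_unique [FiniteDimensional ℝ E] [T2Space M]
    {D' : Cₛ^∞⟮I; F, V⟯ → Cₛ^∞⟮I; F, V⟯} (hD : IsOperatorOf I η x D)
    (hD' : IsOperatorOf I η x D') : D = D' := by
  funext X
  ext m
  have hm := mem_baseSet_trivializationAt F V m
  apply eq_of_trivializationAt_snd_eq hm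
  refine (SeparatingDual.eq_iff_forall_dual_eq (R := ℝ)).2 fun ℓ ↦ ?_
  let ψ : V m →L[ℝ] Trivial M ℝ m :=
    ℓ ∘L ((trivializationAt F V m).continuousLinearEquivAt ℝ m hm : V m →L[ℝ] F)
  obtain ⟨φ, hφ⟩ := exists_section_apply_eq (I := I) (F := F →L[ℝ] ℝ)
    (V := fun m ↦ V m →L[ℝ] Trivial M ℝ m) m ψ
  have hpairing : (φ m (D X m) : ℝ) = φ m (D' X m) := (hD φ X m).trans (hD' φ X m).symm
  rw [hφ] at hpairing
  exact hpairing

theorem HasConnectionTerm.isOperatorOf_iff [FiniteDimensional ℝ E] [T2Space M]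
    (hD : HasConnectionTerm I x K D) (hηK : HasFibreComponent I η x K)
    (D' : Cₛ^∞⟮I; F, V⟯ → Cₛ^∞⟮I; F, V⟯) : IsOperatorOf I η x D' ↔ D' = D :=
  ⟨fun hD' ↦ isOperatorOf_unique hD' (hD.isOperatorOf hηK), fun h ↦ h ▸ hD.isOperatorOf hηK⟩

end Operators

section CompleteLift

variable
    {E : Type*} [NormedAddCommGroup E] [NormedSpace ℝ E]
    {H : Type*} [TopologicalSpace H] {I : ModelWithCorners ℝ E H}
    {M : Type*} [TopologicalSpace M] [ChartedSpace H M]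
    {F : Type*} [NormedAddCommGroup F] [NormedSpace ℝ F]
    {x : ∀ m : M, TangentSpace I m}

/-- The fibre component of the complete lift of `x` over `m`: the derivative at `m` of the
coordinate representation of `x` in the preferred chart at `m`. -/
def completeLiftComponent (x : ∀ m : M, TangentSpace I m) (m : M) : TangentSpace I m →ₗ[ℝ] E :=
  (mfderiv I 𝓘(ℝ, E) (vectorDerivAlong I x (extChartAt I m)) m).toLinearMap

variable [IsManifold I ∞ M]

theorem sectionCoord_tangent {y : ∀ m : M, TangentSpace I m} {m₀ m : M}
    (hm : m ∈ (chartAt H m₀).source) :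
    sectionCoord E (TangentSpace I : M → Type _) y m₀ m =
      vectorDerivAlong I y (extChartAt I m₀) m :=
  trivializationAt_tangent_snd (b := (⟨m, y m⟩ : TangentBundle I M)) hm

/-- The complete lift of `x`, given by its components in the preferred chart. By
`mk_completeLift` it is `J ∘ T(x)`, where `J` is the canonical involution. -/
def completeLift (x : ∀ m : M, TangentSpace I m) (v : TangentBundle I M) :
    TangentSpace I.tangent v :=
  ((x v.1, completeLiftComponent x v.1 v.2) : E × E)

theorem hasFibreComponent_completeLift :
    HasFibreComponent I (completeLift x) x (completeLiftComponent x) :=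
  fun _ _ ↦ rfl

theorem mk_completeLift (hx : IsSmoothVectorField I x) (v : TangentBundle I M) :
    (⟨v, completeLift x v⟩ : TangentBundle I.tangent (TangentBundle I M)) =
      canonicalInvolution I (tangentMap I I.tangent (T% x) v) := by
  have hxv : MDifferentiableAt I I.tangent (T% x) v.1 := hx.mdifferentiable (by simp) v.1
  have hfst : (show E × E from mfderiv I I.tangent (T% x) v.1 v.2).1 = v.2 :=
    snd_eq_of_mk_eq (W := fun _ ↦ v.2) (canonicalInvolution_tangentMap_proj hxv)
  have hsnd : (show E × E from mfderiv I I.tangent (T% x) v.1 v.2).2 =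
      completeLiftComponent x v.1 v.2 :=
    Eq.trans (α := E)
      (mfderiv_totalDifferential_extChartAt (⟨v.1, x v.1⟩ : TangentBundle I M) _).symm
      (totalDifferential_comp (b := v) ((contMDiffAt_totalDifferential_extChartAt
        (⟨v.1, x v.1⟩ : TangentBundle I M)).mdifferentiableAt (by simp)) hxv).symm
  exact (congrArg₂ (fun u w : E ↦ (⟨⟨v.1, u⟩, ((x v.1, w) : E × E)⟩ :
    TangentBundle I.tangent (TangentBundle I M))) hfst hsnd).symm

variable [I.Boundaryless]

theorem totalDifferential_completeLift (hx : IsSmoothVectorField I x) {ψ : M → F}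
    {v : TangentBundle I M} (hψ : ContMDiffAt I 𝓘(ℝ, F) ∞ ψ v.1) :
    totalDifferential I.tangent (totalDifferential I ψ) ⟨v, completeLift x v⟩ =
      totalDifferential I (vectorDerivAlong I x ψ) v := by
  rw [mk_completeLift hx]
  exact Eq.trans (α := F)
    (mfderiv_totalDifferential_canonicalInvolution (tangentMap I I.tangent (T% x) v)
      (hψ.of_le (by norm_cast)))
    (totalDifferential_comp (b := v) ((contMDiffAt_totalDifferential
      (b := (⟨v.1, x v.1⟩ : TangentBundle I M)) hψ).mdifferentiableAt (by simp))
      (hx.mdifferentiable (by simp) v.1)).symm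

theorem isSmoothVectorField_completeLift (hx : IsSmoothVectorField I x) :
    IsSmoothVectorField I.tangent (completeLift x) := by
  intro v
  refine contMDiffAt_vectorField_totalSpace (V := (TangentSpace I : M → Type _)) hx
    (fun _ ↦ rfl) ?_
  have hsmooth : ContMDiffAt I 𝓘(ℝ, E) ∞ (vectorDerivAlong I x (extChartAt I v.1)) v.1 :=
    contMDiffAt_vectorDerivAlong contMDiffAt_extChartAt (hx v.1)
  refine (contMDiffAt_totalDifferential (b := v) hsmooth).congr_of_eventuallyEq ?_
  filter_upwards [eventually_proj (a := v) (chart_source_mem_nhds H v.1)] with b hb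
  have hcoord : (fun c : TangentBundle I M ↦ (trivializationAt E (TangentSpace I) v.1 c).2) =ᶠ[𝓝 b]
      totalDifferential I (extChartAt I v.1) := by
    filter_upwards [eventually_proj (a := b) ((chartAt H v.1).open_source.mem_nhds hb)] with c hc
    exact trivializationAt_tangent_snd hc
  exact (totalDifferential_congr (w := ⟨b, completeLift x b⟩) hcoord).trans
    (totalDifferential_completeLift hx (contMDiffAt_extChartAt' hb))

theorem isCompleteLift_completeLift (hx : IsSmoothVectorField I x) :
    IsCompleteLift I x (completeLift x) where
  smooth := isSmoothVectorField_completeLift hx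
  lift _ hf _ := totalDifferential_completeLift hx hf.contMDiffAt

theorem isLinearVectorField_completeLift (hx : IsSmoothVectorField I x) :
    IsLinearVectorField I (completeLift x) x :=
  hasFibreComponent_completeLift.isLinearVectorField (isSmoothVectorField_completeLift hx) hx

variable [CompleteSpace E]

/-- The Lie derivative along `x`, as an operator on sections of the tangent bundle. -/
def lieDerivative (hx : IsSmoothVectorField I x)
    (y : Cₛ^∞⟮I; E, (TangentSpace I : M → Type _)⟯) :
    Cₛ^∞⟮I; E, (TangentSpace I : M → Type _)⟯ :=
  ⟨mlieBracket I x y, hx.mlieBracket y.contMDiff⟩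

theorem hasConnectionTerm_lieDerivative (hx : IsSmoothVectorField I x) :
    HasConnectionTerm I x (completeLiftComponent x) (lieDerivative hx) := by
  intro y m
  have hcoord : sectionCoord E (TangentSpace I : M → Type _) y m =ᶠ[𝓝 m]
      vectorDerivAlong I y (extChartAt I m) := by
    filter_upwards [chart_source_mem_nhds H m] with q hq
    exact sectionCoord_tangent hq
  have hbracket : sectionCoord E (TangentSpace I : M → Type _) (lieDerivative hx y) m m =
      (show E from mlieBracket I x y m) :=
    (sectionCoord_tangent (mem_chart_source H m)).trans
      (totalDifferential_extChartAt_self (⟨m, mlieBracket I x y m⟩ : TangentBundle I M))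
  have hderiv : vectorDerivAlong I x (sectionCoord E (TangentSpace I : M → Type _) y m) m =
      vectorDerivAlong I x (vectorDerivAlong I y (extChartAt I m)) m :=
    totalDifferential_congr (w := (⟨m, x m⟩ : TangentBundle I M)) hcoord
  rw [hderiv, hbracket, mlieBracket_eq_sub (hx m) (y.contMDiff m)]
  rfl

end CompleteLift

/-! ### Lie groupoids -/

namespace LieGroupoid

variable
    {EG : Type*} [NormedAddCommGroup EG] [NormedSpace ℝ EG]
    {HG : Type*} [TopologicalSpace HG] {IG : ModelWithCorners ℝ EG HG}
    {G : Type*} [TopologicalSpace G] [ChartedSpace HG G]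
    {EM : Type*} [NormedAddCommGroup EM] [NormedSpace ℝ EM]
    {HM : Type*} [TopologicalSpace HM] {IM : ModelWithCorners ℝ EM HM}
    {M : Type*} [TopologicalSpace M] [ChartedSpace HM M]
    {F : Type*} [NormedAddCommGroup F] [NormedSpace ℝ F]
    (𝒢 : LieGroupoid IG G IM M)

local notation "IA" => ModelWithCorners.prod IM 𝓘(ℝ, AlgebroidModel EG EM)
local notation "AG" => TotalSpace (AlgebroidModel EG EM) (LieGroupoid.Algebroid 𝒢)
local notation "ΓAG" => Cₛ^∞⟮IM; AlgebroidModel EG EM, LieGroupoid.Algebroid 𝒢⟯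

/-- The domain `G ×_M G` of the product. -/
def composable : Set (G × G) := {p | 𝒢.src p.1 = 𝒢.tgt p.2}

/-- The tangent map of the right translation `h ↦ h g`, which is only defined on the source fibre
over the target of `g`; it is meant for vectors tangent to that fibre. -/
def rightMul (g : G) (b : TangentBundle IG G) : TangentBundle IG G :=
  ⟨𝒢.mul b.1 g, mfderivWithin IG IG (fun h ↦ 𝒢.mul h g) {h | 𝒢.src h = 𝒢.tgt g} b.1 b.2⟩

theorem mdifferentiable_src : MDifferentiable IG IM 𝒢.src :=
  𝒢.contMDiff_src.mdifferentiable (by simp)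

theorem mdifferentiable_tgt : MDifferentiable IG IM 𝒢.tgt :=
  𝒢.contMDiff_tgt.mdifferentiable (by simp)

theorem mdifferentiable_one : MDifferentiable IM IG 𝒢.one :=
  𝒢.contMDiff_one.mdifferentiable (by simp)

theorem mdifferentiableWithinAt_mul {z : G × G} (hz : z ∈ 𝒢.composable) :
    MDifferentiableWithinAt (IG.prod IG) IG (fun p : G × G ↦ 𝒢.mul p.1 p.2) 𝒢.composable z :=
  (𝒢.contMDiffOn_mul z hz).mdifferentiableWithinAt (by simp)

theorem mdifferentiableWithinAt_rightTranslation {h g : G} (hg : 𝒢.src h = 𝒢.tgt g) :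
    MDifferentiableWithinAt IG IG (fun h ↦ 𝒢.mul h g) {h | 𝒢.src h = 𝒢.tgt g} h := by
  have hpair : ContMDiffWithinAt IG (IG.prod IG) ∞ (fun h ↦ (h, g)) {h | 𝒢.src h = 𝒢.tgt g} h :=
    contMDiffWithinAt_id.prodMk contMDiffWithinAt_const
  exact ((𝒢.contMDiffOn_mul (h, g) hg).comp h hpair fun _ hk ↦ hk).mdifferentiableWithinAt
    (by simp)

theorem hasVelocity_rightMul {c : ℝ → G} {b : TangentBundle IG G} (hc : HasVelocity c b) {g : G}
    (hb : 𝒢.src b.1 = 𝒢.tgt g) (hcg : ∀ᶠ t in 𝓝 0, 𝒢.src (c t) = 𝒢.tgt g) :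
    HasVelocity (fun t ↦ 𝒢.mul (c t) g) (𝒢.rightMul g b) :=
  hc.comp_within hcg (𝒢.mdifferentiableWithinAt_rightTranslation hb).hasMFDerivWithinAt

theorem tangentMap_mul_extension {m : G × G → G} {b : TangentBundle (IG.prod IG) (G × G)}
    (hm : MDifferentiableAt (IG.prod IG) IG m b.1)
    (hmul : ∀ᶠ z in 𝓝 b.1, z ∈ 𝒢.composable → m z = 𝒢.mul z.1 z.2)
    (hb : b.1 ∈ 𝒢.composable) (ht : IsTangentTo 𝒢.composable b) :
    tangentMap (IG.prod IG) IG m b = ⟨𝒢.mul b.1.1 b.1.2,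
      mfderivWithin (IG.prod IG) IG (fun p : G × G ↦ 𝒢.mul p.1 p.2) 𝒢.composable b.1 b.2⟩ :=
  ht.mfderiv_eq (S₁ := univ) (S₂ := 𝒢.composable) hm.hasMFDerivAt.hasMFDerivWithinAt
    (𝒢.mdifferentiableWithinAt_mul hb).hasMFDerivWithinAt (subset_univ _) subset_rfl
    (eventually_nhdsWithin_iff.2 hmul)

theorem one_injective : Injective 𝒢.one := LeftInverse.injective 𝒢.src_one

theorem mfderiv_src_mfderiv_one (m : M) (u : TangentSpace IM m) :
    (mfderiv IG IM 𝒢.src (𝒢.one m) (mfderiv IM IG 𝒢.one m u) : EM) = u := by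
  have h := DFunLike.congr_fun
    (mfderiv_comp m (𝒢.mdifferentiable_src (𝒢.one m)) (𝒢.mdifferentiable_one m)) u
  have hid : 𝒢.src ∘ 𝒢.one =ᶠ[𝓝 m] id := .of_forall 𝒢.src_one
  exact h.symm.trans (DFunLike.congr_fun (hid.mfderiv_eq.trans mfderiv_id) u)

theorem mfderiv_one_injective (m : M) : Injective (mfderiv IM IG 𝒢.one m) := fun u u' h ↦
  (𝒢.mfderiv_src_mfderiv_one m u).symm.trans
    ((congrArg (mfderiv IG IM 𝒢.src (𝒢.one m)) h).trans (𝒢.mfderiv_src_mfderiv_one m u'))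

theorem mk_rightInvariant (X : ∀ m, 𝒢.Algebroid m) (g : G) :
    (⟨g, 𝒢.rightInvariant X g⟩ : TangentBundle IG G) =
      𝒢.rightMul g (𝒢.totalIncl ⟨𝒢.tgt g, X (𝒢.tgt g)⟩) := by
  have mk_cast : ∀ {g' : G} (h : g' = g) (v : TangentSpace IG g'),
      (⟨g, h ▸ v⟩ : TangentBundle IG G) = ⟨g', v⟩ := by
    rintro _ rfl v
    rfl
  exact mk_cast (𝒢.one_mul g) _

theorem src_totalIncl (a : AG) : 𝒢.src (𝒢.totalIncl a).1 = a.1 := 𝒢.src_one a.1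

theorem mfderiv_src_totalIncl (a : AG) :
    mfderiv IG IM 𝒢.src (𝒢.totalIncl a).1 (𝒢.totalIncl a).2 = 0 := 𝒢.mfderiv_src_incl a.1 a.2

theorem totalIncl_injective : Injective 𝒢.totalIncl := by
  rintro ⟨m, a⟩ ⟨m', a'⟩ h
  obtain rfl : m = m' := 𝒢.one_injective (congrArg TotalSpace.proj h)
  have hincl : 𝒢.incl m a = 𝒢.incl m a' := by simpa [totalIncl] using h
  rw [𝒢.incl_injective m hincl]

theorem mk_anchor (a : AG) :
    (⟨a.1, 𝒢.anchor a.1 a.2⟩ : TangentBundle IM M) = tangentMap IG IM 𝒢.tgt (𝒢.totalIncl a) := by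
  have mk_cast {m m' : M} (h : m' = m) (v : TangentSpace IM m') :
      (⟨m, h ▸ v⟩ : TangentBundle IM M) = ⟨m', v⟩ := by
    subst h
    rfl
  exact mk_cast (𝒢.tgt_one a.1) _

/-- The source projection, read in the preferred chart of `M` at the source of `g`. -/
def srcChart (g : G) : G → EM := extChartAt IM (𝒢.src g) ∘ 𝒢.src

theorem contMDiffAt_srcChart (g : G) : ContMDiffAt IG 𝓘(ℝ, EM) ∞ (𝒢.srcChart g) g :=
  contMDiffAt_extChartAt.comp g 𝒢.contMDiff_src.contMDiffAt

variable [IsManifold IG ∞ G] [IsManifold IM ∞ M]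

theorem mdifferentiable_tangentMap_src :
    MDifferentiable IG.tangent IM.tangent (tangentMap IG IM 𝒢.src) :=
  (𝒢.contMDiff_src.contMDiff_tangentMap (m := ∞) (by simp)).mdifferentiable (by simp)

theorem eventuallyEq_totalDifferential_srcChart (b : TangentBundle IG G) :
    totalDifferential IG (𝒢.srcChart b.1) =ᶠ[𝓝 b]
      totalDifferential IM (extChartAt IM (𝒢.src b.1)) ∘ tangentMap IG IM 𝒢.src := by
  have hsource : ∀ᶠ g in 𝓝 b.1, 𝒢.src g ∈ (chartAt HM (𝒢.src b.1)).source :=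
    𝒢.contMDiff_src.continuous.continuousAt.eventually
      ((chartAt HM (𝒢.src b.1)).open_source.mem_nhds (mem_chart_source HM (𝒢.src b.1)))
  filter_upwards [eventually_proj hsource] with c hc
  exact totalDifferential_comp (mdifferentiableAt_extChartAt (I := IM) hc)
    (𝒢.mdifferentiable_src c.1)

theorem totalDifferential_srcChart (b : TangentBundle IG G) :
    totalDifferential IG (𝒢.srcChart b.1) b = mfderiv IG IM 𝒢.src b.1 b.2 :=
  (𝒢.eventuallyEq_totalDifferential_srcChart b).eq_of_nhds.trans
    (totalDifferential_extChartAt_self (tangentMap IG IM 𝒢.src b))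

theorem mfderiv_tangentMap_src_apply (b : TangentBundle IG G) (Z : TangentSpace IG.tangent b) :
    mfderiv IG.tangent IM.tangent (tangentMap IG IM 𝒢.src) b Z =
      ((mfderiv IG IM 𝒢.src b.1 (show EG × EG from Z).1,
        mfderiv IG.tangent 𝓘(ℝ, EM) (totalDifferential IG (𝒢.srcChart b.1)) b Z) : EM × EM) := by
  have hproj : MDifferentiableAt IM.tangent IM (π EM (TangentSpace IM))
      (tangentMap IG IM 𝒢.src b) :=
    (contMDiff_proj (TangentSpace IM : M → Type _) (n := ∞)).mdifferentiable (by simp) _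
  have hproj' : MDifferentiableAt IG.tangent IG (π EG (TangentSpace IG)) b :=
    (contMDiff_proj (TangentSpace IG : G → Type _) (n := ∞)).mdifferentiable (by simp) _
  have hchart := (contMDiffAt_totalDifferential_extChartAt (I := IM)
    (tangentMap IG IM 𝒢.src b)).mdifferentiableAt (by simp : (∞ : WithTop ℕ∞) ≠ 0)
  have hsrc := 𝒢.mdifferentiable_tangentMap_src b
  set Z' := mfderiv IG.tangent IM.tangent (tangentMap IG IM 𝒢.src) b Z
  have hfst : (show EM × EM from Z').1 = mfderiv IG IM 𝒢.src b.1 (show EG × EG from Z).1 :=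
    (mfderiv_proj_apply (tangentMap IG IM 𝒢.src b) Z').symm.trans
      ((DFunLike.congr_fun (mfderiv_comp b hproj hsrc) Z).symm.trans
        ((DFunLike.congr_fun (mfderiv_comp b (𝒢.mdifferentiable_src b.1) hproj') Z).trans
          (congrArg (mfderiv IG IM 𝒢.src b.1) (mfderiv_proj_apply b Z))))
  have hsnd : (show EM × EM from Z').2 =
      totalDifferential IG.tangent (totalDifferential IG (𝒢.srcChart b.1)) ⟨b, Z⟩ :=
    (mfderiv_totalDifferential_extChartAt (tangentMap IG IM 𝒢.src b) Z').symm.trans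
      ((totalDifferential_comp (b := (⟨b, Z⟩ : TangentBundle IG.tangent (TangentBundle IG G)))
        hchart hsrc).symm.trans
        (totalDifferential_congr (𝒢.eventuallyEq_totalDifferential_srcChart b).symm))
  exact Prod.ext hfst hsnd

section LieFunctor

variable {𝒢} {ξ : ∀ g : G, TangentSpace IG g} {x : ∀ m : M, TangentSpace IM m}

theorem lieFunctor_mem_tangentAlgebroid (hξ : 𝒢.IsMultiplicative ξ x) (a : AG) :
    𝒢.lieFunctor ξ a ∈ 𝒢.tangentAlgebroid := by
  refine ⟨⟨⟨a.1, x a.1⟩, ?_⟩, ?_⟩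
  · rw [tangentMap, hξ.one]
    rfl
  have hrelated : tangentMap IG IM 𝒢.src ∘ T% ξ = T% x ∘ 𝒢.src :=
    funext fun g ↦ congrArg (TotalSpace.mk (𝒢.src g)) (hξ.src g)
  have hξd := hξ.smooth.mdifferentiable (by simp) (𝒢.one a.1)
  have hxd := hξ.smooth_base.mdifferentiable (by simp) (𝒢.src (𝒢.one a.1))
  have hvanish : mfderiv IG IM.tangent (tangentMap IG IM 𝒢.src ∘ T% ξ) (𝒢.one a.1)
      (𝒢.incl a.1 a.2) = 0 := by
    rw [hrelated, mfderiv_comp _ hxd (𝒢.mdifferentiable_src _)]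
    exact (congrArg (mfderiv IM IM.tangent (T% x) _) (𝒢.mfderiv_src_incl a.1 a.2)).trans
      (map_zero (mfderiv IM IM.tangent (T% x) (𝒢.src (𝒢.one a.1))))
  exact (DFunLike.congr_fun (mfderiv_comp (𝒢.one a.1)
    (𝒢.mdifferentiable_tangentMap_src ⟨𝒢.one a.1, ξ (𝒢.one a.1)⟩) hξd) (𝒢.incl a.1 a.2)).symm.trans
    hvanish

end LieFunctor

variable [FiniteDimensional ℝ EG] [FiniteDimensional ℝ EM]

/-- A vector-valued function on `G` whose differential gives the fibre coordinate of the local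
trivialization of the Lie algebroid around `m₀`. -/
def fibreFun (m₀ : M) : G → AlgebroidModel EG EM :=
  𝒢.fibreCoord m₀ ∘ extChartAt IG (𝒢.one m₀)

theorem contMDiffAt_fibreFun {m₀ : M} {g : G} (hg : g ∈ (chartAt HG (𝒢.one m₀)).source) :
    ContMDiffAt IG 𝓘(ℝ, AlgebroidModel EG EM) ∞ (𝒢.fibreFun m₀) g :=
  ((𝒢.fibreCoord m₀).contMDiff (n := ∞)).contMDiffAt.comp g (contMDiffAt_extChartAt' hg)

theorem one_mem_chart_source {m₀ m : M} (hm : m ∈ 𝒢.trivDomain m₀) :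
    𝒢.one m ∈ (chartAt HG (𝒢.one m₀)).source := by
  have h : 𝒢.one m ∈ (trivializationAt EG (TangentSpace IG) (𝒢.one m₀)).baseSet := hm.1.1
  rwa [TangentBundle.trivializationAt_baseSet] at h

theorem trivializationAt_snd {m₀ : M} {a : AG} (ha : a.1 ∈ 𝒢.trivDomain m₀) :
    (trivializationAt (AlgebroidModel EG EM) 𝒢.Algebroid m₀ a).2 =
      totalDifferential IG (𝒢.fibreFun m₀) (𝒢.totalIncl a) := by
  have hone := 𝒢.one_mem_chart_source ha
  have hfibreFun : totalDifferential IG (𝒢.fibreFun m₀) (𝒢.totalIncl a) =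
      𝒢.fibreCoord m₀ (totalDifferential IG (extChartAt IG (𝒢.one m₀)) (𝒢.totalIncl a)) :=
    DFunLike.congr_fun ((𝒢.fibreCoord m₀).hasFDerivAt.hasMFDerivAt.comp (𝒢.one a.1)
      (mdifferentiableAt_extChartAt (I := IG) hone).hasMFDerivAt).mfderiv (𝒢.incl a.1 a.2)
  rw [hfibreFun]
  exact congrArg (𝒢.fibreCoord m₀) (DFunLike.congr_fun
    (TangentBundle.continuousLinearMapAt_trivializationAt (I := IG) (𝕜 := ℝ) hone)
    (𝒢.incl a.1 a.2))

theorem eventuallyEq_trivializationAt_snd (a : AG) :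
    (fun b ↦ (trivializationAt (AlgebroidModel EG EM) 𝒢.Algebroid a.1 b).2) =ᶠ[𝓝 a]
      totalDifferential IG (𝒢.fibreFun a.1) ∘ 𝒢.totalIncl := by
  filter_upwards [eventually_proj
    ((𝒢.isOpen_trivDomain a.1).mem_nhds (𝒢.mem_trivDomain a.1))] with b hb
  exact 𝒢.trivializationAt_snd hb

theorem contMDiffAt_frame_inverse {m₀ m : M} (hm : m ∈ 𝒢.trivDomain m₀) :
    ContMDiffAt IM 𝓘(ℝ, EM × AlgebroidModel EG EM →L[ℝ] EG) ∞
      (fun m ↦ (𝒢.frame m₀ m).inverse) m :=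
  (ContinuousLinearMap.IsInvertible.contDiffAt_map_inverse hm.2).contMDiffAt.comp m
    ((𝒢.contMDiffOn_frame m₀).contMDiffAt ((𝒢.isOpen_coordDomain m₀).mem_nhds hm.1))

theorem trivializationAt_totalIncl_snd {m₀ : M} {a : AG} (ha : a.1 ∈ 𝒢.trivDomain m₀) :
    (trivializationAt EG (TangentSpace IG) (𝒢.one m₀) (𝒢.totalIncl a)).2 =
      (𝒢.frame m₀ a.1).inverse
        (0, (trivializationAt (AlgebroidModel EG EM) 𝒢.Algebroid m₀ a).2) := by
  have hincl := 𝒢.incl_fromFibre ha (𝒢.toFibre m₀ a.1 a.2)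
  rw [𝒢.fromFibre_toFibre ha, fromFibreAux] at hincl
  have hcoord := congrArg ((trivializationAt EG (TangentSpace IG)
    (𝒢.one m₀)).continuousLinearMapAt ℝ (𝒢.one a.1)) hincl
  rw [Trivialization.continuousLinearMapAt_symmL _ ha.1.1,
    Trivialization.continuousLinearMapAt_apply_of_mem ℝ _ ha.1.1] at hcoord
  exact hcoord

theorem contMDiff_totalIncl : ContMDiff IA IG.tangent ∞ 𝒢.totalIncl := by
  intro a
  have hproj : ContMDiffAt IA IM ∞ (π (AlgebroidModel EG EM) 𝒢.Algebroid) a :=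
    contMDiff_proj 𝒢.Algebroid a
  have hfibre : ContMDiffAt IA 𝓘(ℝ, AlgebroidModel EG EM) ∞
      (fun b ↦ (trivializationAt (AlgebroidModel EG EM) 𝒢.Algebroid a.1 b).2) a :=
    contMDiffAt_trivialization_snd (𝒢.mem_trivDomain a.1)
  refine (contMDiffAt_totalSpace ..).2 ⟨𝒢.contMDiff_one.contMDiffAt.comp a hproj, ?_⟩
  refine (((𝒢.contMDiffAt_frame_inverse (𝒢.mem_trivDomain a.1)).comp a hproj).clm_apply
    ((contMDiffAt_const (c := (0 : EM))).prodMk_space hfibre)).congr_of_eventuallyEq ?_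
  filter_upwards [eventually_proj
    ((𝒢.isOpen_trivDomain a.1).mem_nhds (𝒢.mem_trivDomain a.1))] with b hb
  exact 𝒢.trivializationAt_totalIncl_snd hb

theorem mdifferentiable_totalIncl : MDifferentiable IA IG.tangent 𝒢.totalIncl :=
  𝒢.contMDiff_totalIncl.mdifferentiable (by simp)

theorem contMDiff_anchor :
    ContMDiff IA IM.tangent ∞ (fun a : AG ↦ (⟨a.1, 𝒢.anchor a.1 a.2⟩ : TangentBundle IM M)) := by
  rw [funext 𝒢.mk_anchor]
  exact (𝒢.contMDiff_tgt.contMDiff_tangentMap (m := ∞) (by simp)).comp 𝒢.contMDiff_totalIncl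

theorem mfderiv_totalIncl_fst {a : AG} (ζ : TangentSpace IA a) :
    (show EG × EG from mfderiv IA IG.tangent 𝒢.totalIncl a ζ).1 =
      mfderiv IM IG 𝒢.one a.1 (show EM × AlgebroidModel EG EM from ζ).1 := by
  have hprojG : MDifferentiableAt IG.tangent IG (π EG (TangentSpace IG)) (𝒢.totalIncl a) :=
    (contMDiff_proj (TangentSpace IG : G → Type _) (n := ∞)).mdifferentiable (by simp) _
  have hprojA : MDifferentiableAt IA IM (π (AlgebroidModel EG EM) 𝒢.Algebroid) a :=
    (contMDiff_proj 𝒢.Algebroid (n := ∞)).mdifferentiable (by simp) _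
  refine (mfderiv_proj_apply (𝒢.totalIncl a) (mfderiv IA IG.tangent 𝒢.totalIncl a ζ)).symm.trans
    ((DFunLike.congr_fun (mfderiv_comp a hprojG (𝒢.mdifferentiable_totalIncl a)) ζ).symm.trans
      ((DFunLike.congr_fun (mfderiv_comp a (𝒢.mdifferentiable_one a.1) hprojA) ζ).trans ?_))
  exact congrArg (mfderiv IM IG 𝒢.one a.1) (mfderiv_proj_apply a ζ)

theorem mfderiv_totalIncl_vertical (a : AG) (k : 𝒢.Algebroid a.1) :
    mfderiv IA IG.tangent 𝒢.totalIncl a ((0 : EM),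
      (trivializationAt (AlgebroidModel EG EM) 𝒢.Algebroid a.1 ⟨a.1, k⟩).2) =
      (((0 : EG), 𝒢.incl a.1 k) : EG × EG) := by
  have hline : 𝒢.totalIncl ∘ (fun t : ℝ ↦ (⟨a.1, a.2 + t • k⟩ : AG)) =
      fun t ↦ ⟨𝒢.one a.1, 𝒢.incl a.1 a.2 + t • 𝒢.incl a.1 k⟩ := by
    funext t
    simp only [comp_apply, totalIncl, map_add, map_smul]
  have himage := (hasVelocity_add_smul (I := IM) a k).comp (𝒢.mdifferentiable_totalIncl a)
  rw [hline] at himage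
  have hfibre : (trivializationAt EG (TangentSpace IG) (𝒢.one a.1)
      ⟨𝒢.one a.1, 𝒢.incl a.1 k⟩).2 = 𝒢.incl a.1 k :=
    (trivializationAt_tangent_snd (mem_chart_source HG (𝒢.one a.1))).trans
      (totalDifferential_extChartAt_self ⟨𝒢.one a.1, 𝒢.incl a.1 k⟩)
  have hvelocity := himage.unique
    (hasVelocity_add_smul (I := IG) (𝒢.totalIncl a) (𝒢.incl a.1 k)) .rfl
  exact (eq_of_heq (TotalSpace.ext_iff.1 hvelocity).2).trans (congrArg (Prod.mk (0 : EG)) hfibre)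

theorem jMap_proj (w : TangentBundle IA AG) :
    (𝒢.jMap w).1 = ⟨𝒢.one w.1.1,
      mfderiv IM IG 𝒢.one w.1.1 (show EM × AlgebroidModel EG EM from w.2).1⟩ :=
  congrArg (fun v : TangentSpace IG (𝒢.one w.1.1) ↦ (⟨𝒢.one w.1.1, v⟩ : TangentBundle IG G))
    (𝒢.mfderiv_totalIncl_fst w.2)

theorem totalDifferential_srcChart_comp_totalIncl (w : TangentBundle IA AG) :
    totalDifferential IA (totalDifferential IG (𝒢.srcChart (𝒢.one w.1.1)) ∘ 𝒢.totalIncl) w =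
      0 := by
  have hzero : totalDifferential IG (𝒢.srcChart (𝒢.one w.1.1)) ∘ 𝒢.totalIncl
      =ᶠ[𝓝 w.1] fun _ ↦ (0 : EM) := by
    filter_upwards [𝒢.mdifferentiable_totalIncl.continuous.continuousAt.eventually
      (𝒢.eventuallyEq_totalDifferential_srcChart (𝒢.totalIncl w.1))] with c hc
    exact hc.trans ((congrArg (mfderiv IM 𝓘(ℝ, EM) (extChartAt IM (𝒢.src (𝒢.one w.1.1)))
      (𝒢.src (𝒢.one c.1))) (𝒢.mfderiv_src_incl c.1 c.2)).trans (map_zero _))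
  rw [totalDifferential_congr hzero, totalDifferential, mfderiv_const]
  rfl

section Base

variable {𝒢} {ξ : ∀ g : G, TangentSpace IG g} {x : ∀ m : M, TangentSpace IM m}

theorem IsLieLift.fst_eq {ξ' : ∀ a : AG, TangentSpace IA a} (h : 𝒢.IsLieLift ξ ξ')
    (hξ : 𝒢.IsMultiplicative ξ x) (a : AG) :
    (show EM × AlgebroidModel EG EM from ξ' a).1 = x a.1 :=
  𝒢.mfderiv_one_injective a.1 ((snd_eq_of_mk_eq
    ((𝒢.jMap_proj ⟨a, ξ' a⟩).symm.trans (congrArg TotalSpace.proj (h a)))).trans (hξ.one a.1).symm)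

end Base

variable [IG.Boundaryless]

theorem contMDiffAt_of_totalIncl
    {E : Type*} [NormedAddCommGroup E] [NormedSpace ℝ E]
    {H : Type*} [TopologicalSpace H] {I : ModelWithCorners ℝ E H}
    {N : Type*} [TopologicalSpace N] [ChartedSpace H N] {f : N → AG} {n : N}
    (hf : ContMDiffAt I IG.tangent ∞ (𝒢.totalIncl ∘ f) n) : ContMDiffAt I IA ∞ f n := by
  have hbase : ContMDiffAt I IM ∞ (fun k ↦ (f k).1) n :=
    ((𝒢.contMDiff_src.contMDiffAt.comp _ (contMDiff_proj (TangentSpace IG : G → Type _) _)).comp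
      n hf).congr_of_eventuallyEq (.of_forall fun k ↦ (𝒢.src_totalIncl (f k)).symm)
  have hfibre := (contMDiffAt_totalDifferential (b := 𝒢.totalIncl (f n))
    (𝒢.contMDiffAt_fibreFun (m₀ := (f n).1) (mem_chart_source HG _))).comp n hf
  refine (contMDiffAt_totalSpace ..).2 ⟨hbase, hfibre.congr_of_eventuallyEq ?_⟩
  filter_upwards [hbase.continuousAt.eventually
    ((𝒢.isOpen_trivDomain (f n).1).mem_nhds (𝒢.mem_trivDomain (f n).1))] with k hk
  exact 𝒢.trivializationAt_snd hk

theorem totalDifferential_comp_totalIncl {ψ : G → F} (w : TangentBundle IA AG)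
    (hψ : ContMDiffAt IG 𝓘(ℝ, F) ∞ ψ (𝒢.one w.1.1)) :
    totalDifferential IA (totalDifferential IG ψ ∘ 𝒢.totalIncl) w =
      totalDifferential IG.tangent (totalDifferential IG ψ) (𝒢.jMap w) :=
  (totalDifferential_comp ((contMDiffAt_totalDifferential
    (b := 𝒢.totalIncl w.1) hψ).mdifferentiableAt (by simp)) (𝒢.mdifferentiable_totalIncl w.1)).trans
    (mfderiv_totalDifferential_canonicalInvolution (tangentMap IA IG.tangent 𝒢.totalIncl w)
      (hψ.of_le (by norm_cast))).symm

theorem snd_eq_totalDifferential_jMap (w : TangentBundle IA AG) :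
    (show EM × AlgebroidModel EG EM from w.2).2 =
      totalDifferential IG.tangent (totalDifferential IG (𝒢.fibreFun w.1.1)) (𝒢.jMap w) := by
  rw [← 𝒢.totalDifferential_comp_totalIncl w (𝒢.contMDiffAt_fibreFun (mem_chart_source HG _)),
    ← totalDifferential_congr (𝒢.eventuallyEq_trivializationAt_snd w.1)]
  exact (mfderiv_trivializationAt_snd_apply (I := IM) w.1 w.2).symm

theorem jMap_injective : Injective 𝒢.jMap := by
  rintro ⟨a, ζ⟩ ⟨a', ζ'⟩ h
  have hbase : 𝒢.totalIncl a = 𝒢.totalIncl a' :=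
    congrArg (fun Z ↦ (canonicalInvolution IG Z).1) h
  obtain rfl : a = a' := 𝒢.totalIncl_injective hbase
  have hproj := (𝒢.jMap_proj ⟨a, ζ⟩).symm.trans
    ((congrArg TotalSpace.proj h).trans (𝒢.jMap_proj ⟨a, ζ'⟩))
  have hfst : (show EM × AlgebroidModel EG EM from ζ).1 =
      (show EM × AlgebroidModel EG EM from ζ').1 :=
    𝒢.mfderiv_one_injective a.1 (eq_of_heq (TotalSpace.ext_iff.1 hproj).2)
  have hsnd : (show EM × AlgebroidModel EG EM from ζ).2 =
      (show EM × AlgebroidModel EG EM from ζ').2 :=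
    (𝒢.snd_eq_totalDifferential_jMap ⟨a, ζ⟩).trans
      ((congrArg (totalDifferential IG.tangent (totalDifferential IG (𝒢.fibreFun a.1))) h).trans
        (𝒢.snd_eq_totalDifferential_jMap ⟨a, ζ'⟩).symm)
  exact congrArg (TotalSpace.mk a) (Prod.ext hfst hsnd)

theorem mfderiv_totalDifferential_srcChart_totalIncl {a : AG} (ζ : TangentSpace IA a) :
    mfderiv IG.tangent 𝓘(ℝ, EM) (totalDifferential IG (𝒢.srcChart (𝒢.one a.1))) (𝒢.totalIncl a)
      (mfderiv IA IG.tangent 𝒢.totalIncl a ζ) = 0 :=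
  (totalDifferential_comp (b := (⟨a, ζ⟩ : TangentBundle IA AG))
    ((contMDiffAt_totalDifferential (b := 𝒢.totalIncl a)
      (𝒢.contMDiffAt_srcChart (𝒢.one a.1))).mdifferentiableAt (by simp))
    (𝒢.mdifferentiable_totalIncl a)).symm.trans
    (𝒢.totalDifferential_srcChart_comp_totalIncl ⟨a, ζ⟩)

theorem exists_mfderiv_totalIncl_eq {a : AG} {u : TangentSpace IM a.1} {v : EG}
    (hv : mfderiv IG.tangent 𝓘(ℝ, EM) (totalDifferential IG (𝒢.srcChart (𝒢.one a.1)))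
      (𝒢.totalIncl a) ((mfderiv IM IG 𝒢.one a.1 u : EG), v) = 0) :
    ∃ ζ : TangentSpace IA a, mfderiv IA IG.tangent 𝒢.totalIncl a ζ =
      ((mfderiv IM IG 𝒢.one a.1 u : EG), v) := by
  let ζ₀ : TangentSpace IA a := ((u : EM), (0 : AlgebroidModel EG EM))
  let Y₀ : EG × EG := mfderiv IA IG.tangent 𝒢.totalIncl a ζ₀
  have hfst : Y₀.1 = mfderiv IM IG 𝒢.one a.1 u := 𝒢.mfderiv_totalIncl_fst ζ₀
  let Y : EG × EG := (mfderiv IM IG 𝒢.one a.1 u, v)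
  have hsub : Y - Y₀ = ((0 : EG), v - Y₀.2) := Prod.ext (sub_eq_zero.2 hfst.symm) rfl
  have hvertical : mfderiv IG.tangent 𝓘(ℝ, EM)
      (totalDifferential IG (𝒢.srcChart (𝒢.one a.1))) (𝒢.totalIncl a) ((0 : EG), v - Y₀.2) = 0 :=
    hsub ▸ (map_sub (mfderiv IG.tangent 𝓘(ℝ, EM) (totalDifferential IG (𝒢.srcChart (𝒢.one a.1)))
      (𝒢.totalIncl a)) _ _).trans
        (sub_eq_zero.2 (hv.trans (𝒢.mfderiv_totalDifferential_srcChart_totalIncl ζ₀).symm))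
  have hker : mfderiv IG IM 𝒢.src (𝒢.one a.1) (v - Y₀.2) = 0 :=
    (𝒢.totalDifferential_srcChart ⟨𝒢.one a.1, v - Y₀.2⟩).symm.trans
      ((mfderiv_totalDifferential_vertical (b := 𝒢.totalIncl a)
        ((𝒢.contMDiffAt_srcChart (𝒢.one a.1)).of_le (by norm_cast))
        (v - Y₀.2)).symm.trans hvertical)
  let k : 𝒢.Algebroid a.1 := 𝒢.mkAlgebroid a.1 (v - Y₀.2) hker
  let ζ₁ : TangentSpace IA a :=
    ((0 : EM), (trivializationAt (AlgebroidModel EG EM) 𝒢.Algebroid a.1 ⟨a.1, k⟩).2)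
  have hsum : mfderiv IA IG.tangent 𝒢.totalIncl a (ζ₀ + ζ₁) = Y₀ + ((0 : EG), v - Y₀.2) :=
    (map_add (mfderiv IA IG.tangent 𝒢.totalIncl a) ζ₀ ζ₁).trans
      (congrArg (Y₀ + ·) (𝒢.mfderiv_totalIncl_vertical a k))
  exact ⟨ζ₀ + ζ₁, hsum.trans (hsub ▸ add_sub_cancel _ _)⟩

theorem tangentAlgebroid_subset_range_jMap : 𝒢.tangentAlgebroid ⊆ range 𝒢.jMap := by
  rintro ⟨b, Z⟩ ⟨⟨u, hu⟩, hZ⟩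
  obtain rfl : b = tangentMap IM IG 𝒢.one u := hu
  have hsplit := (𝒢.mfderiv_tangentMap_src_apply _ Z).symm.trans hZ
  have hker : mfderiv IG IM 𝒢.src (𝒢.one u.1) (show EG × EG from Z).1 = 0 :=
    congrArg Prod.fst hsplit
  let a : AG := ⟨u.1, 𝒢.mkAlgebroid u.1 (show EG × EG from Z).1 hker⟩
  have hY := (mfderiv_totalDifferential_canonicalInvolution
    (⟨tangentMap IM IG 𝒢.one u, Z⟩ : TangentBundle IG.tangent (TangentBundle IG G))
    ((𝒢.contMDiffAt_srcChart (𝒢.one u.1)).of_le (by norm_cast))).trans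
    (congrArg Prod.snd hsplit)
  obtain ⟨ζ, hζ⟩ := 𝒢.exists_mfderiv_totalIncl_eq (a := a) (u := u.2) hY
  exact ⟨⟨a, ζ⟩, congrArg (fun y : TangentSpace IG.tangent (𝒢.totalIncl a) ↦
    canonicalInvolution IG ⟨𝒢.totalIncl a, y⟩) hζ⟩

theorem jMap_mem_tangentAlgebroid (w : TangentBundle IA AG) : 𝒢.jMap w ∈ 𝒢.tangentAlgebroid := by
  refine ⟨⟨⟨w.1.1, (show EM × AlgebroidModel EG EM from w.2).1⟩, 𝒢.jMap_proj w⟩, ?_⟩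
  have hfst : mfderiv IG IM 𝒢.src (𝒢.jMap w).1.1 (show EG × EG from (𝒢.jMap w).2).1 = 0 :=
    𝒢.mfderiv_src_incl w.1.1 w.1.2
  have hsnd : mfderiv IG.tangent 𝓘(ℝ, EM) (totalDifferential IG (𝒢.srcChart (𝒢.jMap w).1.1))
      (𝒢.jMap w).1 (𝒢.jMap w).2 = 0 :=
    (𝒢.totalDifferential_comp_totalIncl w (𝒢.contMDiffAt_srcChart (𝒢.one w.1.1))).symm.trans
      (𝒢.totalDifferential_srcChart_comp_totalIncl w)
  exact (𝒢.mfderiv_tangentMap_src_apply (𝒢.jMap w).1 (𝒢.jMap w).2).trans (Prod.ext hfst hsnd)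

theorem bijOn_jMap : BijOn 𝒢.jMap univ 𝒢.tangentAlgebroid :=
  ⟨fun w _ ↦ 𝒢.jMap_mem_tangentAlgebroid w, 𝒢.jMap_injective.injOn,
    𝒢.tangentAlgebroid_subset_range_jMap.trans image_univ.superset⟩

section Lift

variable {𝒢} {ξ : ∀ g : G, TangentSpace IG g} {x : ∀ m : M, TangentSpace IM m}

theorem exists_isLieLift (hξ : 𝒢.IsMultiplicative ξ x) :
    ∃ ξ' : ∀ a : AG, TangentSpace IA a, 𝒢.IsLieLift ξ ξ' := by
  have hexists (a : AG) : ∃ ζ : TangentSpace IA a, 𝒢.jMap ⟨a, ζ⟩ = 𝒢.lieFunctor ξ a := by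
    obtain ⟨⟨a', ζ⟩, hζ⟩ := 𝒢.tangentAlgebroid_subset_range_jMap
      (lieFunctor_mem_tangentAlgebroid hξ a)
    have hbase : 𝒢.totalIncl a' = 𝒢.totalIncl a :=
      (congrArg (fun Z ↦ (canonicalInvolution IG Z).1) hζ).trans
        (canonicalInvolution_tangentMap_proj (b := 𝒢.totalIncl a)
          (hξ.smooth.mdifferentiable (by simp) (𝒢.one a.1)))
    obtain rfl := 𝒢.totalIncl_injective hbase
    exact ⟨ζ, hζ⟩
  exact ⟨fun a ↦ (hexists a).choose, fun a ↦ (hexists a).choose_spec⟩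

theorem IsLieLift.totalDifferential_eq {ξ' : ∀ a : AG, TangentSpace IA a}
    (h : 𝒢.IsLieLift ξ ξ') (hξ : IsSmoothVectorField IG ξ) {a : AG} {ψ : G → F}
    (hψ : ContMDiffAt IG 𝓘(ℝ, F) ∞ ψ (𝒢.one a.1)) :
    totalDifferential IA (totalDifferential IG ψ ∘ 𝒢.totalIncl) ⟨a, ξ' a⟩ =
      totalDifferential IG (vectorDerivAlong IG ξ ψ) (𝒢.totalIncl a) := by
  rw [𝒢.totalDifferential_comp_totalIncl ⟨a, ξ' a⟩ hψ, h a]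
  exact (totalDifferential_comp (b := 𝒢.totalIncl a) ((contMDiffAt_totalDifferential
    (b := ⟨𝒢.one a.1, ξ (𝒢.one a.1)⟩) hψ).mdifferentiableAt (by simp))
    (hξ.mdifferentiable (by simp) (𝒢.one a.1))).symm

theorem IsLieLift.snd_eq {ξ' : ∀ a : AG, TangentSpace IA a} (h : 𝒢.IsLieLift ξ ξ')
    (hξ : IsSmoothVectorField IG ξ) (a : AG) :
    (show EM × AlgebroidModel EG EM from ξ' a).2 =
      totalDifferential IG (vectorDerivAlong IG ξ (𝒢.fibreFun a.1)) (𝒢.totalIncl a) := by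
  have hfibre := 𝒢.contMDiffAt_fibreFun (m₀ := a.1) (mem_chart_source HG _)
  rw [← h.totalDifferential_eq hξ hfibre, 𝒢.totalDifferential_comp_totalIncl ⟨a, ξ' a⟩ hfibre]
  exact 𝒢.snd_eq_totalDifferential_jMap ⟨a, ξ' a⟩

end Lift

section Translations

variable [IM.Boundaryless]

theorem isTangentTo_srcFibre {b : TangentBundle IG G} (hb : mfderiv IG IM 𝒢.src b.1 b.2 = 0)
    {m : M} (hm : 𝒢.src b.1 = m) : IsTangentTo {h | 𝒢.src h = m} b :=
  hm ▸ isTangentTo_fibre 𝒢.contMDiff_src.contMDiffAt (𝒢.src_submersion b.1) hb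

theorem isTangentTo_composable {b b' : TangentBundle IG G}
    (h : tangentMap IG IM 𝒢.src b = tangentMap IG IM 𝒢.tgt b') :
    IsTangentTo 𝒢.composable ((equivTangentBundleProd IG G IG G).symm (b, b')) := by
  obtain ⟨c', hc'⟩ := exists_hasVelocity b'
  obtain ⟨c, hc, hsrc⟩ := HasVelocity.exists_lift
    (h ▸ hc'.comp (𝒢.mdifferentiable_tgt b'.1)) 𝒢.contMDiff_src.contMDiffAt (𝒢.src_submersion b.1)
  exact ⟨_, hc.prodMk hc', hsrc⟩

/- The product is only smooth on the closed subset of composable pairs. Correcting the first factor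
by a local section of the source makes nearby pairs composable. -/
theorem exists_mul_extension {h g : G} (hg : 𝒢.src h = 𝒢.tgt g) :
    ∃ m : G × G → G, ContMDiffAt (IG.prod IG) IG ∞ m (h, g) ∧
      ∀ᶠ z in 𝓝 (h, g), z ∈ 𝒢.composable → m z = 𝒢.mul z.1 z.2 := by
  obtain ⟨σ, hσ, hright, hleft⟩ := exists_local_sections
    (𝒢.contMDiff_src.contMDiffAt (x := h)) (𝒢.src_submersion h)
  have hσ₀ : σ (h, 𝒢.tgt g) = h := hg ▸ hleft.self_of_nhds
  rw [hg] at hσ hright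
  have htgt : ContMDiffAt (IG.prod IG) (IG.prod IM) ∞ (fun z : G × G ↦ (z.1, 𝒢.tgt z.2)) (h, g) :=
    contMDiffAt_fst.prodMk (𝒢.contMDiff_tgt.contMDiffAt.comp (h, g) contMDiffAt_snd)
  let correct : G × G → G × G := fun z ↦ (σ (z.1, 𝒢.tgt z.2), z.2)
  have hcorrect : ContMDiffAt (IG.prod IG) (IG.prod IG) ∞ correct (h, g) :=
    (ContMDiffAt.comp (h, g) hσ htgt).prodMk contMDiffAt_snd
  have hcomposable : ∀ᶠ z in 𝓝 (h, g), correct z ∈ 𝒢.composable :=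
    htgt.continuousAt.eventually hright
  refine ⟨fun z ↦ 𝒢.mul (correct z).1 (correct z).2, ?_, ?_⟩
  · exact ((𝒢.contMDiffOn_mul (h, g) hg).comp_of_eq (s := {z | correct z ∈ 𝒢.composable})
      hcorrect.contMDiffWithinAt (fun _ hz ↦ hz) (Prod.ext hσ₀ rfl)).contMDiffAt hcomposable
  · filter_upwards [(continuousAt_fst (p := ((h, g) : G × G))).eventually hleft] with z hz hzg
    exact congrArg (𝒢.mul · z.2) ((congrArg (fun m ↦ σ (z.1, m)) hzg.symm).trans hz)

theorem rightMul_eq_tangentMap {m : G × G → G} {b : TangentBundle IG G} {g : G}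
    (hm : MDifferentiableAt (IG.prod IG) IG m (b.1, g))
    (hmul : ∀ᶠ z in 𝓝 (b.1, g), z ∈ 𝒢.composable → m z = 𝒢.mul z.1 z.2)
    (hg : 𝒢.src b.1 = 𝒢.tgt g) (hb : mfderiv IG IM 𝒢.src b.1 b.2 = 0) :
    𝒢.rightMul g b = tangentMap (IG.prod IG) IG m
      ((equivTangentBundleProd IG G IG G).symm (b, ⟨g, 0⟩)) := by
  obtain ⟨c, hc, hsrc⟩ := 𝒢.isTangentTo_srcFibre hb hg
  refine (𝒢.hasVelocity_rightMul hc hg hsrc).unique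
    ((hc.prodMk (hasVelocity_const g)).comp (f := m) hm) ?_
  filter_upwards [hsrc, (hc.tendsto.prodMk_nhds tendsto_const_nhds).eventually hmul] with t ht hmt
  exact (hmt ht).symm

theorem rightMul_rightMul {b : TangentBundle IG G} {h g : G} (hh : 𝒢.src b.1 = 𝒢.tgt h)
    (hb : mfderiv IG IM 𝒢.src b.1 b.2 = 0) (hg : 𝒢.src h = 𝒢.tgt g) :
    𝒢.rightMul g (𝒢.rightMul h b) = 𝒢.rightMul (𝒢.mul h g) b := by
  obtain ⟨c, hc, hsrc⟩ := 𝒢.isTangentTo_srcFibre hb hh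
  have htgt := 𝒢.tgt_mul h g hg
  have hiterated := 𝒢.hasVelocity_rightMul (𝒢.hasVelocity_rightMul hc hh hsrc)
    ((𝒢.src_mul _ _ hh).trans hg) (hsrc.mono fun t ht ↦ (𝒢.src_mul _ _ ht).trans hg)
  have hproduct := 𝒢.hasVelocity_rightMul hc (hh.trans htgt.symm)
    (hsrc.mono fun t ht ↦ ht.trans htgt.symm)
  exact hiterated.unique hproduct (hsrc.mono fun t ht ↦ 𝒢.mul_assoc _ _ _ ht hg)

theorem tangentMap_src_rightMul {b : TangentBundle IG G} {g : G} (hg : 𝒢.src b.1 = 𝒢.tgt g)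
    (hb : mfderiv IG IM 𝒢.src b.1 b.2 = 0) :
    tangentMap IG IM 𝒢.src (𝒢.rightMul g b) = ⟨𝒢.src g, 0⟩ := by
  obtain ⟨c, hc, hsrc⟩ := 𝒢.isTangentTo_srcFibre hb hg
  exact ((𝒢.hasVelocity_rightMul hc hg hsrc).comp (𝒢.mdifferentiable_src _)).unique
    (hasVelocity_const _) (hsrc.mono fun t ht ↦ 𝒢.src_mul _ _ ht)

theorem tangentMap_tgt_rightMul {b : TangentBundle IG G} {g : G} (hg : 𝒢.src b.1 = 𝒢.tgt g)
    (hb : mfderiv IG IM 𝒢.src b.1 b.2 = 0) :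
    tangentMap IG IM 𝒢.tgt (𝒢.rightMul g b) = tangentMap IG IM 𝒢.tgt b := by
  obtain ⟨c, hc, hsrc⟩ := 𝒢.isTangentTo_srcFibre hb hg
  exact ((𝒢.hasVelocity_rightMul hc hg hsrc).comp (𝒢.mdifferentiable_tgt _)).unique
    (hc.comp (𝒢.mdifferentiable_tgt _)) (hsrc.mono fun t ht ↦ 𝒢.tgt_mul _ _ ht)

theorem rightMul_one {b : TangentBundle IG G} {m : M} (hm : 𝒢.src b.1 = m)
    (hb : mfderiv IG IM 𝒢.src b.1 b.2 = 0) : 𝒢.rightMul (𝒢.one m) b = b := by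
  obtain ⟨c, hc, hsrc⟩ := 𝒢.isTangentTo_srcFibre hb hm
  have htgt := 𝒢.tgt_one m
  exact (𝒢.hasVelocity_rightMul hc (hm.trans htgt.symm)
    (hsrc.mono fun t ht ↦ ht.trans htgt.symm)).unique hc
      (hsrc.mono fun t ht ↦ ht ▸ 𝒢.mul_one (c t))

theorem mfderiv_src_rightInvariant (X : ∀ m, 𝒢.Algebroid m) (g : G) :
    mfderiv IG IM 𝒢.src g (𝒢.rightInvariant X g) = 0 := by
  have h := 𝒢.tangentMap_src_rightMul (g := g) (𝒢.src_totalIncl _)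
    (𝒢.mfderiv_src_totalIncl ⟨𝒢.tgt g, X (𝒢.tgt g)⟩)
  rw [← 𝒢.mk_rightInvariant] at h
  exact snd_eq_of_mk_eq (W := fun _ ↦ 0) h

theorem rightInvariant_one (X : ∀ m, 𝒢.Algebroid m) (m : M) :
    𝒢.rightInvariant X (𝒢.one m) = 𝒢.incl m (X m) := by
  have h := 𝒢.mk_rightInvariant X (𝒢.one m)
  rw [𝒢.tgt_one, 𝒢.rightMul_one (𝒢.src_totalIncl ⟨m, X m⟩) (𝒢.mfderiv_src_totalIncl _)] at h
  simpa [totalIncl] using h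

theorem rightMul_rightInvariant (X : ∀ m, 𝒢.Algebroid m) {h g : G} (hg : 𝒢.src h = 𝒢.tgt g) :
    𝒢.rightMul g ⟨h, 𝒢.rightInvariant X h⟩ =
      ⟨𝒢.mul h g, 𝒢.rightInvariant X (𝒢.mul h g)⟩ := by
  rw [𝒢.mk_rightInvariant, 𝒢.mk_rightInvariant,
    𝒢.rightMul_rightMul (𝒢.src_totalIncl _) (𝒢.mfderiv_src_totalIncl _) hg, 𝒢.tgt_mul _ _ hg]

theorem contMDiff_rightInvariant (X : ΓAG) :
    ContMDiff IG IG.tangent ∞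
      (fun g ↦ (⟨g, 𝒢.rightInvariant X g⟩ : TangentBundle IG G)) := by
  intro g
  obtain ⟨m, hm, hmul⟩ := 𝒢.exists_mul_extension (h := 𝒢.one (𝒢.tgt g)) (g := g) (𝒢.src_one _)
  let X' : G → TangentBundle IG G := fun k ↦ 𝒢.totalIncl ⟨𝒢.tgt k, X (𝒢.tgt k)⟩
  have hX' : ContMDiff IG IG.tangent ∞ X' :=
    𝒢.contMDiff_totalIncl.comp (X.contMDiff.comp 𝒢.contMDiff_tgt)
  have hpair : ContMDiff IG (IG.prod IG).tangent ∞
      (fun k ↦ (equivTangentBundleProd IG G IG G).symm (X' k, ⟨k, 0⟩)) :=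
    contMDiff_equivTangentBundleProd_symm.comp
      (hX'.prodMk (contMDiff_zeroSection ℝ (TangentSpace IG : G → Type _)))
  have htangent : ContMDiffAt IG IG.tangent ∞ (fun k ↦ tangentMap (IG.prod IG) IG m
      ((equivTangentBundleProd IG G IG G).symm (X' k, ⟨k, 0⟩))) g :=
    ContMDiffAt.comp g (contMDiffAt_tangentMap
      (b := (equivTangentBundleProd IG G IG G).symm (X' g, ⟨g, 0⟩)) hm) hpair.contMDiffAt
  have hunit : ContinuousAt (fun k ↦ (𝒢.one (𝒢.tgt k), k)) g :=
    ((𝒢.contMDiff_one.continuous.comp 𝒢.contMDiff_tgt.continuous).prodMk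
      continuous_id).continuousAt
  refine htangent.congr_of_eventuallyEq ?_
  filter_upwards [hunit.eventually (eventually_mdifferentiableAt (p := (𝒢.one (𝒢.tgt g), g))
      (hm.of_le (by norm_cast))),
    hunit.eventually hmul.eventually_nhds] with k hmk hmulk
  rw [𝒢.mk_rightInvariant]
  exact 𝒢.rightMul_eq_tangentMap hmk hmulk (𝒢.src_totalIncl _) (𝒢.mfderiv_src_totalIncl _)

end Translations

section BracketOperator

variable [IM.Boundaryless]

variable {𝒢} {ξ : ∀ g : G, TangentSpace IG g} {x : ∀ m : M, TangentSpace IM m}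

theorem isTangentTo_composable_rightInvariant (X : ∀ m, 𝒢.Algebroid m) {z : G × G}
    (hz : z ∈ 𝒢.composable) :
    IsTangentTo 𝒢.composable (⟨z, (𝒢.rightInvariant X z.1, (0 : TangentSpace IG z.2))⟩ :
      TangentBundle (IG.prod IG) (G × G)) := by
  refine 𝒢.isTangentTo_composable (b := ⟨z.1, 𝒢.rightInvariant X z.1⟩) (b' := ⟨z.2, 0⟩) ?_
  have hcomposable : 𝒢.src z.1 = 𝒢.tgt z.2 := hz
  rw [tangentMap, tangentMap, 𝒢.mfderiv_src_rightInvariant, map_zero, hcomposable]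

namespace IsMultiplicative

theorem isTangentTo_composable (hξ : 𝒢.IsMultiplicative ξ x) {z : G × G}
    (hz : z ∈ 𝒢.composable) :
    IsTangentTo 𝒢.composable (⟨z, (ξ z.1, ξ z.2)⟩ : TangentBundle (IG.prod IG) (G × G)) := by
  refine 𝒢.isTangentTo_composable (b := ⟨z.1, ξ z.1⟩) (b' := ⟨z.2, ξ z.2⟩) ?_
  have hcomposable : 𝒢.src z.1 = 𝒢.tgt z.2 := hz
  rw [tangentMap, tangentMap, hξ.src, hξ.tgt, hcomposable]

theorem mfderiv_src_mlieBracket (hξ : 𝒢.IsMultiplicative ξ x) (X : ΓAG) (g : G) :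
    mfderiv IG IM 𝒢.src g (mlieBracket IG ξ (𝒢.rightInvariant X) g) = 0 :=
  (mfderiv_mlieBracket_of_forall_related 𝒢.contMDiff_src hξ.smooth
    (𝒢.contMDiff_rightInvariant X) hξ.smooth_base isSmoothVectorField_zero hξ.src
    (𝒢.mfderiv_src_rightInvariant X) g).trans (congrFun mlieBracket_zero_right _)

/- A smooth extension `m` of the product relates `ξ × ξ` to `ξ` and `X⃗ × 0` to `X⃗` on composable
pairs, hence also the brackets. -/
theorem mfderiv_mul_extension_mlieBracket (hξ : 𝒢.IsMultiplicative ξ x) (X : ΓAG)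
    {m : G × G → G} {p : G × G} (hp : p ∈ 𝒢.composable)
    (hm : ContMDiffAt (IG.prod IG) IG ∞ m p)
    (hmul : ∀ᶠ z in 𝓝 p, z ∈ 𝒢.composable → m z = 𝒢.mul z.1 z.2) :
    mfderiv (IG.prod IG) IG m p (mlieBracket (IG.prod IG)
      (fun z : G × G ↦ ((ξ z.1, ξ z.2) : TangentSpace (IG.prod IG) z))
      (fun z : G × G ↦ ((𝒢.rightInvariant X z.1, 0) : TangentSpace (IG.prod IG) z)) p) =
    mlieBracket IG ξ (𝒢.rightInvariant X) (m p) := by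
  have hX : IsSmoothVectorField IG (𝒢.rightInvariant X) := 𝒢.contMDiff_rightInvariant X
  have hnear : ∀ᶠ z in 𝓝[𝒢.composable] p, z ∈ 𝒢.composable ∧
      MDifferentiableAt (IG.prod IG) IG m z ∧
        ∀ᶠ z' in 𝓝 z, z' ∈ 𝒢.composable → m z' = 𝒢.mul z'.1 z'.2 := by
    filter_upwards [self_mem_nhdsWithin, nhdsWithin_le_nhds
      (eventually_mdifferentiableAt (hm.of_le (by norm_cast))),
      nhdsWithin_le_nhds hmul.eventually_nhds] with z hz hmz hmulz using ⟨hz, hmz, hmulz⟩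
  refine mfderiv_mlieBracket_of_related (S := 𝒢.composable) hm
    (hξ.smooth.prod hξ.smooth).contMDiffAt (hX.prod isSmoothVectorField_zero).contMDiffAt
    hξ.smooth.contMDiffAt hX.contMDiffAt hp (hξ.isTangentTo_composable hp)
    (isTangentTo_composable_rightInvariant X hp) ?_ ?_
  · filter_upwards [hnear] with z ⟨hz, hmz, hmulz⟩
    exact snd_eq_of_mk_eq ((𝒢.tangentMap_mul_extension (b := ⟨z, (ξ z.1, ξ z.2)⟩) hmz hmulz hz
      (hξ.isTangentTo_composable hz)).trans
        (congrArg (TotalSpace.mk (𝒢.mul z.1 z.2)) (hξ.mul z.1 z.2 hz)))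
  · filter_upwards [hnear] with z ⟨hz, hmz, hmulz⟩
    exact snd_eq_of_mk_eq ((𝒢.rightMul_eq_tangentMap (b := ⟨z.1, 𝒢.rightInvariant X z.1⟩)
      hmz hmulz hz (𝒢.mfderiv_src_rightInvariant X z.1)).symm.trans
        (𝒢.rightMul_rightInvariant X hz))

theorem rightMul_mlieBracket (hξ : 𝒢.IsMultiplicative ξ x) (X : ΓAG) (g : G) :
    𝒢.rightMul g ⟨𝒢.one (𝒢.tgt g), mlieBracket IG ξ (𝒢.rightInvariant X) (𝒢.one (𝒢.tgt g))⟩ =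
      ⟨g, mlieBracket IG ξ (𝒢.rightInvariant X) g⟩ := by
  have hg : 𝒢.src (𝒢.one (𝒢.tgt g)) = 𝒢.tgt g := 𝒢.src_one _
  obtain ⟨m, hm, hmul⟩ := 𝒢.exists_mul_extension hg
  have hmg : m (𝒢.one (𝒢.tgt g), g) = g := (hmul.self_of_nhds hg).trans (𝒢.one_mul g)
  have hfibre : (⟨m (𝒢.one (𝒢.tgt g), g), mlieBracket IG ξ (𝒢.rightInvariant X)
      (m (𝒢.one (𝒢.tgt g), g))⟩ : TangentBundle IG G) =
        ⟨g, mlieBracket IG ξ (𝒢.rightInvariant X) g⟩ :=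
    congrArg (fun k ↦ (⟨k, mlieBracket IG ξ (𝒢.rightInvariant X) k⟩ : TangentBundle IG G)) hmg
  have hbracket : mlieBracket (IG.prod IG)
      (fun z : G × G ↦ ((ξ z.1, ξ z.2) : TangentSpace (IG.prod IG) z))
      (fun z : G × G ↦ ((𝒢.rightInvariant X z.1, 0) : TangentSpace (IG.prod IG) z))
      (𝒢.one (𝒢.tgt g), g) =
        ((mlieBracket IG ξ (𝒢.rightInvariant X) (𝒢.one (𝒢.tgt g)), 0) : EG × EG) :=
    (mlieBracket_prod hξ.smooth (𝒢.contMDiff_rightInvariant X) hξ.smooth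
      (isSmoothVectorField_zero (I := IG) (M := G)) (𝒢.one (𝒢.tgt g), g)).trans
        (Prod.ext (x := (_ : EG × EG)) (y := (_ : EG × EG)) rfl
          (congrFun (mlieBracket_zero_right (I := IG) (W := ξ)) g))
  exact (𝒢.rightMul_eq_tangentMap (hm.mdifferentiableAt (by simp)) hmul hg
    (hξ.mfderiv_src_mlieBracket X _)).trans
    ((congrArg (fun Z ↦ tangentMap (IG.prod IG) IG m ⟨(𝒢.one (𝒢.tgt g), g), Z⟩)
      hbracket.symm).trans ((congrArg (TotalSpace.mk _)
        (hξ.mfderiv_mul_extension_mlieBracket X hg hm hmul)).trans hfibre))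

/-- The operator `D_ξ`: the value of `D_ξ X` at `m` is that of the bracket of `ξ` with the
right-invariant vector field of `X` at `1_m`. -/
def bracketOperator (hξ : 𝒢.IsMultiplicative ξ x) (X : ΓAG) : ΓAG where
  toFun m := 𝒢.mkAlgebroid m (mlieBracket IG ξ (𝒢.rightInvariant X) (𝒢.one m))
    (hξ.mfderiv_src_mlieBracket X (𝒢.one m))
  contMDiff_toFun m := by
    refine 𝒢.contMDiffAt_of_totalIncl ?_
    exact (hξ.smooth.mlieBracket (𝒢.contMDiff_rightInvariant X)).contMDiffAt.comp m
      𝒢.contMDiff_one.contMDiffAt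

theorem incl_bracketOperator (hξ : 𝒢.IsMultiplicative ξ x) (X : ΓAG) (m : M) :
    𝒢.incl m (hξ.bracketOperator X m) = mlieBracket IG ξ (𝒢.rightInvariant X) (𝒢.one m) := rfl

end IsMultiplicative

theorem IsBracketOperator.incl_eq {D : ΓAG → ΓAG} (hD : 𝒢.IsBracketOperator ξ D) (X : ΓAG)
    (m : M) : 𝒢.incl m (D X m) = mlieBracket IG ξ (𝒢.rightInvariant X) (𝒢.one m) :=
  (𝒢.rightInvariant_one (D X) m).symm.trans (hD X (𝒢.one m))

theorem IsMultiplicative.isBracketOperator_iff (hξ : 𝒢.IsMultiplicative ξ x) (D : ΓAG → ΓAG) :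
    𝒢.IsBracketOperator ξ D ↔ D = hξ.bracketOperator := by
  constructor
  · intro hD
    ext X m
    exact 𝒢.incl_injective m ((hD.incl_eq X m).trans (hξ.incl_bracketOperator X m).symm)
  · rintro rfl X g
    exact snd_eq_of_mk_eq
      ((𝒢.mk_rightInvariant (hξ.bracketOperator X) g).trans (hξ.rightMul_mlieBracket X g))

end BracketOperator

section LiftedOperator

variable {𝒢} {ξ : ∀ g : G, TangentSpace IG g} {x : ∀ m : M, TangentSpace IM m}

variable (𝒢 ξ) in
/-- The fibre component over `m` of the lift of `ξ` to the Lie algebroid: the derivative along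
`𝒢.Algebroid m` of the coordinate representation of `ξ` at `1_m`. -/
def liftComponent (m : M) : 𝒢.Algebroid m →ₗ[ℝ] AlgebroidModel EG EM :=
  (mfderiv IG 𝓘(ℝ, AlgebroidModel EG EM) (vectorDerivAlong IG ξ (𝒢.fibreFun m)) (𝒢.one m) ∘L
    𝒢.incl m).toLinearMap

theorem contMDiffAt_vectorDerivAlong_fibreFun (hξ : IsSmoothVectorField IG ξ) (m : M) :
    ContMDiffAt IG 𝓘(ℝ, AlgebroidModel EG EM) ∞ (vectorDerivAlong IG ξ (𝒢.fibreFun m))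
      (𝒢.one m) :=
  contMDiffAt_vectorDerivAlong (𝒢.contMDiffAt_fibreFun (mem_chart_source HG _)) (hξ (𝒢.one m))

theorem IsLieLift.hasFibreComponent {ξ' : ∀ a : AG, TangentSpace IA a} (h : 𝒢.IsLieLift ξ ξ')
    (hξ : 𝒢.IsMultiplicative ξ x) : HasFibreComponent IM ξ' x (𝒢.liftComponent ξ) :=
  fun m X ↦ Prod.ext (x := (show EM × AlgebroidModel EG EM from ξ' ⟨m, X⟩))
    (h.fst_eq hξ ⟨m, X⟩) (h.snd_eq hξ.smooth ⟨m, X⟩)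

theorem IsLieLift.isSmoothVectorField {ξ' : ∀ a : AG, TangentSpace IA a}
    (h : 𝒢.IsLieLift ξ ξ') (hξ : 𝒢.IsMultiplicative ξ x) : IsSmoothVectorField IA ξ' := by
  intro a
  refine contMDiffAt_vectorField_totalSpace hξ.smooth_base (h.fst_eq hξ) ?_
  have hsmooth : ContMDiffAt IA 𝓘(ℝ, AlgebroidModel EG EM) ∞
      (totalDifferential IG (vectorDerivAlong IG ξ (𝒢.fibreFun a.1)) ∘ 𝒢.totalIncl) a :=
    (contMDiffAt_totalDifferential (b := 𝒢.totalIncl a)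
      (contMDiffAt_vectorDerivAlong_fibreFun hξ.smooth a.1)).comp a
        𝒢.contMDiff_totalIncl.contMDiffAt
  refine hsmooth.congr_of_eventuallyEq ?_
  filter_upwards [eventually_proj_mem_baseSet a] with b hb
  have hcoord : (fun c ↦ (trivializationAt (AlgebroidModel EG EM) 𝒢.Algebroid a.1 c).2) =ᶠ[𝓝 b]
      totalDifferential IG (𝒢.fibreFun a.1) ∘ 𝒢.totalIncl := by
    filter_upwards [eventually_proj ((𝒢.isOpen_trivDomain a.1).mem_nhds hb)] with c hc
    exact 𝒢.trivializationAt_snd hc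
  exact (totalDifferential_congr (w := ⟨b, ξ' b⟩) hcoord).trans
    (h.totalDifferential_eq hξ.smooth (𝒢.contMDiffAt_fibreFun (𝒢.one_mem_chart_source hb)))

theorem IsLieLift.isLinearVectorField {ξ' : ∀ a : AG, TangentSpace IA a}
    (h : 𝒢.IsLieLift ξ ξ') (hξ : 𝒢.IsMultiplicative ξ x) : IsLinearVectorField IM ξ' x :=
  (h.hasFibreComponent hξ).isLinearVectorField (h.isSmoothVectorField hξ) hξ.smooth_base

variable [IM.Boundaryless]

theorem sectionCoord_eq_rightInvariant (X : ∀ m, 𝒢.Algebroid m) {m₀ m : M}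
    (hm : m ∈ 𝒢.trivDomain m₀) :
    sectionCoord (AlgebroidModel EG EM) 𝒢.Algebroid X m₀ m =
      vectorDerivAlong IG (𝒢.rightInvariant X) (𝒢.fibreFun m₀) (𝒢.one m) := by
  refine (𝒢.trivializationAt_snd (a := ⟨m, X m⟩) hm).trans ?_
  rw [vectorDerivAlong, 𝒢.rightInvariant_one X m]
  rfl

/- Evaluate the bracket with `X⃗` at `1_m` on the chart function `𝒢.fibreFun m`: as `ξ` is tangent
to the units, `ξ(X⃗ ψ)` only sees the values of `X` along `x`, while `X⃗(ξ ψ)` is tensorial in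
`X m`. -/
theorem IsMultiplicative.hasConnectionTerm (hξ : 𝒢.IsMultiplicative ξ x) :
    HasConnectionTerm IM x (𝒢.liftComponent ξ) hξ.bracketOperator := by
  intro X m
  have hψ := 𝒢.contMDiffAt_fibreFun (m₀ := m) (mem_chart_source HG (𝒢.one m))
  have hX : IsSmoothVectorField IG (𝒢.rightInvariant X) := 𝒢.contMDiff_rightInvariant X
  have hcoord : sectionCoord (AlgebroidModel EG EM) 𝒢.Algebroid X m =ᶠ[𝓝 m]
      vectorDerivAlong IG (𝒢.rightInvariant X) (𝒢.fibreFun m) ∘ 𝒢.one := by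
    filter_upwards [(𝒢.isOpen_trivDomain m).mem_nhds (𝒢.mem_trivDomain m)] with m' hm'
    exact sectionCoord_eq_rightInvariant X hm'
  have hbase : vectorDerivAlong IM x (sectionCoord (AlgebroidModel EG EM) 𝒢.Algebroid X m) m =
      vectorDerivAlong IG ξ (vectorDerivAlong IG (𝒢.rightInvariant X) (𝒢.fibreFun m))
        (𝒢.one m) :=
    (totalDifferential_congr (w := (⟨m, x m⟩ : TangentBundle IM M)) hcoord).trans
      (vectorDerivAlong_comp_of_related
        ((contMDiffAt_vectorDerivAlong_fibreFun hX m).mdifferentiableAt (by simp))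
        (𝒢.mdifferentiable_one m) (hξ.one m))
  have hfibre : 𝒢.liftComponent ξ m (X m) = vectorDerivAlong IG (𝒢.rightInvariant X)
      (vectorDerivAlong IG ξ (𝒢.fibreFun m)) (𝒢.one m) :=
    congrArg (fun v : TangentSpace IG (𝒢.one m) ↦ totalDifferential IG
      (vectorDerivAlong IG ξ (𝒢.fibreFun m)) ⟨𝒢.one m, v⟩) (𝒢.rightInvariant_one X m).symm
  have hbracket : sectionCoord (AlgebroidModel EG EM) 𝒢.Algebroid (hξ.bracketOperator X) m m =
      vectorDerivAlong IG (mlieBracket IG ξ (𝒢.rightInvariant X)) (𝒢.fibreFun m) (𝒢.one m) :=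
    𝒢.trivializationAt_snd (a := ⟨m, hξ.bracketOperator X m⟩) (𝒢.mem_trivDomain m)
  rw [hbracket, hbase, hfibre]
  exact vectorDerivAlong_mlieBracket (hψ.of_le (by norm_cast)) hξ.smooth.contMDiffAt
    hX.contMDiffAt

theorem IsLieLift.isOperatorOf_iff [T2Space M] {ξ' : ∀ a : AG, TangentSpace IA a}
    (h : 𝒢.IsLieLift ξ ξ') (hξ : 𝒢.IsMultiplicative ξ x) (D : ΓAG → ΓAG) :
    IsOperatorOf IM ξ' x D ↔ D = hξ.bracketOperator :=
  hξ.hasConnectionTerm.isOperatorOf_iff (h.hasFibreComponent hξ) D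

theorem IsMultiplicative.isCovariantDifferentialOperator (hξ : 𝒢.IsMultiplicative ξ x) :
    IsCovariantDifferentialOperator IM x hξ.bracketOperator :=
  hξ.hasConnectionTerm.isCovariantDifferentialOperator

end LiftedOperator

section Anchor

variable [IM.Boundaryless]

theorem mfderiv_tgt_rightInvariant (X : ∀ m, 𝒢.Algebroid m) (g : G) :
    mfderiv IG IM 𝒢.tgt g (𝒢.rightInvariant X g) = 𝒢.anchor (𝒢.tgt g) (X (𝒢.tgt g)) := by
  have h := 𝒢.tangentMap_tgt_rightMul (g := g) (𝒢.src_totalIncl _)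
    (𝒢.mfderiv_src_totalIncl ⟨𝒢.tgt g, X (𝒢.tgt g)⟩)
  rw [← 𝒢.mk_rightInvariant, ← 𝒢.mk_anchor] at h
  exact snd_eq_of_mk_eq (W := fun m ↦ 𝒢.anchor m (X m)) h

variable {𝒢} {ξ : ∀ g : G, TangentSpace IG g} {x : ∀ m : M, TangentSpace IM m}

theorem IsMultiplicative.anchor_bracketOperator (hξ : 𝒢.IsMultiplicative ξ x) {D : ΓAG → ΓAG}
    (hD : 𝒢.IsBracketOperator ξ D) (X : ΓAG) (m : M) :
    𝒢.anchor m (D X m) = mlieBracket IM x (fun m' ↦ 𝒢.anchor m' (X m')) m := by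
  have hX : IsSmoothVectorField IM (fun m' ↦ 𝒢.anchor m' (X m')) :=
    𝒢.contMDiff_anchor.comp X.contMDiff
  have hrelated := mfderiv_mlieBracket_of_forall_related 𝒢.contMDiff_tgt hξ.smooth
    (𝒢.contMDiff_rightInvariant X) hξ.smooth_base hX hξ.tgt (𝒢.mfderiv_tgt_rightInvariant X)
    (𝒢.one m)
  rw [← hD.incl_eq] at hrelated
  exact snd_eq_of_mk_eq (q := 𝒢.tgt (𝒢.one m))
    (W := fun m ↦ mlieBracket IM x (fun m' ↦ 𝒢.anchor m' (X m')) m)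
    ((𝒢.mk_anchor ⟨m, D X m⟩).trans (congrArg (TotalSpace.mk (𝒢.tgt (𝒢.one m))) hrelated))

end Anchor

end LieGroupoid

/-! ### The pair groupoid -/

section PairGroupoid

open LieGroupoid

variable
    {E : Type*} [NormedAddCommGroup E] [NormedSpace ℝ E]
    {H : Type*} [TopologicalSpace H] {I : ModelWithCorners ℝ E H}
    {M : Type*} [TopologicalSpace M] [ChartedSpace H M]

local notation "IA" => ModelWithCorners.prod I 𝓘(ℝ, AlgebroidModel (E × E) E)
local notation "AG" =>
  TotalSpace (AlgebroidModel (E × E) E) (LieGroupoid.Algebroid (pairGroupoid I M))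

theorem pairGroupoid_anchor (m : M) (a : (pairGroupoid I M).Algebroid m) :
    (pairGroupoid I M).anchor m a = (show E × E from (pairGroupoid I M).incl m a).1 :=
  DFunLike.congr_fun (mfderiv_fst (I := I) (I' := I) (x := (m, m))) ((pairGroupoid I M).incl m a)

theorem pairGroupoid_incl_snd (m : M) (a : (pairGroupoid I M).Algebroid m) :
    (show E × E from (pairGroupoid I M).incl m a).2 = 0 :=
  (DFunLike.congr_fun (mfderiv_snd (I := I) (I' := I) (x := (m, m)))
    ((pairGroupoid I M).incl m a)).symm.trans ((pairGroupoid I M).mfderiv_src_incl m a)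

section PairField

variable {x : ∀ m : M, TangentSpace I m}

theorem mfderiv_fst_pairField (g : M × M) :
    mfderiv (I.prod I) I Prod.fst g (pairField I x g) = x g.1 :=
  DFunLike.congr_fun (mfderiv_fst (I := I) (I' := I) (x := g)) (pairField I x g)

theorem mfderiv_snd_pairField (g : M × M) :
    mfderiv (I.prod I) I Prod.snd g (pairField I x g) = x g.2 :=
  DFunLike.congr_fun (mfderiv_snd (I := I) (I' := I) (x := g)) (pairField I x g)

theorem hasMFDerivAt_pairGroupoid_mul (z : (M × M) × (M × M)) :
    HasMFDerivAt ((I.prod I).prod (I.prod I)) (I.prod I)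
      (fun z : (M × M) × (M × M) ↦ (pairGroupoid I M).mul z.1 z.2) z
      (((ContinuousLinearMap.fst ℝ E E ∘L ContinuousLinearMap.fst ℝ (E × E) (E × E)).prod
        (ContinuousLinearMap.snd ℝ E E ∘L ContinuousLinearMap.snd ℝ (E × E) (E × E))) :
        (E × E) × (E × E) →L[ℝ] E × E) :=
  ((hasMFDerivAt_fst (I := I) (I' := I) (x := z.1)).comp z
    (hasMFDerivAt_fst (I := I.prod I) (I' := I.prod I) (x := z))).prodMk
  ((hasMFDerivAt_snd (I := I) (I' := I) (x := z.2)).comp z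
    (hasMFDerivAt_snd (I := I.prod I) (I' := I.prod I) (x := z)))

variable [IsManifold I ∞ M]

theorem eventuallyEq_vectorDerivAlong_pairField (m : M) :
    vectorDerivAlong (I.prod I) (pairField I x) (extChartAt I m ∘ Prod.fst) =ᶠ[𝓝 (m, m)]
      vectorDerivAlong I x (extChartAt I m) ∘ Prod.fst := by
  filter_upwards [(continuousAt_fst (p := (m, m))).eventually (chart_source_mem_nhds H m)]
    with g hg
  exact vectorDerivAlong_comp_of_related (mdifferentiableAt_extChartAt (I := I) hg)
    mdifferentiableAt_fst (mfderiv_fst_pairField g)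

variable [FiniteDimensional ℝ E] [I.Boundaryless]

theorem isTangentTo_composable_pairField {g h : M × M}
    (hgh : (g, h) ∈ (pairGroupoid I M).composable) :
    IsTangentTo (pairGroupoid I M).composable
      (⟨(g, h), (pairField I x g, pairField I x h)⟩ :
        TangentBundle ((I.prod I).prod (I.prod I)) ((M × M) × (M × M))) := by
  refine (pairGroupoid I M).isTangentTo_composable (b := ⟨g, pairField I x g⟩)
    (b' := ⟨h, pairField I x h⟩) ?_
  have hsrc : tangentMap (I.prod I) I (pairGroupoid I M).src ⟨g, pairField I x g⟩ =
      ⟨g.2, x g.2⟩ := congrArg (TotalSpace.mk g.2) (mfderiv_snd_pairField g)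
  have htgt : tangentMap (I.prod I) I (pairGroupoid I M).tgt ⟨h, pairField I x h⟩ =
      ⟨h.1, x h.1⟩ := congrArg (TotalSpace.mk h.1) (mfderiv_fst_pairField h)
  have hmeet : g.2 = h.1 := hgh
  rw [hsrc, htgt, hmeet]

theorem isMultiplicative_pairField (hx : IsSmoothVectorField I x) :
    (pairGroupoid I M).IsMultiplicative (pairField I x) x where
  smooth := hx.prod hx
  smooth_base := hx
  src := mfderiv_snd_pairField
  tgt := mfderiv_fst_pairField
  one m := DFunLike.congr_fun
    ((hasMFDerivAt_id (I := I) m).prodMk (hasMFDerivAt_id (I := I) m)).mfderiv (x m)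
  mul g h hgh := by
    have hmul := hasMFDerivAt_pairGroupoid_mul (I := I) (g, h)
    have htangent := (pairGroupoid I M).tangentMap_mul_extension
      (b := ⟨(g, h), (pairField I x g, pairField I x h)⟩) hmul.mdifferentiableAt
      (.of_forall fun _ _ ↦ rfl) hgh (isTangentTo_composable_pairField hgh)
    refine snd_eq_of_mk_eq (W := pairField I x) (p := (pairGroupoid I M).mul g h)
      (q := (g.1, h.2)) (htangent.symm.trans ?_)
    exact congrArg (TotalSpace.mk (g.1, h.2))
      (DFunLike.congr_fun hmul.mfderiv (pairField I x g, pairField I x h))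

end PairField

variable [IsManifold I ∞ M] [FiniteDimensional ℝ E] [I.Boundaryless]

/-- The inverse of the anchor of the pair groupoid: `v` is the anchor of `(v, 0)`. -/
def pairAnchorInv (v : TangentBundle I M) : AG :=
  ⟨v.1, (pairGroupoid I M).mkAlgebroid v.1 ((v.2, 0) : E × E)
    (DFunLike.congr_fun (mfderiv_snd (I := I) (I' := I) (x := (v.1, v.1))) ((v.2, 0) : E × E))⟩

theorem contMDiff_pairAnchorInv : ContMDiff I.tangent IA ∞ (pairAnchorInv (I := I) (M := M)) := by
  intro v
  refine (pairGroupoid I M).contMDiffAt_of_totalIncl ?_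
  have hpair : ContMDiff I.tangent (I.tangent.prod I.tangent) ∞
      (fun v : TangentBundle I M ↦ (v, (⟨v.1, 0⟩ : TangentBundle I M))) :=
    contMDiff_id.prodMk (isSmoothVectorField_zero.comp
      (contMDiff_proj (TangentSpace I : M → Type _)))
  exact (contMDiff_equivTangentBundleProd_symm.comp hpair).contMDiffAt

variable (I M) in
/-- The anchor of the pair groupoid as a diffeomorphism onto the tangent bundle. -/
def pairAnchor : Diffeomorph IA I.tangent AG (TangentBundle I M) ∞ where
  toFun a := ⟨a.1, (pairGroupoid I M).anchor a.1 a.2⟩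
  invFun := pairAnchorInv
  left_inv a := by
    refine congrArg (TotalSpace.mk a.1) ((pairGroupoid I M).incl_injective a.1 ?_)
    exact Prod.ext (x := (_ : E × E)) (y := (_ : E × E)) (pairGroupoid_anchor a.1 a.2)
      (pairGroupoid_incl_snd a.1 a.2).symm
  right_inv v := congrArg (TotalSpace.mk v.1) (pairGroupoid_anchor v.1 (pairAnchorInv v).2)
  contMDiff_toFun := (pairGroupoid I M).contMDiff_anchor
  contMDiff_invFun := contMDiff_pairAnchorInv

theorem mdifferentiable_pairAnchor : MDifferentiable IA I.tangent (pairAnchor I M) :=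
  (pairAnchor I M).contMDiff.mdifferentiable (by simp)

theorem pairAnchor_eq_tangentMap_fst (a : AG) :
    pairAnchor I M a = tangentMap (I.prod I) I Prod.fst ((pairGroupoid I M).totalIncl a) :=
  (pairGroupoid I M).mk_anchor a

theorem eventuallyEq_totalDifferential_comp_pairAnchor (a : AG) :
    totalDifferential I (extChartAt I a.1) ∘ pairAnchor I M =ᶠ[𝓝 a]
      totalDifferential (I.prod I) (extChartAt I a.1 ∘ Prod.fst) ∘
        (pairGroupoid I M).totalIncl := by
  filter_upwards [eventually_proj (a := a) (chart_source_mem_nhds H a.1)] with b hb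
  rw [comp_apply, pairAnchor_eq_tangentMap_fst]
  exact (totalDifferential_comp (b := (pairGroupoid I M).totalIncl b)
    (mdifferentiableAt_extChartAt (I := I) hb) mdifferentiableAt_fst).symm

variable {x : ∀ m : M, TangentSpace I m}

theorem mfderiv_pairAnchor_snd (hx : IsSmoothVectorField I x) {ξ' : ∀ a : AG, TangentSpace IA a}
    (hξ' : (pairGroupoid I M).IsLieLift (pairField I x) ξ') (a : AG) :
    (show E × E from mfderiv IA I.tangent (pairAnchor I M) a (ξ' a)).2 =
      completeLiftComponent x a.1 (pairAnchor I M a).2 := by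
  let w : TangentBundle IA AG := ⟨a, ξ' a⟩
  have hchart : ContMDiffAt (I.prod I) 𝓘(ℝ, E) ∞ (extChartAt I a.1 ∘ Prod.fst) (a.1, a.1) :=
    contMDiffAt_extChartAt.comp (I' := I) (a.1, a.1) contMDiffAt_fst
  have hanchor := totalDifferential_comp (b := w) ((contMDiffAt_totalDifferential_extChartAt
    (pairAnchor I M a)).mdifferentiableAt (by simp)) (mdifferentiable_pairAnchor a)
  have hlift := hξ'.totalDifferential_eq (isMultiplicative_pairField hx).smooth (a := a) hchart
  have hfst := totalDifferential_comp (b := (pairGroupoid I M).totalIncl a)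
    ((contMDiffAt_vectorDerivAlong contMDiffAt_extChartAt (hx a.1)).mdifferentiableAt (by simp))
    (mdifferentiableAt_fst (x := (a.1, a.1)))
  rw [← pairAnchor_eq_tangentMap_fst] at hfst
  calc (show E × E from mfderiv IA I.tangent (pairAnchor I M) a (ξ' a)).2
    _ = totalDifferential I.tangent (totalDifferential I (extChartAt I a.1))
          (tangentMap IA I.tangent (pairAnchor I M) w) :=
      (mfderiv_totalDifferential_extChartAt (pairAnchor I M a) _).symm
    _ = totalDifferential IA (totalDifferential I (extChartAt I a.1) ∘ pairAnchor I M) w :=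
      hanchor.symm
    _ = totalDifferential IA (totalDifferential (I.prod I) (extChartAt I a.1 ∘ Prod.fst) ∘
          (pairGroupoid I M).totalIncl) w :=
      totalDifferential_congr (eventuallyEq_totalDifferential_comp_pairAnchor a)
    _ = totalDifferential (I.prod I) (vectorDerivAlong (I.prod I) (pairField I x)
          (extChartAt I a.1 ∘ Prod.fst)) ((pairGroupoid I M).totalIncl a) := hlift
    _ = totalDifferential (I.prod I) (vectorDerivAlong I x (extChartAt I a.1) ∘ Prod.fst)
          ((pairGroupoid I M).totalIncl a) :=
      totalDifferential_congr (eventuallyEq_vectorDerivAlong_pairField a.1)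
    _ = completeLiftComponent x a.1 (pairAnchor I M a).2 := hfst

theorem mfderiv_pairAnchor (hx : IsSmoothVectorField I x) {ξ' : ∀ a : AG, TangentSpace IA a}
    (hξ' : (pairGroupoid I M).IsLieLift (pairField I x) ξ') (a : AG) :
    mfderiv IA I.tangent (pairAnchor I M) a (ξ' a) = completeLift x (pairAnchor I M a) := by
  have hπ : MDifferentiableAt I.tangent I (π E (TangentSpace I)) (pairAnchor I M a) :=
    (contMDiff_proj (TangentSpace I : M → Type _) (n := ∞)).mdifferentiable (by simp) _
  set Z : TangentSpace I.tangent (pairAnchor I M a) :=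
    mfderiv IA I.tangent (pairAnchor I M) a (ξ' a)
  have hbase : (show E × E from Z).1 = x a.1 := by
    have hproj := DFunLike.congr_fun (mfderiv_comp a hπ (mdifferentiable_pairAnchor a)) (ξ' a)
    exact (mfderiv_proj_apply (I := I) (pairAnchor I M a) Z).symm.trans
      (hproj.symm.trans ((mfderiv_proj_apply (I := I) a (ξ' a)).trans
        (hξ'.fst_eq (isMultiplicative_pairField hx) a)))
  exact Prod.ext (x := (show E × E from Z)) hbase (mfderiv_pairAnchor_snd hx hξ' a)

end PairGroupoid

end

theorem mainTheorem2_general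
    {EG : Type*} [NormedAddCommGroup EG] [NormedSpace ℝ EG] [FiniteDimensional ℝ EG]
    {HG : Type*} [TopologicalSpace HG] (IG : ModelWithCorners ℝ EG HG) [IG.Boundaryless]
    (G : Type*) [TopologicalSpace G] [ChartedSpace HG G] [IsManifold IG ∞ G]
    {EM : Type*} [NormedAddCommGroup EM] [NormedSpace ℝ EM] [FiniteDimensional ℝ EM]
    {HM : Type*} [TopologicalSpace HM] (IM : ModelWithCorners ℝ EM HM) [IM.Boundaryless]
    (M : Type*) [TopologicalSpace M] [ChartedSpace HM M] [IsManifold IM ∞ M] [T2Space M]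
    (𝒢 : LieGroupoid IG G IM M) :
    (BijOn 𝒢.jMap univ 𝒢.tangentAlgebroid ∧
      ∀ (ξ : ∀ g : G, TangentSpace IG g) (x : ∀ m : M, TangentSpace IM m),
        𝒢.IsMultiplicative ξ x →
        (∀ a, 𝒢.lieFunctor ξ a ∈ 𝒢.tangentAlgebroid) ∧
        ∃ ξ' : ∀ a : TotalSpace (LieGroupoid.AlgebroidModel EG EM) 𝒢.Algebroid,
            TangentSpace (IM.prod 𝓘(ℝ, LieGroupoid.AlgebroidModel EG EM)) a,
          𝒢.IsLieLift ξ ξ' ∧ IsLinearVectorField IM ξ' x ∧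
          ∃ Dξ Dξ' : Cₛ^∞⟮IM; LieGroupoid.AlgebroidModel EG EM, 𝒢.Algebroid⟯ →
              Cₛ^∞⟮IM; LieGroupoid.AlgebroidModel EG EM, 𝒢.Algebroid⟯,
            (∀ D, 𝒢.IsBracketOperator ξ D ↔ D = Dξ) ∧
            (∀ D, IsOperatorOf IM ξ' x D ↔ D = Dξ') ∧
            IsCovariantDifferentialOperator IM x Dξ' ∧
            Dξ' = Dξ) ∧
    (∀ x : ∀ m : M, TangentSpace IM m, IsSmoothVectorField IM x →
      (pairGroupoid IM M).IsMultiplicative (pairField IM x) x ∧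
      ∃ ξ' : ∀ a : TotalSpace (LieGroupoid.AlgebroidModel (EM × EM) EM)
            (pairGroupoid IM M).Algebroid,
          TangentSpace (IM.prod 𝓘(ℝ, LieGroupoid.AlgebroidModel (EM × EM) EM)) a,
        (pairGroupoid IM M).IsLieLift (pairField IM x) ξ' ∧
        ∃ x' : ∀ v : TangentBundle IM M, TangentSpace IM.tangent v,
          IsCompleteLift IM x x' ∧
          (∃ Φ : Diffeomorph (IM.prod 𝓘(ℝ, LieGroupoid.AlgebroidModel (EM × EM) EM)) IM.tangent
              (TotalSpace (LieGroupoid.AlgebroidModel (EM × EM) EM) (pairGroupoid IM M).Algebroid)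
              (TangentBundle IM M) ∞,
            (∀ a, Φ a = ⟨a.1, (pairGroupoid IM M).anchor a.1 a.2⟩) ∧
            ∀ a, mfderiv (IM.prod 𝓘(ℝ, LieGroupoid.AlgebroidModel (EM × EM) EM)) IM.tangent Φ a
              (ξ' a) = x' (Φ a)) ∧
          IsLinearVectorField IM x' x ∧
          (∃ L : Cₛ^∞⟮IM; EM, (TangentSpace IM : M → Type _)⟯ →
              Cₛ^∞⟮IM; EM, (TangentSpace IM : M → Type _)⟯,
            (∀ y m, L y m = mlieBracket IM x y m) ∧
            ∀ D, IsOperatorOf IM x' x D ↔ D = L) ∧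
          ∀ D, (pairGroupoid IM M).IsBracketOperator (pairField IM x) D → ∀ X m,
            (pairGroupoid IM M).anchor m (D X m) =
              mlieBracket IM x (fun m' ↦ (pairGroupoid IM M).anchor m' (X m')) m) := by
  refine ⟨⟨𝒢.bijOn_jMap, fun ξ x hξ ↦ ?_⟩, fun x hx ↦ ?_⟩
  · obtain ⟨ξ', hξ'⟩ := LieGroupoid.exists_isLieLift hξ
    exact ⟨LieGroupoid.lieFunctor_mem_tangentAlgebroid hξ, ξ', hξ', hξ'.isLinearVectorField hξ,
      hξ.bracketOperator, hξ.bracketOperator, hξ.isBracketOperator_iff, hξ'.isOperatorOf_iff hξ,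
      hξ.isCovariantDifferentialOperator, rfl⟩
  · have hξ := isMultiplicative_pairField hx
    obtain ⟨ξ', hξ'⟩ := LieGroupoid.exists_isLieLift hξ
    exact ⟨hξ, ξ', hξ', completeLift x, isCompleteLift_completeLift hx,
      ⟨pairAnchor IM M, fun _ ↦ rfl, mfderiv_pairAnchor hx hξ'⟩,
      isLinearVectorField_completeLift hx,
      ⟨lieDerivative hx, fun _ _ ↦ rfl,
        (hasConnectionTerm_lieDerivative hx).isOperatorOf_iff hasFibreComponent_completeLift⟩,
      fun _ hD ↦ hξ.anchor_bracketOperator hD⟩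

theorem mainTheorem2
    {EG : Type*} [NormedAddCommGroup EG] [NormedSpace ℝ EG] [FiniteDimensional ℝ EG]
    {HG : Type*} [TopologicalSpace HG] (IG : ModelWithCorners ℝ EG HG) [IG.Boundaryless]
    (G : Type*) [TopologicalSpace G] [ChartedSpace HG G] [IsManifold IG ∞ G] [T2Space G]
    {EM : Type*} [NormedAddCommGroup EM] [NormedSpace ℝ EM] [FiniteDimensional ℝ EM]
    {HM : Type*} [TopologicalSpace HM] (IM : ModelWithCorners ℝ EM HM) [IM.Boundaryless]
    (M : Type*) [TopologicalSpace M] [ChartedSpace HM M] [IsManifold IM ∞ M] [T2Space M]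
    (𝒢 : LieGroupoid IG G IM M) :
    (BijOn 𝒢.jMap univ 𝒢.tangentAlgebroid ∧
      ∀ (ξ : ∀ g : G, TangentSpace IG g) (x : ∀ m : M, TangentSpace IM m),
        𝒢.IsMultiplicative ξ x →
        (∀ a, 𝒢.lieFunctor ξ a ∈ 𝒢.tangentAlgebroid) ∧
        ∃ ξ' : ∀ a : TotalSpace (LieGroupoid.AlgebroidModel EG EM) 𝒢.Algebroid,
            TangentSpace (IM.prod 𝓘(ℝ, LieGroupoid.AlgebroidModel EG EM)) a,
          𝒢.IsLieLift ξ ξ' ∧ IsLinearVectorField IM ξ' x ∧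
          ∃ Dξ Dξ' : Cₛ^∞⟮IM; LieGroupoid.AlgebroidModel EG EM, 𝒢.Algebroid⟯ →
              Cₛ^∞⟮IM; LieGroupoid.AlgebroidModel EG EM, 𝒢.Algebroid⟯,
            (∀ D, 𝒢.IsBracketOperator ξ D ↔ D = Dξ) ∧
            (∀ D, IsOperatorOf IM ξ' x D ↔ D = Dξ') ∧
            IsCovariantDifferentialOperator IM x Dξ' ∧
            Dξ' = Dξ) ∧
    (∀ x : ∀ m : M, TangentSpace IM m, IsSmoothVectorField IM x →
      (pairGroupoid IM M).IsMultiplicative (pairField IM x) x ∧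
      ∃ ξ' : ∀ a : TotalSpace (LieGroupoid.AlgebroidModel (EM × EM) EM)
            (pairGroupoid IM M).Algebroid,
          TangentSpace (IM.prod 𝓘(ℝ, LieGroupoid.AlgebroidModel (EM × EM) EM)) a,
        (pairGroupoid IM M).IsLieLift (pairField IM x) ξ' ∧
        ∃ x' : ∀ v : TangentBundle IM M, TangentSpace IM.tangent v,
          IsCompleteLift IM x x' ∧
          (∃ Φ : Diffeomorph (IM.prod 𝓘(ℝ, LieGroupoid.AlgebroidModel (EM × EM) EM)) IM.tangent
              (TotalSpace (LieGroupoid.AlgebroidModel (EM × EM) EM) (pairGroupoid IM M).Algebroid)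
              (TangentBundle IM M) ∞,
            (∀ a, Φ a = ⟨a.1, (pairGroupoid IM M).anchor a.1 a.2⟩) ∧
            ∀ a, mfderiv (IM.prod 𝓘(ℝ, LieGroupoid.AlgebroidModel (EM × EM) EM)) IM.tangent Φ a
              (ξ' a) = x' (Φ a)) ∧
          IsLinearVectorField IM x' x ∧
          (∃ L : Cₛ^∞⟮IM; EM, (TangentSpace IM : M → Type _)⟯ →
              Cₛ^∞⟮IM; EM, (TangentSpace IM : M → Type _)⟯,
            (∀ y m, L y m = mlieBracket IM x y m) ∧
            ∀ D, IsOperatorOf IM x' x D ↔ D = L) ∧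
          ∀ D, (pairGroupoid IM M).IsBracketOperator (pairField IM x) D → ∀ X m,
            (pairGroupoid IM M).anchor m (D X m) =
              mlieBracket IM x (fun m' ↦ (pairGroupoid IM M).anchor m' (X m')) m) :=
  mainTheorem2_general IG G IM M 𝒢
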